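/- **Conventions.** *Operad* means coloured nonsymmetric operad. A *simplicial operad* $\mathcal Q$ is an operad enriched in simplicial sets, equivalently a simplicial object $[m]\mapsto \mathcal Q_m$ in operads all of whose simplicial operators are the identity on colours; $\mathcal Q(a_1,\dots,a_k;b)$ denotes its simplicial sets of operations, and morphisms of simplicial operads form the sets $\mathsf{Op}_\Delta(\mathcal P,\mathcal Q)$. Its *monoidal envelope* $\mathcal L\mathcal Q$ is the simplicial category whose objects are finite sequences of colours, and in which an $m$-simplex of the mapping space from $\underline a$ to $\underline b=(b_1,\dots,b_r)$ is a sequence $(f_1,\dots,f_r)$ of $m$-simplices of operation spaces such that $f_i$ has target $b_i$ and the sources of $f_1,\dots,f_r$ concatenate to $\underline a$; composition is blockwise operadic composition. $\boldsymbol\Delta^n$ is the usual simplicial thickening of $[n]$, and $N_\Delta$ is the homotopy coherent nerve of simplicial categories. For a set $X$ let $\mathcal L X$ be the set of finite sequences in $X$. $\mathsf{List}$ is the category of sets and *listings* (functions $A\to\mathcal L X$), composed by concatenation. A *simplicial list* is a functor $X:\Delta^{op}\to\mathsf{List}$; $\mathcal L X$ is the simplicial set $[n]\mapsto\mathcal L(X_n)$.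 $X$ is *operadic* if $\theta^*:X_n\to \mathcal L X_k$ takes values in sequences of length one for every $\theta:[k]\to[n]$ with $\theta(k)=n$. A *quasi-operad* is an operadic simplicial list $X$ such that $\mathcal L X$ is a quasi-category. Let $\Delta_+$ be the category of finite ordinals (including $\emptyset$) and monotone maps, ordinals being considered up to unique isomorphism. An $n$-simplex $\alpha=(A_0\to\cdots\to A_n)$ of $N(\Delta_+)$ is *rooted* if $|A_n|=1$. For $a\in A_n$ let $\alpha_a$ be the rooted simplex formed by the preimages of $a$ in $A_0,\dots,A_n$. For an $n$-simplex $\alpha$ let $\mathbb V_\alpha$ be the simplicial operad with set of colours $\coprod_i A_i$ whose operad of $m$-simplices is generated by the operations $$(f,a):(b_1,\dots,b_k)\to a,\qquad f\in\boldsymbol\Delta^n(i,j)_m,\ a\in A_j,$$ where $b_1<\dots<b_k$ are the elements of $A_i$ over $a$, subject to the relations $(1_i,a)=1_a$ and $(g\circ f,a)=(g,a)\circ\big((f,b_1),\dots,(f,b_k)\big)$, where $g\in\boldsymbol\Delta^n(j,l)_m$, $a\in A_l$, and $b_1<\dots<b_k$ are the elements of $A_j$ over $a$; simplicial operators act on $f$.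 For $\theta:[k]\to[n]$ and $a\in A_{\theta(k)}$ there is an induced morphism $(\theta,a):\mathbb V_{(\theta^*\alpha)_a}\to\mathbb V_{\theta^*\alpha}\to\mathbb V_\alpha$. The *homotopy coherent list nerve* of a simplicial operad $\mathcal Q$ is the simplicial list $N^l_\Delta\mathcal Q$ with $$(N^l_\Delta\mathcal Q)_n=\coprod_{\alpha\in N(\Delta_+)_n\ \text{rooted}}\mathsf{Op}_\Delta(\mathbb V_\alpha,\mathcal Q),$$ in which, for $x:\mathbb V_\alpha\to\mathcal Q$ and $\theta:[k]\to[n]$, the listing is $\theta^*x=\big(x\circ(\theta,a)\big)_{a\in A_{\theta(k)}}$. **Theorem.** Let $\mathcal Q$ be a simplicial operad all of whose operation spaces $\mathcal Q(a_1,\dots,a_k;b)$ are Kan complexes. Then $N^l_\Delta\mathcal Q$ is a quasi-operad. Moreover, there is an isomorphism of simplicial sets $\mathcal L(N^l_\Delta\mathcal Q)\cong N_\Delta(\mathcal L\mathcal Q)$, and $N_\Delta(\mathcal L\mathcal Q)$ is a quasi-category. -/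

import Mathlib

open CategoryTheory MonoidalCategory Opposite

universe w w' w'' u u' u''

namespace ListNerve

/-! ### Colored nonsymmetric operads -/

/-- The data of a (colored, nonsymmetric) operad with set of colors `C`, before the unit and
associativity laws: a set of operations, each with a source list of colors and a target color,
identity operations, and a composite `g ∘ (f₁, …, fₖ)` for every operation `g : (b₁, …, bₖ) → c`
and every list of operations `fᵢ` with targets `bᵢ`. -/
structure OperadData (C : Type w) where
  Op : Type u
  src : Op → List C
  tgt : Op → C
  one : C → Op
  src_one : ∀ c, src (one c) = [c]
  tgt_one : ∀ c, tgt (one c) = c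
  comp : (g : Op) → (fs : List Op) → fs.map tgt = src g → Op
  src_comp : ∀ g fs h, src (comp g fs h) = fs.flatMap src
  tgt_comp : ∀ g fs h, tgt (comp g fs h) = tgt g

namespace OperadData

variable {C : Type w}

/-- Composition of lists of operations: given a list `gs` of operations and a list `fs` of
operations whose targets form the concatenation of the sources of `gs`, cut `fs` into consecutive
blocks and compose each member of `gs` with its block. -/
def compList (P : OperadData.{w, u} C) :
    (gs fs : List P.Op) → fs.map P.tgt = gs.flatMap P.src → List P.Op
  | [], _, _ => []
  | g :: gs, fs, h =>
      P.comp g (fs.take (P.src g).length) (by rw [List.map_take, h]; simp) ::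
        P.compList gs (fs.drop (P.src g).length) (by rw [List.map_drop, h]; simp)

theorem compList_congr (P : OperadData.{w, u} C) {gs gs' fs fs' : List P.Op}
    (hg : gs = gs') (hf : fs = fs') (h : fs.map P.tgt = gs.flatMap P.src) :
    P.compList gs fs h = P.compList gs' fs' (by rw [← hg, ← hf, h]) := by
  subst hg hf; rfl

theorem comp_congr (P : OperadData.{w, u} C) {g g' : P.Op} {fs fs' : List P.Op}
    (hg : g = g') (hf : fs = fs') (h : fs.map P.tgt = P.src g) :
    P.comp g fs h = P.comp g' fs' (by rw [← hg, ← hf, h]) := by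
  subst hg hf; rfl

theorem compList_cons_append (P : OperadData.{w, u} C) (g : P.Op) (gs fs fs' : List P.Op)
    (h : fs.map P.tgt = P.src g) (h' : fs'.map P.tgt = gs.flatMap P.src)
    (h'' : (fs ++ fs').map P.tgt = (g :: gs).flatMap P.src) :
    P.compList (g :: gs) (fs ++ fs') h'' = P.comp g fs h :: P.compList gs fs' h' := by
  have hl : (P.src g).length = fs.length := by rw [← h]; simp
  rw [compList]
  congr 1
  · exact P.comp_congr rfl (by simp [hl]) _
  · exact P.compList_congr rfl (by simp [hl]) _

theorem exists_split (P : OperadData.{w, u} C) {as bs : List C} {fs : List P.Op}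
    (h : fs.map P.tgt = as ++ bs) :
    ∃ f₁ f₂, fs = f₁ ++ f₂ ∧ f₁.map P.tgt = as ∧ f₂.map P.tgt = bs := by
  obtain ⟨f₁, f₂, h1, h2, h3⟩ := List.map_eq_append_iff.1 h
  exact ⟨f₁, f₂, h1, h2, h3⟩

theorem compList_map_tgt (P : OperadData.{w, u} C) (gs fs : List P.Op)
    (h : fs.map P.tgt = gs.flatMap P.src) : (P.compList gs fs h).map P.tgt = gs.map P.tgt := by
  induction gs generalizing fs with
  | nil => rfl
  | cons g gs ih => simp [compList, P.tgt_comp, ih]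

theorem compList_flatMap_src (P : OperadData.{w, u} C) (gs fs : List P.Op)
    (h : fs.map P.tgt = gs.flatMap P.src) :
    (P.compList gs fs h).flatMap P.src = fs.flatMap P.src := by
  induction gs generalizing fs with
  | nil =>
    have : fs = [] := by simpa using h
    simp [compList, this]
  | cons g gs ih =>
    rw [compList, List.flatMap_cons, P.src_comp, ih, ← List.flatMap_append, List.take_append_drop]

theorem compList_append (P : OperadData.{w, u} C) (gs gs' fs fs' : List P.Op)
    (h : fs.map P.tgt = gs.flatMap P.src) (h' : fs'.map P.tgt = gs'.flatMap P.src) :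
    P.compList (gs ++ gs') (fs ++ fs') (by simp [h, h']) =
      P.compList gs fs h ++ P.compList gs' fs' h' := by
  induction gs generalizing fs with
  | nil =>
    have : fs = [] := by simpa using h
    subst this
    rfl
  | cons g gs ih =>
    obtain ⟨f₁, f₂, rfl, h1, h2⟩ := P.exists_split (h.trans List.flatMap_cons)
    rw [P.compList_cons_append g gs f₁ f₂ h1 h2]
    refine (P.compList_congr (List.cons_append) (List.append_assoc f₁ f₂ fs') _).trans ?_
    rw [P.compList_cons_append g (gs ++ gs') f₁ (f₂ ++ fs') h1 (by simp [h2, h']), ih f₂ h2,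
      List.cons_append]

end OperadData

/-- A (colored, nonsymmetric) operad with set of colors `C`. -/
structure Operad (C : Type w) extends OperadData.{w, u} C where
  one_comp : ∀ f, comp (one (tgt f)) [f] (by simp [src_one]) = f
  comp_one : ∀ g, comp g ((src g).map one) (by simp [tgt_one, Function.comp_def]) = g
  assoc : ∀ g fs hs (h : fs.map tgt = src g) (h' : hs.map tgt = fs.flatMap src),
    comp (comp g fs h) hs (h'.trans (src_comp g fs h).symm) =
      comp g (toOperadData.compList fs hs h') ((toOperadData.compList_map_tgt fs hs h').trans h)

namespace Operad

variable {C : Type w} (P : Operad.{w, u} C)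

theorem compList_one (gs fs : List P.Op) (h : fs.map P.tgt = gs.flatMap P.src)
    (hf : fs = (gs.flatMap P.src).map P.one) : P.compList gs fs h = gs := by
  subst hf
  induction gs with
  | nil => rfl
  | cons g gs ih =>
    have e : ((g :: gs).flatMap P.src).map P.one =
      (P.src g).map P.one ++ (gs.flatMap P.src).map P.one := by simp
    have h1 : ((P.src g).map P.one).map P.tgt = P.src g := by
      simp [P.tgt_one, Function.comp_def]
    have h2 : ((gs.flatMap P.src).map P.one).map P.tgt = gs.flatMap P.src := by
      simp [P.tgt_one, Function.comp_def]
    rw [P.compList_congr rfl e h, P.compList_cons_append g gs _ _ h1 h2, P.comp_one, ih]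

theorem one_compList (gs fs : List P.Op) (h : fs.map P.tgt = gs.flatMap P.src)
    (hg : gs = (fs.map P.tgt).map P.one) : P.compList gs fs h = fs := by
  subst hg
  induction fs with
  | nil => rfl
  | cons f fs ih =>
    have h1 : [f].map P.tgt = P.src (P.one (P.tgt f)) := by simp [P.src_one]
    have h2 : fs.map P.tgt = ((fs.map P.tgt).map P.one).flatMap P.src := by
      rw [List.flatMap_map]
      simp only [P.src_one]
      exact (List.flatMap_singleton' _).symm
    have := P.compList_cons_append (P.one (P.tgt f)) ((fs.map P.tgt).map P.one) [f] fs h1 h2 h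
    exact this.trans (by rw [P.one_comp, ih])

theorem compList_assoc (hs gs fs : List P.Op) (h : gs.map P.tgt = hs.flatMap P.src)
    (h' : fs.map P.tgt = gs.flatMap P.src) :
    P.compList (P.compList hs gs h) fs (h'.trans (P.compList_flatMap_src hs gs h).symm) =
      P.compList hs (P.compList gs fs h') ((P.compList_map_tgt gs fs h').trans h) := by
  induction hs generalizing gs fs with
  | nil => rfl
  | cons k hs ih =>
    obtain ⟨g₁, g₂, rfl, hg1, hg2⟩ := P.exists_split (h.trans List.flatMap_cons)
    obtain ⟨f₁, f₂, rfl, hf1, hf2⟩ := P.exists_split (h'.trans List.flatMap_append)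
    rw [P.compList_congr (P.compList_cons_append k hs g₁ g₂ hg1 hg2 h) rfl,
      P.compList_cons_append _ _ f₁ f₂ (hf1.trans (P.src_comp k g₁ hg1).symm)
        (hf2.trans (P.compList_flatMap_src hs g₂ hg2).symm), ih g₂ f₂ hg2 hf2,
      P.compList_congr rfl (P.compList_append g₁ g₂ f₁ f₂ hf1 hf2),
      P.compList_cons_append k hs _ _ ((P.compList_map_tgt g₁ f₁ hf1).trans hg1)
        ((P.compList_map_tgt g₂ f₂ hf2).trans hg2), P.assoc k g₁ f₁ hg1 hf1]

end Operad

/-- A morphism of operads lying over a function `φ` on colors. -/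
@[ext]
structure OperadHom {C : Type w} {D : Type w'} (P : OperadData.{w, u} C) (Q : OperadData.{w', u'} D)
    (φ : C → D) where
  op : P.Op → Q.Op
  src_op : ∀ f, Q.src (op f) = (P.src f).map φ
  tgt_op : ∀ f, Q.tgt (op f) = φ (P.tgt f)
  op_one : ∀ c, op (P.one c) = Q.one (φ c)
  op_comp : ∀ g fs (h : fs.map P.tgt = P.src g),
    op (P.comp g fs h) = Q.comp (op g) (fs.map op) (by
      rw [src_op, ← h, List.map_map, List.map_map]; exact List.map_congr_left fun f _ => tgt_op f)

namespace OperadHom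

variable {C : Type w} {D : Type w'} {E : Type w''} {P : OperadData.{w, u} C}
  {Q : OperadData.{w', u'} D} {R : OperadData.{w'', u''} E} {φ : C → D} {ψ : D → E}

theorem map_tgt (F : OperadHom P Q φ) (fs : List P.Op) :
    (fs.map F.op).map Q.tgt = (fs.map P.tgt).map φ := by
  simp [F.tgt_op]

theorem flatMap_src (F : OperadHom P Q φ) (fs : List P.Op) :
    (fs.map F.op).flatMap Q.src = (fs.flatMap P.src).map φ := by
  simp [List.flatMap_map, List.map_flatMap, F.src_op]

theorem op_compList (F : OperadHom P Q φ) (gs fs : List P.Op)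
    (h : fs.map P.tgt = gs.flatMap P.src) :
    (P.compList gs fs h).map F.op = Q.compList (gs.map F.op) (fs.map F.op)
      (by rw [F.map_tgt, F.flatMap_src, h]) := by
  induction gs generalizing fs with
  | nil => rfl
  | cons g gs ih =>
    obtain ⟨f₁, f₂, rfl, h1, h2⟩ := P.exists_split (h.trans List.flatMap_cons)
    rw [P.compList_cons_append g gs f₁ f₂ h1 h2, List.map_cons, ih f₂ h2, F.op_comp,
      Q.compList_congr (List.map_cons) (List.map_append),
      Q.compList_cons_append (F.op g) (gs.map F.op) (f₁.map F.op) (f₂.map F.op)]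

def comp (G : OperadHom Q R ψ) (F : OperadHom P Q φ) : OperadHom P R (ψ ∘ φ) where
  op := G.op ∘ F.op
  src_op f := by simp [G.src_op, F.src_op]
  tgt_op f := by simp [G.tgt_op, F.tgt_op]
  op_one c := by simp [G.op_one, F.op_one]
  op_comp g fs h := by simp [G.op_comp, F.op_comp]

end OperadHom

/-! ### Operads presented by generators and relations -/

section Presentation

variable {C : Type w} {E : Type u} (s : E → List C) (t : E → C)

/-- Formal composites of identities and generators `e : s e → t e`. -/
inductive Term : List C → C → Type (max w u)
  | one (c : C) : Term [c] c
  | gen (e : E) : Term (s e) (t e)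
  | comp {n : ℕ} {as : Fin n → List C} {bs : Fin n → C} {bl : List C} {c : C}
      (h : bl = List.ofFn bs) (g : Term bl c) (fs : ∀ i, Term (as i) (bs i)) :
      Term (List.ofFn as).flatten c

/-- Formal composites with their sources and targets, no law being imposed. -/
abbrev freeData : OperadData.{w, max w u} C where
  Op := Σ (as : List C) (c : C), Term s t as c
  src f := f.1
  tgt f := f.2.1
  one c := ⟨[c], c, .one c⟩
  src_one _ := rfl
  tgt_one _ := rfl
  comp g fs h := ⟨_, g.2.1, .comp (n := fs.length) (as := fun i => fs[i].1)
    (bs := fun i => fs[i].2.1) (by rw [← h, ← List.ofFn_getElem_eq_map]; rfl) g.2.2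
    (fun i => fs[i].2.2)⟩
  src_comp g fs h := by
    change (List.ofFn fun i : Fin fs.length => (fs[i]).1).flatten = _
    rw [List.flatMap_def, ← List.ofFn_getElem_eq_map]; rfl
  tgt_comp _ _ _ := rfl

/-- A generator, as a formal composite. -/
def freeGen (e : E) : (freeData s t).Op := ⟨s e, t e, .gen e⟩

variable {s t} {D : Type w'} (P : OperadData.{w', u'} D) (φ : C → D) (γ : E → P.Op)
  (hs : ∀ e, P.src (γ e) = (s e).map φ) (ht : ∀ e, P.tgt (γ e) = φ (t e))

/-- Evaluation of formal composites. -/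
def interpret : {as : List C} → {c : C} → Term s t as c →
    {p : P.Op // P.src p = as.map φ ∧ P.tgt p = φ c}
  | _, _, .one c => ⟨P.one (φ c), P.src_one _, P.tgt_one _⟩
  | _, _, .gen e => ⟨γ e, hs e, ht e⟩
  | _, _, .comp (n := n) (as := as) (bs := bs) h g fs =>
    ⟨P.comp (interpret g).1 (List.ofFn fun i => (interpret (fs i)).1) (by
        rw [(interpret g).2.1, h, List.map_ofFn, List.map_ofFn]
        congr 1; funext i; exact (interpret (fs i)).2.2),
      by
        rw [P.src_comp, List.flatMap_def, List.map_ofFn, List.map_flatten, List.map_ofFn]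
        congr 2; funext i; exact (interpret (fs i)).2.1,
      by rw [P.tgt_comp]; exact (interpret g).2.2⟩

/-- The morphism out of the formal composites determined by its values on generators. -/
def freeLift : OperadHom (freeData s t) P φ where
  op f := (interpret P φ γ hs ht f.2.2).1
  src_op f := (interpret P φ γ hs ht f.2.2).2.1
  tgt_op f := (interpret P φ γ hs ht f.2.2).2.2
  op_one _ := rfl
  op_comp g fs h := P.comp_congr rfl (by
    rw [← List.ofFn_getElem_eq_map]; rfl) _

end Presentation

section Quotient

variable {C : Type w} (D : OperadData.{w, u} C) (r : D.Op → D.Op → Prop)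

/-- The congruence generated by the operad laws and the (source and target preserving instances of
the) relation `r`. -/
inductive Rel : D.Op → D.Op → Prop
  | rel {f g} : r f g → D.src f = D.src g → D.tgt f = D.tgt g → Rel f g
  | refl (f) : Rel f f
  | symm {f g} : Rel f g → Rel g f
  | trans {f g h} : Rel f g → Rel g h → Rel f h
  | comp {g g' fs fs' h h'} : Rel g g' → fs.length = fs'.length →
      (∀ p ∈ fs.zip fs', Rel p.1 p.2) → Rel (D.comp g fs h) (D.comp g' fs' h')
  | one_comp (f h) : Rel (D.comp (D.one (D.tgt f)) [f] h) f
  | comp_one (g h) : Rel (D.comp g ((D.src g).map D.one) h) g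
  | assoc (g fs hs h h' h₁ h₂) :
      Rel (D.comp (D.comp g fs h) hs h₁) (D.comp g (D.compList fs hs h') h₂)

variable {D r}

theorem Rel.src_tgt {f g : D.Op} (h : Rel D r f g) : D.src f = D.src g ∧ D.tgt f = D.tgt g := by
  induction h with
  | rel _ h1 h2 => exact ⟨h1, h2⟩
  | refl => exact ⟨rfl, rfl⟩
  | symm _ ih => exact ⟨ih.1.symm, ih.2.symm⟩
  | trans _ _ ih1 ih2 => exact ⟨ih1.1.trans ih2.1, ih1.2.trans ih2.2⟩
  | @comp g g' fs fs' h h' _ hl _ ih ih' =>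
    refine ⟨?_, by rw [D.tgt_comp, D.tgt_comp, ih.2]⟩
    rw [D.src_comp, D.src_comp, List.flatMap_def, List.flatMap_def]
    congr 1
    apply List.ext_getElem (by simpa using hl)
    intro i h1 h2
    simp only [List.length_map] at h1 h2
    have := (ih' (fs[i], fs'[i]) (by
      rw [List.mem_iff_getElem]; exact ⟨i, by simp [h1, h2], by simp⟩)).1
    simpa using this
  | one_comp f h => exact ⟨by rw [D.src_comp]; simp, by rw [D.tgt_comp, D.tgt_one]⟩
  | comp_one g h =>
    exact ⟨by rw [D.src_comp]; simp [List.flatMap_map, D.src_one], by rw [D.tgt_comp]⟩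
  | assoc g fs hs h h' h₁ h₂ =>
    exact ⟨by rw [D.src_comp, D.src_comp, D.compList_flatMap_src], by simp only [D.tgt_comp]⟩

variable (D r)

def relSetoid : Setoid D.Op := ⟨Rel D r, .refl, .symm, .trans⟩

theorem out_tgt (f : Quotient (relSetoid D r)) :
    D.tgt f.out = Quotient.lift D.tgt (fun _ _ h => (Rel.src_tgt h).2) f := by
  conv_rhs => rw [← Quotient.out_eq f]
  rfl

theorem out_src (f : Quotient (relSetoid D r)) :
    D.src f.out = Quotient.lift D.src (fun _ _ h => (Rel.src_tgt h).1) f := by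
  conv_rhs => rw [← Quotient.out_eq f]
  rfl

/-- The quotient of `D` by the congruence generated by `r` and the operad laws. -/
noncomputable abbrev quotData : OperadData.{w, u} C where
  Op := Quotient (relSetoid D r)
  src := Quotient.lift D.src fun _ _ h => (Rel.src_tgt h).1
  tgt := Quotient.lift D.tgt fun _ _ h => (Rel.src_tgt h).2
  one c := Quotient.mk _ (D.one c)
  src_one := D.src_one
  tgt_one := D.tgt_one
  comp g fs h := Quotient.mk _ (D.comp g.out (fs.map Quotient.out) (by
    rw [out_src, ← h, List.map_map]; exact List.map_congr_left fun f _ => out_tgt D r f))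
  src_comp g fs h := by
    change D.src _ = _
    rw [D.src_comp, List.flatMap_map]
    congr 1; funext f; exact out_src D r f
  tgt_comp g fs h := (D.tgt_comp _ _ _).trans (out_tgt D r g)

/-- The quotient map. -/
noncomputable def quotMk : OperadHom D (quotData D r) id where
  op := Quotient.mk _
  src_op f := (List.map_id _).symm
  tgt_op _ := rfl
  op_one _ := rfl
  op_comp g fs h := by
    refine Quotient.sound (Rel.comp ?_ (by simp) ?_)
    · exact (Quotient.exact (Quotient.out_eq (Quotient.mk (relSetoid D r) g))).symm
    · intro p hp
      obtain ⟨i, hi, rfl⟩ := List.mem_iff_getElem.1 hp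
      simp only [List.getElem_zip, List.getElem_map]
      exact (Quotient.exact (Quotient.out_eq (Quotient.mk (relSetoid D r) _))).symm

theorem quotMk_surjective : Function.Surjective (quotMk D r).op := Quotient.mk_surjective

/-- The operad presented by the composition data `D` and the relations `r`. -/
noncomputable abbrev presented : Operad.{w, u} C where
  toOperadData := quotData D r
  one_comp f := by
    obtain ⟨f, rfl⟩ := quotMk_surjective D r f
    have := (quotMk D r).op_comp (D.one (D.tgt f)) [f] (by simp [D.src_one])
    exact this.symm.trans (Quotient.sound (Rel.one_comp _ _))
  comp_one g := by
    obtain ⟨g, rfl⟩ := quotMk_surjective D r g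
    have := (quotMk D r).op_comp g ((D.src g).map D.one) (by
      simp [D.tgt_one, Function.comp_def])
    refine Eq.trans ?_ (this.symm.trans (Quotient.sound (Rel.comp_one _ _)))
    exact OperadData.comp_congr _ rfl (by
      rw [(quotMk D r).src_op, List.map_map, List.map_map]; rfl) _
  assoc g fs hs h h' := by
    obtain ⟨g, rfl⟩ := quotMk_surjective D r g
    obtain ⟨fs, rfl⟩ := (List.map_surjective_iff.2 (quotMk_surjective D r)) fs
    obtain ⟨hs, rfl⟩ := (List.map_surjective_iff.2 (quotMk_surjective D r)) hs
    have h0 : fs.map D.tgt = D.src g := by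
      rw [(quotMk D r).map_tgt, (quotMk D r).src_op] at h
      simpa using h
    have h0' : hs.map D.tgt = fs.flatMap D.src := by
      rw [(quotMk D r).map_tgt, (quotMk D r).flatMap_src] at h'
      simpa using h'
    rw [OperadData.comp_congr _ ((quotMk D r).op_comp g fs h0).symm rfl,
      OperadData.comp_congr _ rfl ((quotMk D r).op_compList fs hs h0').symm,
      ← (quotMk D r).op_comp _ _ (h0'.trans (D.src_comp g fs h0).symm),
      ← (quotMk D r).op_comp _ _ ((D.compList_map_tgt fs hs h0').trans h0)]
    exact Quotient.sound (Rel.assoc _ _ _ _ _ _ _)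

variable {D r} {C' : Type w'} {P : Operad.{w', u'} C'} {φ : C → C'}

theorem Rel.op_eq (F : OperadHom D P.toOperadData φ) (hr : ∀ f g, r f g → F.op f = F.op g)
    {f g : D.Op} (h : Rel D r f g) : F.op f = F.op g := by
  induction h with
  | rel h _ _ => exact hr _ _ h
  | refl => rfl
  | symm _ ih => exact ih.symm
  | trans _ _ ih1 ih2 => exact ih1.trans ih2
  | @comp g g' fs fs' h h' _ hl _ ih ih' =>
    rw [F.op_comp, F.op_comp]
    refine OperadData.comp_congr _ ih ?_ _
    apply List.ext_getElem (by simpa using hl)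
    intro i h1 h2
    simp only [List.length_map] at h1 h2
    have := (ih' (fs[i], fs'[i]) (by
      rw [List.mem_iff_getElem]; exact ⟨i, by simp [h1, h2], by simp⟩))
    simpa using this
  | one_comp f h =>
    rw [F.op_comp]
    refine Eq.trans ?_ (P.one_comp (F.op f))
    exact OperadData.comp_congr _ (by rw [F.op_one, F.tgt_op]) rfl _
  | comp_one g h =>
    rw [F.op_comp]
    refine Eq.trans ?_ (P.comp_one (F.op g))
    exact OperadData.comp_congr _ rfl (by
      simp [F.src_op, Function.comp_def, F.op_one]) _
  | assoc g fs hs h h' h₁ h₂ =>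
    rw [F.op_comp _ _ h₁, F.op_comp _ _ h₂]
    have a1 : (fs.map F.op).map P.tgt = P.src (F.op g) := by
      rw [F.map_tgt, h, F.src_op]
    have a2 : (hs.map F.op).map P.tgt = (fs.map F.op).flatMap P.src := by
      rw [F.map_tgt, h', F.flatMap_src]
    refine (OperadData.comp_congr _ (F.op_comp g fs h) rfl _).trans
      ((P.assoc (F.op g) (fs.map F.op) (hs.map F.op) a1 a2).trans ?_)
    exact OperadData.comp_congr _ rfl (F.op_compList fs hs h').symm _

/-- The universal property of a presented operad. -/
noncomputable def presentedLift (F : OperadHom D P.toOperadData φ)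
    (hr : ∀ f g, r f g → F.op f = F.op g) :
    OperadHom (presented D r).toOperadData P.toOperadData φ where
  op := Quotient.lift F.op fun _ _ h => Rel.op_eq F hr h
  src_op f := by
    obtain ⟨f, rfl⟩ := quotMk_surjective D r f
    exact F.src_op f
  tgt_op f := by
    obtain ⟨f, rfl⟩ := quotMk_surjective D r f
    exact F.tgt_op f
  op_one c := F.op_one c
  op_comp g fs h := by
    obtain ⟨g, rfl⟩ := quotMk_surjective D r g
    obtain ⟨fs, rfl⟩ := (List.map_surjective_iff.2 (quotMk_surjective D r)) fs
    have h0 : fs.map D.tgt = D.src g := by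
      change (fs.map (quotMk D r).op).map (quotData D r).tgt = (quotData D r).src _ at h
      rw [(quotMk D r).map_tgt, (quotMk D r).src_op] at h
      simpa using h
    have e := (quotMk D r).op_comp g fs h0
    have e2 : Quotient.lift F.op (fun _ _ h => Rel.op_eq F hr h)
      ((presented D r).comp ((quotMk D r).op g) (fs.map (quotMk D r).op) h) =
        F.op (D.comp g fs h0) :=
      (congrArg (Quotient.lift F.op fun _ _ h => Rel.op_eq F hr h) e.symm)
    refine e2.trans ((F.op_comp g fs h0).trans ?_)
    exact OperadData.comp_congr _ rfl (by rw [List.map_map]; rfl) _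

end Quotient

section PresentationExt

variable {C : Type w} {E : Type u} {s : E → List C} {t : E → C} {D : Type w'}
  {P : OperadData.{w', u'} D} {φ : C → D}
  {r : (freeData s t).Op → (freeData s t).Op → Prop}

theorem term_comp_eq {n : ℕ} (x : Fin n → (freeData s t).Op) {bl : List C} {c : C}
    (g : Term s t bl c) (h : bl = List.ofFn fun i => (x i).2.1) (L : List (freeData s t).Op)
    (hL : L.length = n) (hx : ∀ i : Fin n, x i = L[i])
    (h' : L.map (freeData s t).tgt = bl) :
    (⟨_, c, Term.comp h g fun i => (x i).2.2⟩ : (freeData s t).Op) =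
      (freeData s t).comp ⟨bl, c, g⟩ L h' := by
  subst hL
  obtain rfl : x = fun i => L[i] := funext hx
  rfl

theorem freeData_ext (F G : OperadHom (freeData s t) P φ)
    (h : ∀ e, F.op (freeGen s t e) = G.op (freeGen s t e)) : ∀ f, F.op f = G.op f := by
  rintro ⟨as, c, f⟩
  induction f with
  | one c => exact (F.op_one c).trans (G.op_one c).symm
  | gen e => exact h e
  | @comp n as bs bl c hb g fs ihg ihfs =>
    subst hb
    have hfs : (List.ofFn fun i => (⟨as i, bs i, fs i⟩ : (freeData s t).Op)).map
        (freeData s t).tgt = List.ofFn bs := by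
      rw [List.map_ofFn]; rfl
    have key := term_comp_eq (fun i => (⟨as i, bs i, fs i⟩ : (freeData s t).Op)) g rfl
      (List.ofFn fun i => (⟨as i, bs i, fs i⟩ : (freeData s t).Op)) (by simp) (by simp) hfs
    refine (congrArg F.op key).trans (Eq.trans ?_ (congrArg G.op key).symm)
    refine (F.op_comp _ _ hfs).trans (Eq.trans ?_ (G.op_comp _ _ hfs).symm)
    refine P.comp_congr ihg ?_ _
    rw [List.map_ofFn, List.map_ofFn]
    congr 1; funext i; exact ihfs i

theorem presented_ext (F G : OperadHom (presented (freeData s t) r).toOperadData P φ)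
    (h : ∀ e, F.op ((quotMk _ r).op (freeGen s t e)) = G.op ((quotMk _ r).op (freeGen s t e))) :
    F = G := by
  ext f
  obtain ⟨f, rfl⟩ := quotMk_surjective _ r f
  exact freeData_ext (F.comp (quotMk _ r)) (G.comp (quotMk _ r)) h f

end PresentationExt

/-! ### Simplicial operads -/

/-- A simplicial operad, i.e. a (colored, nonsymmetric) operad enriched in simplicial sets,
presented as a simplicial object in operads whose simplicial operators are the identity on
colors: the operations of `level [m]` are the `m`-simplices of the spaces of operations. -/
structure SimplicialOperad where
  Col : Type w
  level : SimplexCategoryᵒᵖ → Operad.{w, u} Col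
  map : ∀ {m k : SimplexCategoryᵒᵖ}, (m ⟶ k) →
    OperadHom (level m).toOperadData (level k).toOperadData id
  map_id : ∀ m f, (map (𝟙 m)).op f = f
  map_comp : ∀ {m k l : SimplexCategoryᵒᵖ} (p : m ⟶ k) (q : k ⟶ l) (f : (level m).Op),
    (map (p ≫ q)).op f = (map q).op ((map p).op f)

namespace SimplicialOperad

/-- The simplicial set `Q(a₁, …, aₖ; b)` of operations with given source and target. -/
def opSpace (Q : SimplicialOperad.{w, u}) (as : List Q.Col) (b : Q.Col) : SSet.{u} where
  obj m := {f : (Q.level m).Op // (Q.level m).src f = as ∧ (Q.level m).tgt f = b}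
  map p := ↾fun f => ⟨(Q.map p).op f.1, by rw [(Q.map p).src_op, f.2.1, List.map_id],
    by rw [(Q.map p).tgt_op, f.2.2]; rfl⟩
  map_id m := ConcreteCategory.hom_ext _ _ fun f => Subtype.ext (Q.map_id m f.1)
  map_comp p q := ConcreteCategory.hom_ext _ _ fun f => Subtype.ext (Q.map_comp p q f.1)

/-- A morphism of simplicial operads. -/
structure Hom (P : SimplicialOperad.{w, u}) (Q : SimplicialOperad.{w', u'}) where
  col : P.Col → Q.Col
  hom : ∀ m, OperadHom (P.level m).toOperadData (Q.level m).toOperadData col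
  naturality : ∀ {m k : SimplexCategoryᵒᵖ} (p : m ⟶ k) (f : (P.level m).Op),
    (hom k).op ((P.map p).op f) = (Q.map p).op ((hom m).op f)

namespace Hom

variable {P : SimplicialOperad.{w, u}} {Q : SimplicialOperad.{w', u'}}
  {R : SimplicialOperad.{w'', u''}}

theorem ext' {F G : Hom P Q} (hc : F.col = G.col)
    (h : ∀ m f, (F.hom m).op f = (G.hom m).op f) : F = G := by
  obtain ⟨c, F, _⟩ := F
  obtain ⟨c', G, _⟩ := G
  obtain rfl : c = c' := hc
  congr
  funext m
  exact OperadHom.ext (funext (h m))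

def id (P : SimplicialOperad.{w, u}) : Hom P P where
  col := _root_.id
  hom m := ⟨_root_.id, by simp, by simp, by simp, fun g fs h =>
    OperadData.comp_congr _ rfl (List.map_id _).symm _⟩
  naturality _ _ := rfl

def comp (G : Hom Q R) (F : Hom P Q) : Hom P R where
  col := G.col ∘ F.col
  hom m := (G.hom m).comp (F.hom m)
  naturality p f := by
    change (G.hom _).op ((F.hom _).op _) = _
    rw [F.naturality, G.naturality]; rfl

end Hom

end SimplicialOperad

/-! ### The monoidal envelope -/

/-- The objects of the monoidal envelope `𝓛 Q`: finite sequences of colors of `Q`. -/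
@[ext]
structure Envelope (Q : SimplicialOperad.{w, u}) : Type w where
  cols : List Q.Col

namespace Envelope

variable {Q : SimplicialOperad.{w, u}}

/-- The mapping spaces of the monoidal envelope: an `m`-simplex is a sequence of `m`-simplices of
the spaces of operations, whose sources concatenate to `a` and whose targets form `b`. -/
def homSpace (a b : Envelope Q) : SSet.{u} where
  obj m := {fs : List (Q.level m).Op //
    fs.flatMap (Q.level m).src = a.cols ∧ fs.map (Q.level m).tgt = b.cols}
  map p := ↾fun fs => ⟨fs.1.map (Q.map p).op, by
      rw [(Q.map p).flatMap_src, fs.2.1, List.map_id],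
    by rw [(Q.map p).map_tgt, fs.2.2, List.map_id]⟩
  map_id m := by
    refine ConcreteCategory.hom_ext _ _ fun fs => Subtype.ext ?_
    change fs.1.map _ = fs.1
    conv_rhs => rw [← List.map_id fs.1]
    exact List.map_congr_left fun f _ => Q.map_id m f
  map_comp p q := by
    refine ConcreteCategory.hom_ext _ _ fun fs => Subtype.ext ?_
    change fs.1.map _ = (fs.1.map _).map _
    rw [List.map_map]
    exact List.map_congr_left fun f _ => Q.map_comp p q f

/-- Identities of the monoidal envelope: sequences of identity operations. -/
def idAt (a : Envelope Q) (m : SimplexCategoryᵒᵖ) : (homSpace a a).obj m :=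
  ⟨a.cols.map (Q.level m).one, by simp [List.flatMap_map, (Q.level m).src_one], by
    simp [(Q.level m).tgt_one, Function.comp_def]⟩

/-- Composition in the monoidal envelope. -/
def compAt {a b c : Envelope Q} (m : SimplexCategoryᵒᵖ) (f : (homSpace a b).obj m)
    (g : (homSpace b c).obj m) : (homSpace a c).obj m :=
  ⟨(Q.level m).compList g.1 f.1 (f.2.2.trans g.2.1.symm), by
      rw [OperadData.compList_flatMap_src, f.2.1], by
      rw [OperadData.compList_map_tgt, g.2.2]⟩

theorem idAt_compAt {a b : Envelope Q} (m : SimplexCategoryᵒᵖ) (f : (homSpace a b).obj m) :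
    compAt m (idAt a m) f = f :=
  Subtype.ext ((Q.level m).compList_one _ _ _ (by rw [f.2.1]; rfl))

theorem compAt_idAt {a b : Envelope Q} (m : SimplexCategoryᵒᵖ) (f : (homSpace a b).obj m) :
    compAt m f (idAt b m) = f :=
  Subtype.ext ((Q.level m).one_compList _ _ _ (by rw [f.2.2]; rfl))

theorem compAt_assoc {a b c d : Envelope Q} (m : SimplexCategoryᵒᵖ) (f : (homSpace a b).obj m)
    (g : (homSpace b c).obj m) (h : (homSpace c d).obj m) :
    compAt m (compAt m f g) h = compAt m f (compAt m g h) :=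
  Subtype.ext ((Q.level m).compList_assoc h.1 g.1 f.1 (g.2.2.trans h.2.1.symm)
    (f.2.2.trans g.2.1.symm)).symm

theorem map_idAt (a : Envelope Q) {m k : SimplexCategoryᵒᵖ} (p : m ⟶ k) :
    (homSpace a a).map p (idAt a m) = idAt a k := by
  refine Subtype.ext ?_
  change (a.cols.map _).map _ = a.cols.map _
  rw [List.map_map]
  exact List.map_congr_left fun c _ => (Q.map p).op_one c

theorem map_compAt {a b c : Envelope Q} {m k : SimplexCategoryᵒᵖ} (p : m ⟶ k)
    (f : (homSpace a b).obj m) (g : (homSpace b c).obj m) :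
    (homSpace a c).map p (compAt m f g) =
      compAt k ((homSpace a b).map p f) ((homSpace b c).map p g) :=
  Subtype.ext ((Q.map p).op_compList g.1 f.1 _)

/-- The underlying category of the monoidal envelope: morphisms are `0`-simplices of the mapping
spaces. -/
instance : Category.{u} (Envelope Q) where
  Hom a b := (homSpace a b).obj (op (SimplexCategory.mk 0))
  id a := idAt a _
  comp f g := compAt _ f g
  id_comp f := idAt_compAt _ f
  comp_id f := compAt_idAt _ f
  assoc f g h := compAt_assoc _ f g h

/-- The monoidal envelope `𝓛 Q` as a simplicial category. -/
instance : SimplicialCategory (Envelope Q) where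
  Hom a b := homSpace a b
  id a := { app := fun m => ↾fun _ => idAt a m
            naturality := fun m k p => by
              ext x
              exact (map_idAt a p).symm }
  comp a b c := { app := fun m => ↾fun x => compAt m x.1 x.2
                  naturality := fun m k p => by
                    ext x
                    exact (map_compAt p x.1 x.2).symm }
  id_comp a b := by
    ext m x
    exact idAt_compAt m x
  comp_id a b := by
    ext m x
    exact compAt_idAt m x
  assoc a b c d := by
    ext m x
    exact compAt_assoc m x.1 x.2.1 x.2.2
  homEquiv {a b} := (SSet.unitHomEquiv (homSpace a b)).symm
  homEquiv_id a := by
    apply (SSet.unitHomEquiv (homSpace a a)).injective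
    rw [Equiv.apply_symm_apply]; rfl
  homEquiv_comp {a b c} f g := by
    apply (SSet.unitHomEquiv (homSpace a c)).injective
    rw [Equiv.apply_symm_apply]
    have e : (SimplexCategory.const (SimplexCategory.mk 0) (SimplexCategory.mk 0) 0).op =
      𝟙 (op (SimplexCategory.mk 0)) := Quiver.Hom.unop_inj (by ext; simp)
    have hf : (homSpace a b).map (SimplexCategory.const (SimplexCategory.mk 0)
        (SimplexCategory.mk 0) 0).op f = f := by rw [e, Functor.map_id_apply]
    have hg : (homSpace b c).map (SimplexCategory.const (SimplexCategory.mk 0)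
        (SimplexCategory.mk 0) 0).op g = g := by rw [e, Functor.map_id_apply]
    change compAt _ f g = compAt _ ((homSpace a b).map _ f) ((homSpace b c).map _ g)
    exact (congrArg₂ (compAt _) hf hg).symm

end Envelope
/-! ### Simplices of the nerve of the augmented simplex category -/

/-- An `n`-simplex `A₀ → A₁ → ⋯ → Aₙ` of the nerve of `Δ₊`, the category of finite ordinals
(the empty one included) and monotone maps: a functor from `[n]` to the skeleton of `Δ₊` with objects
`Fin a` for `a : ℕ`. -/
@[ext]
structure Shape (n : ℕ) where
  card : Fin (n + 1) → ℕ
  map : ∀ {i j : Fin (n + 1)}, i ≤ j → Fin (card i) → Fin (card j)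
  monotone : ∀ {i j : Fin (n + 1)} (h : i ≤ j), Monotone (map h)
  map_refl : ∀ (i : Fin (n + 1)) (x : Fin (card i)), map (le_refl i) x = x
  map_map : ∀ {i j k : Fin (n + 1)} (h : i ≤ j) (h' : j ≤ k) (x : Fin (card i)),
    map h' (map h x) = map (h.trans h') x

namespace Shape

/-- `α` is rooted if `Aₙ` is a singleton. -/
def IsRooted {n : ℕ} (α : Shape n) : Prop := α.card (Fin.last n) = 1

/-- The disjoint union of the `Aᵢ`. -/
abbrev Node {n : ℕ} (α : Shape n) : Type := Σ i : Fin (n + 1), Fin (α.card i)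

/-- The preimage of `a ∈ Aⱼ` in `Aᵢ`, as an increasing sequence. -/
def fiber {n : ℕ} (α : Shape n) {i j : Fin (n + 1)} (h : i ≤ j) (a : Fin (α.card j)) :
    List (Fin (α.card i)) :=
  (List.finRange (α.card i)).filter fun x => α.map h x = a

theorem mem_fiber {n : ℕ} (α : Shape n) {i j : Fin (n + 1)} (h : i ≤ j) (a : Fin (α.card j))
    (x : Fin (α.card i)) : x ∈ α.fiber h a ↔ α.map h x = a := by
  simp [fiber]

theorem fiber_pairwise {n : ℕ} (α : Shape n) {i j : Fin (n + 1)} (h : i ≤ j)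
    (a : Fin (α.card j)) : (α.fiber h a).Pairwise (· < ·) :=
  (List.pairwise_lt_finRange _).filter _

theorem fiber_refl {n : ℕ} (α : Shape n) (i : Fin (n + 1)) (a : Fin (α.card i)) :
    α.fiber (le_refl i) a = [a] := by
  refine List.Pairwise.eq_of_mem_iff (α.fiber_pairwise _ a) (List.pairwise_singleton _ a) ?_
  intro x
  rw [mem_fiber, α.map_refl]; simp

end Shape

theorem flatMap_pairwise_lt {n m : ℕ} {l : List (Fin m)} (h : l.Pairwise (· < ·))
    (p : Fin n → Fin m) (hp : Monotone p) (F : Fin m → List (Fin n))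
    (hF : ∀ b, (F b).Pairwise (· < ·)) (hF' : ∀ b, ∀ x ∈ F b, p x = b) :
    (l.flatMap F).Pairwise (· < ·) := by
  rw [List.pairwise_flatMap]
  refine ⟨fun b _ => hF b, h.imp ?_⟩
  intro b b' hb x hx y hy
  by_contra hc
  have := hp (not_lt.1 hc)
  rw [hF' _ _ hx, hF' _ _ hy] at this
  exact absurd hb (not_lt.2 this)

namespace Shape

theorem fiber_trans {n : ℕ} (α : Shape n) {i j k : Fin (n + 1)} (h : i ≤ j) (h' : j ≤ k)
    (a : Fin (α.card k)) :
    α.fiber (h.trans h') a = (α.fiber h' a).flatMap fun b => α.fiber h b := by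
  refine List.Pairwise.eq_of_mem_iff (α.fiber_pairwise _ a)
    (flatMap_pairwise_lt (α.fiber_pairwise h' a) (α.map h) (α.monotone h) _
      (fun b => α.fiber_pairwise h b) fun b x hx => (α.mem_fiber h b x).1 hx) ?_
  intro x
  simp only [List.mem_flatMap, mem_fiber]
  exact ⟨fun hx => ⟨α.map h x, by rw [α.map_map, hx], rfl⟩,
    fun ⟨b, hb, hx⟩ => by rw [← hb, ← hx, α.map_map]⟩

/-- The simplicial operator `θ^*` on the nerve of `Δ₊`. -/
def pull {k n : ℕ} (α : Shape n) (θ : Fin (k + 1) →o Fin (n + 1)) : Shape k where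
  card i := α.card (θ i)
  map h := α.map (θ.monotone h)
  monotone h := α.monotone (θ.monotone h)
  map_refl _ _ := α.map_refl _ _
  map_map _ _ _ := α.map_map _ _ _

/-- The preimage of `a ∈ Aₙ` in `Aᵢ`, as a finite set. -/
def rootFinset {n : ℕ} (α : Shape n) (a : Fin (α.card (Fin.last n))) (i : Fin (n + 1)) :
    Finset (Fin (α.card i)) :=
  Finset.univ.filter fun x => α.map (Fin.le_last i) x = a

theorem mem_rootFinset {n : ℕ} (α : Shape n) (a : Fin (α.card (Fin.last n))) (i : Fin (n + 1))
    (x : Fin (α.card i)) : x ∈ α.rootFinset a i ↔ α.map (Fin.le_last i) x = a := by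
  simp [rootFinset]

/-- The restriction of `α` to the preimages of `a ∈ Aₙ` (each of them being identified with a finite
ordinal by its unique increasing enumeration). -/
def root {n : ℕ} (α : Shape n) (a : Fin (α.card (Fin.last n))) : Shape n where
  card i := (α.rootFinset a i).card
  map {i j} h x := ((α.rootFinset a j).orderIsoOfFin rfl).symm
    ⟨α.map h ((α.rootFinset a i).orderIsoOfFin rfl x), by
      rw [mem_rootFinset, α.map_map, ← mem_rootFinset]
      exact ((α.rootFinset a i).orderIsoOfFin rfl x).2⟩
  monotone {i j} h x y hxy := by
    refine ((α.rootFinset a j).orderIsoOfFin rfl).symm.monotone ?_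
    exact α.monotone h (((α.rootFinset a i).orderIsoOfFin rfl).monotone hxy)
  map_refl i x := by
    rw [OrderIso.symm_apply_eq]
    exact Subtype.ext (α.map_refl _ _)
  map_map {i j k} h h' x := by
    rw [EmbeddingLike.apply_eq_iff_eq]
    refine Subtype.ext ?_
    rw [OrderIso.apply_symm_apply]
    exact α.map_map _ _ _

theorem root_isRooted {n : ℕ} (α : Shape n) (a : Fin (α.card (Fin.last n))) :
    (α.root a).IsRooted := by
  change (α.rootFinset a (Fin.last n)).card = 1
  rw [Finset.card_eq_one]
  refine ⟨a, ?_⟩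
  ext x
  rw [mem_rootFinset, α.map_refl]; simp

end Shape

/-- A morphism of simplices of the nerve of `Δ₊`: a simplicial operator `θ` and increasing maps
`Bᵢ → A_{θ i}` inducing isomorphisms from the preimages of `b ∈ Bⱼ` to the preimages of its image. -/
structure ShapeHom {k n : ℕ} (β : Shape k) (α : Shape n) where
  θ : Fin (k + 1) →o Fin (n + 1)
  φ : ∀ i, Fin (β.card i) → Fin (α.card (θ i))
  strictMono : ∀ i, StrictMono (φ i)
  fiber_map : ∀ {i j} (h : i ≤ j) (b : Fin (β.card j)),
    (β.fiber h b).map (φ i) = α.fiber (θ.monotone h) (φ j b)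

namespace ShapeHom

variable {k n l : ℕ} {β : Shape k} {α : Shape n} {γ : Shape l}

/-- The map on nodes. -/
def node (F : ShapeHom β α) (x : β.Node) : α.Node := ⟨F.θ x.1, F.φ x.1 x.2⟩

theorem map_φ (F : ShapeHom β α) {i j : Fin (k + 1)} (h : i ≤ j) (x : Fin (β.card i)) :
    α.map (F.θ.monotone h) (F.φ i x) = F.φ j (β.map h x) := by
  rw [← Shape.mem_fiber, ← F.fiber_map h]
  exact List.mem_map_of_mem ((β.mem_fiber h _ _).2 rfl)

def id (α : Shape n) : ShapeHom α α where
  θ := OrderHom.id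
  φ _ := _root_.id
  strictMono _ := strictMono_id
  fiber_map _ _ := List.map_id _

def comp (G : ShapeHom β α) (F : ShapeHom γ β) : ShapeHom γ α where
  θ := G.θ.comp F.θ
  φ i := G.φ (F.θ i) ∘ F.φ i
  strictMono i := (G.strictMono _).comp (F.strictMono i)
  fiber_map {i _} h b := (List.map_map.symm.trans
    (congrArg (List.map (G.φ (F.θ i))) (F.fiber_map h b))).trans (G.fiber_map _ _)

/-- The morphism `θ^* α → α`. -/
def pull (α : Shape n) (θ : Fin (k + 1) →o Fin (n + 1)) : ShapeHom (α.pull θ) α where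
  θ := θ
  φ _ := _root_.id
  strictMono _ := strictMono_id
  fiber_map _ _ := List.map_id _

/-- The inclusion `α_a → α`. -/
def root (α : Shape n) (a : Fin (α.card (Fin.last n))) : ShapeHom (α.root a) α where
  θ := OrderHom.id
  φ i x := ((α.rootFinset a i).orderIsoOfFin rfl x).1
  strictMono i _ _ h := ((α.rootFinset a i).orderIsoOfFin rfl).strictMono h
  fiber_map {i j} h b := by
    refine List.Pairwise.eq_of_mem_iff (List.Pairwise.map _ (fun x y hxy =>
      ((α.rootFinset a i).orderIsoOfFin rfl).strictMono hxy) ((α.root a).fiber_pairwise h b))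
      (α.fiber_pairwise _ _) ?_
    intro y
    refine List.mem_map.trans (Iff.trans ?_ (α.mem_fiber h _ y).symm)
    constructor
    · rintro ⟨x, hx, rfl⟩
      replace hx := ((α.root a).mem_fiber h b x).1 hx
      have := (OrderIso.symm_apply_eq _).1 hx
      exact congrArg Subtype.val this
    · intro hy
      have hy' : y ∈ α.rootFinset a i := (α.mem_rootFinset a i y).2
        ((α.map_map h (Fin.le_last j) y).symm.trans
          ((congrArg (α.map (Fin.le_last j)) hy).trans ((α.mem_rootFinset a j _).1
            ((α.rootFinset a j).orderIsoOfFin rfl b).2)))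
      refine ⟨((α.rootFinset a i).orderIsoOfFin rfl).symm ⟨y, hy'⟩,
        ((α.root a).mem_fiber h b _).2 ?_, ?_⟩
      · refine (OrderIso.symm_apply_eq _).2 (Subtype.ext ?_)
        change α.map h _ = _
        rw [OrderIso.apply_symm_apply]
        exact hy
      · rw [OrderIso.apply_symm_apply]

theorem root_φ_last (α : Shape n) (a : Fin (α.card (Fin.last n)))
    (x : Fin ((α.root a).card (Fin.last n))) : (root α a).φ (Fin.last n) x = a := by
  have := ((α.rootFinset a (Fin.last n)).orderIsoOfFin rfl x).2
  rw [Shape.mem_rootFinset, α.map_refl] at this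
  exact this

/-- A morphism of simplices is determined by `θ` and its image on the last level. -/
theorem eq_of_range {β' : Shape k} (F : ShapeHom β α) (F' : ShapeHom β' α) (hθ : F.θ = F'.θ)
    (hr : ∀ y, (∃ x, F.node ⟨Fin.last k, x⟩ = y) ↔ ∃ x, F'.node ⟨Fin.last k, x⟩ = y) :
    ∃ h : β = β', h ▸ F = F' := by
  have hF := fun (i j : Fin (k + 1)) (h : i ≤ j) => F.map_φ h
  have hF' := fun (i j : Fin (k + 1)) (h : i ≤ j) => F'.map_φ h
  obtain ⟨θ, φ, sm, fm⟩ := F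
  obtain ⟨θ', φ', sm', fm'⟩ := F'
  obtain rfl : θ = θ' := hθ
  dsimp only at hF hF'
  have hr' : ∀ y : Fin (α.card (θ (Fin.last k))),
      y ∈ Set.range (φ (Fin.last k)) ↔ y ∈ Set.range (φ' (Fin.last k)) := by
    intro y
    have := hr ⟨_, y⟩
    simpa [node] using this
  have hr'' : ∀ i, Set.range (φ i) = Set.range (φ' i) := by
    intro i
    ext y
    have key : y ∈ Set.range (φ i) ↔
        α.map (θ.monotone (Fin.le_last i)) y ∈ Set.range (φ (Fin.last k)) := by
      constructor
      · rintro ⟨x, rfl⟩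
        exact ⟨_, (hF i _ (Fin.le_last i) x).symm⟩
      · rintro ⟨b, hb⟩
        have : y ∈ (β.fiber (Fin.le_last i) b).map (φ i) := by
          rw [fm, Shape.mem_fiber]; exact hb.symm
        obtain ⟨x, _, hx⟩ := List.mem_map.1 this
        exact ⟨x, hx⟩
    have key' : y ∈ Set.range (φ' i) ↔
        α.map (θ.monotone (Fin.le_last i)) y ∈ Set.range (φ' (Fin.last k)) := by
      constructor
      · rintro ⟨x, rfl⟩
        exact ⟨_, (hF' i _ (Fin.le_last i) x).symm⟩
      · rintro ⟨b, hb⟩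
        have : y ∈ (β'.fiber (Fin.le_last i) b).map (φ' i) := by
          rw [fm', Shape.mem_fiber]; exact hb.symm
        obtain ⟨x, _, hx⟩ := List.mem_map.1 this
        exact ⟨x, hx⟩
    rw [key, key', hr']
  have hc : β.card = β'.card := by
    funext i
    have e := Nat.card_congr ((Equiv.ofInjective _ (sm i).injective).trans
      ((Equiv.setCongr (hr'' i)).trans (Equiv.ofInjective _ (sm' i).injective).symm))
    simpa using e
  obtain ⟨c, m, m1, m2, m3⟩ := β
  obtain ⟨c', m', m1', m2', m3'⟩ := β'
  obtain rfl : c = c' := hc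
  obtain rfl : φ = φ' := funext fun i => ((sm i).range_inj (sm' i)).1 (hr'' i)
  have hm : @m = @m' := by
    funext i j h x
    exact (sm j).injective ((hF i j h x).symm.trans (hF' i j h x))
  subst hm
  exact ⟨rfl, rfl⟩

end ShapeHom
/-! ### The simplicial operads `𝕍_α` -/

/-- The simplicial category `𝚫ⁿ`: the simplicial thickening of `[n]`. -/
abbrev Thick (n : ℕ) : Type u := SimplicialThickening (ULift.{u} (Fin (n + 1)))

namespace Thick

variable {n k l : ℕ}

/-- The identity `m`-simplex of the mapping space of `i`. -/
def idAt (i : Thick.{u} n) (m : SimplexCategoryᵒᵖ) : (i ⟶[SSet.{u}] i).obj m :=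
  (eId SSet.{u} i).app m PUnit.unit

/-- Composition of `m`-simplices of the mapping spaces. -/
def compAt {i j k : Thick.{u} n} {m : SimplexCategoryᵒᵖ} (f : (i ⟶[SSet.{u}] j).obj m)
    (g : (j ⟶[SSet.{u}] k).obj m) : (i ⟶[SSet.{u}] k).obj m :=
  (eComp SSet.{u} i j k).app m (f, g)

theorem le {i j : Thick.{u} n} {m : SimplexCategoryᵒᵖ} (f : (i ⟶[SSet.{u}] j).obj m) :
    i.as.down ≤ j.as.down :=
  have h : i.as ≤ j.as := SimplicialThickening.Path.le (f.obj 0)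
  h

/-- The simplicial functor `𝚫ᵏ → 𝚫ⁿ` induced by `θ : [k] → [n]`. -/
def functor (θ : Fin (k + 1) →o Fin (n + 1)) : EnrichedFunctor SSet.{u} (Thick.{u} k) (Thick.{u} n) :=
  SimplicialThickening.functor θ.uliftMap

theorem map_idAt (i : Thick.{u} n) {m m' : SimplexCategoryᵒᵖ} (p : m ⟶ m') :
    (i ⟶[SSet.{u}] i).map p (idAt i m) = idAt i m' :=
  (NatTrans.naturality_apply (eId SSet.{u} i) p PUnit.unit).symm

theorem map_compAt {i j k : Thick.{u} n} {m m' : SimplexCategoryᵒᵖ} (p : m ⟶ m')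
    (f : (i ⟶[SSet.{u}] j).obj m) (g : (j ⟶[SSet.{u}] k).obj m) :
    (i ⟶[SSet.{u}] k).map p (compAt f g) =
      compAt ((i ⟶[SSet.{u}] j).map p f) ((j ⟶[SSet.{u}] k).map p g) :=
  (congrArg (fun F => F (show ((i ⟶[SSet.{u}] j) ⊗ (j ⟶[SSet.{u}] k)).obj m from (f, g)))
    ((eComp SSet.{u} i j k).naturality p)).symm

theorem functor_idAt (θ : Fin (k + 1) →o Fin (n + 1)) (i : Thick.{u} k) (m : SimplexCategoryᵒᵖ) :
    ((functor θ).map i i).app m (idAt i m) = idAt ((functor θ).obj i) m := by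
  have := (functor.{u} θ).map_id i
  exact congrArg (fun F => F.app m PUnit.unit) this

theorem functor_compAt (θ : Fin (k + 1) →o Fin (n + 1)) {i j l : Thick.{u} k}
    {m : SimplexCategoryᵒᵖ} (f : (i ⟶[SSet.{u}] j).obj m) (g : (j ⟶[SSet.{u}] l).obj m) :
    ((functor θ).map i l).app m (compAt f g) =
      compAt (((functor θ).map i j).app m f) (((functor θ).map j l).app m g) := by
  have := (functor.{u} θ).map_comp i j l
  exact congrArg (fun F => F.app m (f, g)) this

/-- The action of `θ` and of a simplicial operator on the mapping spaces. -/
def act (θ : Fin (k + 1) →o Fin (n + 1)) {i j : Thick.{u} k} {m m' : SimplexCategoryᵒᵖ}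
    (p : m ⟶ m') (f : (i ⟶[SSet.{u}] j).obj m) :
    ((functor θ).obj i ⟶[SSet.{u}] (functor θ).obj j).obj m' :=
  ((functor θ).obj i ⟶[SSet.{u}] (functor θ).obj j).map p (((functor θ).map i j).app m f)

theorem act_idAt (θ : Fin (k + 1) →o Fin (n + 1)) (i : Thick.{u} k) {m m' : SimplexCategoryᵒᵖ}
    (p : m ⟶ m') : act θ p (idAt i m) = idAt ((functor θ).obj i) m' := by
  rw [act, functor_idAt, map_idAt]

theorem act_compAt (θ : Fin (k + 1) →o Fin (n + 1)) {i j l : Thick.{u} k}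
    {m m' : SimplexCategoryᵒᵖ} (p : m ⟶ m') (f : (i ⟶[SSet.{u}] j).obj m)
    (g : (j ⟶[SSet.{u}] l).obj m) :
    act θ p (compAt f g) = compAt (act θ p f) (act θ p g) := by
  rw [act, functor_compAt, map_compAt]; rfl

theorem ext_obj {i j : Thick.{u} n} {m : SimplexCategoryᵒᵖ} (f g : (i ⟶[SSet.{u}] j).obj m)
    (h : ∀ x, (f.obj x).I = (g.obj x).I) : f = g :=
  CategoryTheory.Functor.ext (F := f) (G := g) (fun x => SimplicialThickening.Path.ext (h x))
    (fun _ _ _ => InducedCategory.hom_ext (Subsingleton.elim _ _))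

theorem act_id {i j : Thick.{u} n} {m m' : SimplexCategoryᵒᵖ} (p : m ⟶ m')
    (f : (i ⟶[SSet.{u}] j).obj m) : act OrderHom.id p f = (i ⟶[SSet.{u}] j).map p f :=
  ext_obj (i := i) (j := j) (act OrderHom.id p f) ((i ⟶[SSet.{u}] j).map p f)
    fun _ => Set.image_id' _

theorem act_act (θ : Fin (k + 1) →o Fin (n + 1)) (η : Fin (l + 1) →o Fin (k + 1))
    {i j : Thick.{u} l} {m m' m'' : SimplexCategoryᵒᵖ} (p : m ⟶ m') (q : m' ⟶ m'')
    (f : (i ⟶[SSet.{u}] j).obj m) : act θ q (act η p f) = act (θ.comp η) (p ≫ q) f :=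
  ext_obj (act θ q (act η p f)) (act (θ.comp η) (p ≫ q) f) fun _ => Set.image_image _ _ _

end Thick

/-- The generating `m`-simplices `(f, a)` of `𝕍_α`: an `m`-simplex `f` of the mapping space
`𝚫ⁿ(i, j)` and an element `a ∈ Aⱼ`. -/
@[ext]
structure Gen {n : ℕ} (α : Shape n) (m : SimplexCategoryᵒᵖ) : Type u where
  {i j : Thick.{u} n}
  f : (i ⟶[SSet.{u}] j).obj m
  a : Fin (α.card j.as.down)

namespace Gen

variable {n : ℕ} {α : Shape n} {m : SimplexCategoryᵒᵖ}

/-- The source of `(f, a)` is the sequence of the elements of `Aᵢ` over `a`. -/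
def src (e : Gen.{u} α m) : List α.Node := (α.fiber (Thick.le e.f) e.a).map fun b => ⟨_, b⟩

/-- The target of `(f, a)` is `a`. -/
def tgt (e : Gen.{u} α m) : α.Node := ⟨_, e.a⟩

end Gen

section VLevel

variable {n : ℕ} (α : Shape n) (m : SimplexCategoryᵒᵖ)

/-- The relations of `𝕍_α`: `(1, a) = 1_a`, and
`(g ∘ f, a) = (g, a) ∘ ((f, b₁), …, (f, bₖ))`, where `b₁ < ⋯ < bₖ` are the elements over `a`. -/
inductive VRel : (freeData (Gen.src (α := α) (m := m)) Gen.tgt.{u}).Op →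
    (freeData (Gen.src (α := α) (m := m)) Gen.tgt.{u}).Op → Prop
  | id (i : Thick.{u} n) (a : Fin (α.card i.as.down)) :
      VRel (freeGen _ _ ⟨Thick.idAt i m, a⟩) ((freeData _ _).one ⟨i.as.down, a⟩)
  | comp {i j k : Thick.{u} n} (f : (i ⟶[SSet.{u}] j).obj m) (g : (j ⟶[SSet.{u}] k).obj m)
      (a : Fin (α.card k.as.down)) :
      VRel (freeGen _ _ ⟨Thick.compAt f g, a⟩)
        ((freeData _ _).comp (freeGen _ _ ⟨g, a⟩)
          ((α.fiber (Thick.le g) a).map fun b => freeGen _ _ ⟨f, b⟩)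
          (by rw [List.map_map]; rfl))

/-- The operad of `m`-simplices of `𝕍_α`: the operad generated by the operations `(f, a)`, subject
to the relations `VRel`. -/
noncomputable def vLevel : Operad.{0, u} α.Node :=
  presented (freeData (Gen.src (α := α) (m := m)) Gen.tgt.{u}) (VRel α m)

variable {α m}

/-- The operation `(f, a)` of `𝕍_α`. -/
noncomputable def vGen (e : Gen.{u} α m) : (vLevel α m).Op := (quotMk _ _).op (freeGen _ _ e)

theorem src_vGen (e : Gen.{u} α m) : (vLevel α m).src (vGen e) = e.src := rfl

theorem tgt_vGen (e : Gen.{u} α m) : (vLevel α m).tgt (vGen e) = e.tgt := rfl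

theorem vGen_id (i : Thick.{u} n) (a : Fin (α.card i.as.down)) :
    vGen ⟨Thick.idAt i m, a⟩ = (vLevel α m).one ⟨i.as.down, a⟩ := by
  refine Quotient.sound (Rel.rel (VRel.id i a) ?_ rfl)
  change (α.fiber (le_refl _) a).map _ = [_]
  rw [α.fiber_refl]; rfl

theorem vGen_comp {i j k : Thick.{u} n} (f : (i ⟶[SSet.{u}] j).obj m)
    (g : (j ⟶[SSet.{u}] k).obj m) (a : Fin (α.card k.as.down)) :
    vGen ⟨Thick.compAt f g, a⟩ = (vLevel α m).comp (vGen ⟨g, a⟩)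
      ((α.fiber (Thick.le g) a).map fun b => vGen ⟨f, b⟩) (by
        rw [List.map_map]; rfl) := by
  have h : ((α.fiber (Thick.le g) a).map fun b =>
      freeGen (Gen.src (α := α) (m := m)) Gen.tgt.{u} ⟨f, b⟩).map
        (freeData (Gen.src (α := α) (m := m)) Gen.tgt.{u}).tgt =
      (freeData (Gen.src (α := α) (m := m)) Gen.tgt.{u}).src (freeGen _ _ ⟨g, a⟩) := by
    rw [List.map_map]; rfl
  refine Eq.trans (Quotient.sound (Rel.rel (VRel.comp f g a) ?_ rfl)) (((quotMk _ (VRel α m)).op_comp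
    (freeGen _ _ ⟨g, a⟩) ((α.fiber (Thick.le g) a).map fun b => freeGen _ _ ⟨f, b⟩) h).trans ?_)
  · rw [(freeData _ _).src_comp]
    change (α.fiber _ a).map _ = _
    rw [α.fiber_trans (Thick.le f) (Thick.le g), List.map_flatMap, List.flatMap_map]
    rfl
  · exact OperadData.comp_congr _ rfl (by rw [List.map_map]; rfl) _

variable {D : Type w'} {P : Operad.{w', u'} D} {φ : α.Node → D}

/-- Morphisms out of the operad of `m`-simplices of `𝕍_α`. -/
noncomputable def vLift (γ : Gen.{u} α m → P.Op) (hs : ∀ e, P.src (γ e) = e.src.map φ)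
    (ht : ∀ e, P.tgt (γ e) = φ e.tgt)
    (hid : ∀ (i : Thick.{u} n) (a : Fin (α.card i.as.down)),
      γ ⟨Thick.idAt i m, a⟩ = P.one (φ ⟨i.as.down, a⟩))
    (hcomp : ∀ {i j k : Thick.{u} n} (f : (i ⟶[SSet.{u}] j).obj m) (g : (j ⟶[SSet.{u}] k).obj m)
      (a : Fin (α.card k.as.down)) (h : ((α.fiber (Thick.le g) a).map fun b => γ ⟨f, b⟩).map P.tgt =
        P.src (γ ⟨g, a⟩)),
      γ ⟨Thick.compAt f g, a⟩ = P.comp (γ ⟨g, a⟩) ((α.fiber (Thick.le g) a).map fun b => γ ⟨f, b⟩) h) :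
    OperadHom (vLevel α m).toOperadData P.toOperadData φ :=
  presentedLift (freeLift P.toOperadData φ γ hs ht) (by
    rintro _ _ (⟨i, a⟩ | ⟨f, g, a⟩)
    · exact hid i a
    · refine (hcomp f g a ?_).trans ?_
      · rw [hs, List.map_map]
        simp only [Gen.src, List.map_map]
        exact List.map_congr_left fun b _ => ht _
      · refine Eq.trans ?_ ((freeLift P.toOperadData φ γ hs ht).op_comp _ _ _).symm
        exact OperadData.comp_congr _ rfl (by rw [List.map_map]; rfl) _)

theorem vLift_vGen (γ : Gen.{u} α m → P.Op) (hs ht hid hcomp) (e : Gen.{u} α m) :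
    (vLift (φ := φ) γ hs ht hid hcomp).op (vGen e) = γ e := rfl

theorem vLevel_ext (F G : OperadHom (vLevel.{u} α m).toOperadData P.toOperadData φ)
    (h : ∀ e, F.op (vGen e) = G.op (vGen e)) (f : (vLevel.{u} α m).Op) : F.op f = G.op f := by
  rw [presented_ext F G h]

end VLevel

namespace ShapeHom

variable {k n l : ℕ} {β : Shape k} {α : Shape n} {γ : Shape l}

/-- `(f, b) ↦ (p^* θ f, φ b)`. -/
def gen (F : ShapeHom β α) {m m' : SimplexCategoryᵒᵖ} (p : m ⟶ m') (e : Gen.{u} β m) :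
    Gen.{u} α m' where
  i := (Thick.functor F.θ).obj e.i
  j := (Thick.functor F.θ).obj e.j
  f := Thick.act F.θ p e.f
  a := F.φ _ e.a

theorem src_gen (F : ShapeHom β α) {m m' : SimplexCategoryᵒᵖ} (p : m ⟶ m') (e : Gen.{u} β m) :
    (F.gen p e).src = e.src.map F.node := by
  change (α.fiber _ _).map _ = ((β.fiber _ _).map _).map _
  rw [List.map_map]
  refine Eq.trans ?_ (List.map_map (l := β.fiber (Thick.le e.f) e.a) (f := F.φ _)
    (g := fun b => (⟨F.θ e.i.as.down, b⟩ : α.Node)))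
  exact congrArg (List.map fun b => (⟨F.θ e.i.as.down, b⟩ : α.Node))
    (F.fiber_map (Thick.le e.f) e.a).symm

/-- The action of a morphism of simplices and of a simplicial operator on `𝕍`. -/
noncomputable def vMap (F : ShapeHom β α) {m m' : SimplexCategoryᵒᵖ} (p : m ⟶ m') :
    OperadHom (vLevel.{u} β m).toOperadData (vLevel.{u} α m').toOperadData F.node :=
  vLift (fun e => vGen (F.gen p e)) (fun e => F.src_gen p e) (fun e => rfl)
    (fun i a => by
      have e : F.gen p ⟨Thick.idAt i m, a⟩ =
          ⟨Thick.idAt ((Thick.functor F.θ).obj i) m', F.φ _ a⟩ := by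
        simp only [gen, Thick.act_idAt]
      exact (congrArg vGen e).trans (vGen_id _ _))
    (fun {i j k} f g a h => by
      have e : F.gen p ⟨Thick.compAt f g, a⟩ =
          ⟨Thick.compAt (Thick.act F.θ p f) (Thick.act F.θ p g), F.φ _ a⟩ := by
        simp only [gen, Thick.act_compAt]
      refine (congrArg vGen e).trans ((vGen_comp _ _ _).trans ?_)
      refine OperadData.comp_congr _ rfl ?_ _
      refine (congrArg _ (F.fiber_map (Thick.le g) a).symm).trans ?_
      exact List.map_map)

end ShapeHom
namespace ShapeHom

variable {k n l : ℕ} {β : Shape k} {α : Shape n} {γ : Shape l}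

theorem mk_congr {m : SimplexCategoryᵒᵖ} {i j : Thick.{u} n} {f f' : (i ⟶[SSet.{u}] j).obj m}
    (h : f = f') (a : Fin (α.card j.as.down)) : (⟨f, a⟩ : Gen.{u} α m) = ⟨f', a⟩ := by
  subst h; rfl

theorem gen_gen (G : ShapeHom β α) (F : ShapeHom γ β) {m m' m'' : SimplexCategoryᵒᵖ} (p : m ⟶ m')
    (q : m' ⟶ m'') (e : Gen.{u} γ m) : G.gen q (F.gen p e) = (G.comp F).gen (p ≫ q) e :=
  mk_congr (j := (Thick.functor (G.comp F).θ).obj e.j) (Thick.act_act G.θ F.θ p q e.f) _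

theorem gen_one {m : SimplexCategoryᵒᵖ} (e : Gen.{u} α m) : (id α).gen (𝟙 m) e = e :=
  mk_congr (i := e.i) (j := e.j) ((Thick.act_id (𝟙 m) e.f).trans
    (Functor.map_id_apply (e.i ⟶[SSet.{u}] e.j) m e.f)) e.a

theorem vMap_vMap (G : ShapeHom β α) (F : ShapeHom γ β) {m m' m'' : SimplexCategoryᵒᵖ}
    (p : m ⟶ m') (q : m' ⟶ m'') (f : (vLevel.{u} γ m).Op) :
    (G.vMap q).op ((F.vMap p).op f) = ((G.comp F).vMap (p ≫ q)).op f :=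
  vLevel_ext ((G.vMap q).comp (F.vMap p)) ((G.comp F).vMap (p ≫ q))
    (fun e => congrArg vGen (gen_gen G F p q e)) f

theorem vMap_id {m : SimplexCategoryᵒᵖ} (f : (vLevel.{u} α m).Op) :
    ((id α).vMap (𝟙 m)).op f = f :=
  vLevel_ext ((id α).vMap (𝟙 m)) ⟨_root_.id, fun _ => (List.map_id _).symm, fun _ => rfl,
    fun _ => rfl, fun _ _ _ => OperadData.comp_congr _ rfl (List.map_id _).symm _⟩
    (fun e => congrArg vGen (gen_one e)) f

end ShapeHom

/-- The simplicial operad `𝕍_α`. -/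
noncomputable def V {n : ℕ} (α : Shape n) : SimplicialOperad.{0, u} where
  Col := α.Node
  level m := vLevel α m
  map p := (ShapeHom.id α).vMap p
  map_id _ f := ShapeHom.vMap_id f
  map_comp p q f := ((ShapeHom.id α).vMap_vMap (ShapeHom.id α) p q f).symm

namespace V

variable {k n l : ℕ} {β : Shape k} {α : Shape n} {γ : Shape l}

/-- The morphism `𝕍_β → 𝕍_α` induced by a morphism of simplices, `(f, b) ↦ (θ f, φ b)`. -/
noncomputable def hom (F : ShapeHom β α) : SimplicialOperad.Hom (V.{u} β) (V.{u} α) where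
  col := F.node
  hom m := F.vMap (𝟙 m)
  naturality p f :=
    (F.vMap_vMap (ShapeHom.id β) p (𝟙 _) f).trans
      ((congrArg (fun r => (F.vMap r).op f) ((Category.comp_id p).trans
        (Category.id_comp p).symm)).trans
          ((ShapeHom.id α).vMap_vMap F (𝟙 _) p f).symm)

theorem hom_id (α : Shape n) : hom.{u} (ShapeHom.id α) = SimplicialOperad.Hom.id _ :=
  SimplicialOperad.Hom.ext' rfl fun _ f => ShapeHom.vMap_id f

theorem hom_comp (G : ShapeHom β α) (F : ShapeHom γ β) :
    hom.{u} (G.comp F) = (hom G).comp (hom F) :=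
  SimplicialOperad.Hom.ext' rfl fun m f => ((G.vMap_vMap F (𝟙 m) (𝟙 m) f).trans
    (congrArg (fun r => ((G.comp F).vMap r).op f) (Category.comp_id (𝟙 m)))).symm

end V

/-! ### Simplicial lists -/

/-- Simplicial lists: functors from `Δᵒᵖ` to the category of listings, the Kleisli category of the
list monad (a morphism `X ⟶ Y` is a function `X → List Y`). -/
abbrev SimplicialList := SimplexCategoryᵒᵖ ⥤ KleisliCat.{w} List

namespace SimplicialList

/-- The type of `m`-simplices. -/
def simplices (X : SimplicialList.{w}) (m : SimplexCategoryᵒᵖ) : Type w := X.obj m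

/-- The listing induced by a simplicial operator. -/
def act (X : SimplicialList.{w}) {m k : SimplexCategoryᵒᵖ} (p : m ⟶ k) :
    X.simplices m → List (X.simplices k) :=
  X.map p

theorem act_id (X : SimplicialList.{w}) (m : SimplexCategoryᵒᵖ) (x : X.simplices m) :
    X.act (𝟙 m) x = [x] := congrFun (X.map_id m) x

theorem act_comp (X : SimplicialList.{w}) {m k l : SimplexCategoryᵒᵖ} (p : m ⟶ k) (q : k ⟶ l)
    (x : X.simplices m) : X.act (p ≫ q) x = (X.act p x).flatMap (X.act q) :=
  congrFun (X.map_comp p q) x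

/-- A simplicial list is operadic if `θ^*` is a function (it takes values in lists of length one)
for all `θ : [k] → [n]` such that `θ k = n`. -/
def IsOperadic (X : SimplicialList.{w}) : Prop :=
  ∀ {k n : SimplexCategory} (θ : k ⟶ n), θ.toOrderHom (Fin.last _) = Fin.last _ →
    ∀ x : X.simplices (op n), ∃ y, X.act θ.op x = [y]

/-- The simplicial set `𝓛 X` of lists of simplices of `X`. -/
def lists (X : SimplicialList.{w}) : SSet.{w} where
  obj m := List (X.simplices m)
  map p := ↾fun l => l.flatMap (X.act p)
  map_id m := ConcreteCategory.hom_ext _ _ fun l => by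
    change l.flatMap (X.act (𝟙 m)) = l
    rw [funext (X.act_id m)]; exact List.flatMap_singleton' l
  map_comp p q := ConcreteCategory.hom_ext _ _ fun l => by
    change l.flatMap (X.act (p ≫ q)) = (l.flatMap (X.act p)).flatMap (X.act q)
    rw [funext (X.act_comp p q), List.flatMap_assoc]

/-- A quasi-operad is an operadic simplicial list `X` such that `𝓛 X` is a quasi-category. -/
def IsQuasiOperad (X : SimplicialList.{w}) : Prop := X.IsOperadic ∧ SSet.Quasicategory X.lists

end SimplicialList

/-! ### The homotopy coherent list nerve -/

/-- The `n`-simplices of the list nerve: rooted simplices `α` together with a morphism `𝕍_α → Q`. -/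
structure NerveSimplex (Q : SimplicialOperad.{w, u}) (n : ℕ) : Type (max w u) where
  shape : Shape n
  isRooted : shape.IsRooted
  hom : SimplicialOperad.Hom (V.{u} shape) Q

namespace NerveSimplex

variable {Q : SimplicialOperad.{w, u}} {k n l : ℕ}

/-- The restriction of `𝕍_α → Q` along a morphism of simplices `β → α`. -/
noncomputable def restrict {α : Shape n} (x : SimplicialOperad.Hom (V.{u} α) Q) {β : Shape k}
    (F : ShapeHom β α) (hβ : β.IsRooted) : NerveSimplex Q k := ⟨β, hβ, x.comp (V.hom F)⟩

theorem restrict_eq {α : Shape n} (x : SimplicialOperad.Hom (V.{u} α) Q) {β β' : Shape k}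
    (F : ShapeHom β α) (hβ : β.IsRooted) (F' : ShapeHom β' α) (hβ' : β'.IsRooted) (hθ : F.θ = F'.θ)
    (b : Fin (β.card (Fin.last k))) (b' : Fin (β'.card (Fin.last k)))
    (hb : F.node ⟨_, b⟩ = F'.node ⟨_, b'⟩) : restrict x F hβ = restrict x F' hβ' := by
  have hs : ∀ c, c = b := fun c => (Fin.subsingleton_iff_le_one.2 hβ.le).elim c b
  have hs' : ∀ c, c = b' := fun c => (Fin.subsingleton_iff_le_one.2 hβ'.le).elim c b'
  obtain ⟨h, h'⟩ := ShapeHom.eq_of_range F F' hθ fun y =>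
    ⟨fun ⟨c, hc⟩ => ⟨b', by rw [← hc, hs c, hb]⟩, fun ⟨c, hc⟩ => ⟨b, by rw [← hc, hs' c, hb]⟩⟩
  subst h
  obtain rfl : F = F' := h'
  rfl

theorem restrict_restrict {α : Shape n} (x : SimplicialOperad.Hom (V.{u} α) Q) {β : Shape k}
    (F : ShapeHom β α) {γ : Shape l} (G : ShapeHom γ β) (hγ : γ.IsRooted) :
    restrict (x.comp (V.hom F)) G hγ = restrict x (F.comp G) hγ := by
  simp only [restrict, V.hom_comp]; rfl

/-- The listing `θ^* x = ((θ, a)^* x)_a`, where `a` runs through `A_{θ k}` and `(θ, a)^* x` is the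
restriction of `x : 𝕍_α → Q` along `𝕍_{(θ^* α)_a} → 𝕍_{θ^* α} → 𝕍_α`. -/
noncomputable def act (θ : Fin (k + 1) →o Fin (n + 1)) (x : NerveSimplex Q n) :
    List (NerveSimplex Q k) :=
  (List.finRange (x.shape.card (θ (Fin.last k)))).map fun a =>
    restrict x.hom ((ShapeHom.pull x.shape θ).comp (ShapeHom.root (x.shape.pull θ) a))
      ((x.shape.pull θ).root_isRooted a)

theorem finRange_of_rooted {α : Shape n} (h : α.IsRooted) :
    ∃ a, List.finRange (α.card (Fin.last n)) = [a] := by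
  have : α.card (Fin.last n) = 1 := h
  rw [this]; exact ⟨0, rfl⟩

theorem act_of_last (θ : Fin (k + 1) →o Fin (n + 1)) (h : θ (Fin.last k) = Fin.last n)
    (x : NerveSimplex Q n) : ∃ y, act θ x = [y] := by
  obtain ⟨a, ha⟩ : ∃ a, List.finRange (x.shape.card (θ (Fin.last k))) = [a] := by
    rw [h]; exact finRange_of_rooted x.isRooted
  exact ⟨_, by rw [act, ha]; rfl⟩

theorem act_id (x : NerveSimplex Q n) : act OrderHom.id x = [x] := by
  obtain ⟨a, ha⟩ := finRange_of_rooted x.isRooted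
  have h1 : act OrderHom.id x = [restrict x.hom ((ShapeHom.pull x.shape OrderHom.id).comp
      (ShapeHom.root (x.shape.pull OrderHom.id) a)) ((x.shape.pull OrderHom.id).root_isRooted a)] :=
    congrArg (List.map _) ha
  have h2 : restrict x.hom (ShapeHom.id x.shape) x.isRooted = x := by
    simp only [restrict, V.hom_id]; rfl
  rw [h1]
  refine congrArg (fun y => [y]) (Eq.trans ?_ h2)
  have hr : ((x.shape.pull OrderHom.id).root a).card (Fin.last n) = 1 :=
    (x.shape.pull OrderHom.id).root_isRooted a
  refine restrict_eq x.hom _ _ _ _ rfl ⟨0, Nat.one_pos.trans_eq (Eq.symm hr)⟩ a ?_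
  exact congrArg (fun y => (⟨Fin.last n, y⟩ : x.shape.Node)) (ShapeHom.root_φ_last _ _ _)

theorem mem_map_root (β : Shape k) (i : Fin (k + 1)) (b : Fin (β.card (Fin.last k)))
    (x : Fin (β.card i)) :
    x ∈ (List.finRange ((β.root b).card i)).map
      (show Fin ((β.root b).card i) → Fin (β.card i) from (ShapeHom.root β b).φ i) ↔
      β.map (Fin.le_last i) x = b := by
  rw [← β.mem_rootFinset]
  refine List.mem_map.trans ?_
  constructor
  · rintro ⟨y, -, rfl⟩
    exact ((β.rootFinset b i).orderIsoOfFin rfl y).2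
  · intro hx
    exact ⟨((β.rootFinset b i).orderIsoOfFin rfl).symm ⟨x, hx⟩, List.mem_finRange _,
      congrArg Subtype.val (OrderIso.apply_symm_apply _ _)⟩

theorem finRange_eq_flatMap (β : Shape k) (i : Fin (k + 1)) :
    List.finRange (β.card i) = (List.finRange (β.card (Fin.last k))).flatMap fun b =>
      (List.finRange ((β.root b).card i)).map
        (show Fin ((β.root b).card i) → Fin (β.card i) from (ShapeHom.root β b).φ i) := by
  refine List.Pairwise.eq_of_mem_iff (List.pairwise_lt_finRange _)
    (flatMap_pairwise_lt (List.pairwise_lt_finRange _) (β.map (Fin.le_last i)) (β.monotone _) _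
      (fun b => List.Pairwise.map _ (fun _ _ h => (ShapeHom.root β b).strictMono i h)
        (List.pairwise_lt_finRange _)) fun b x hx => (mem_map_root β i b x).1 hx) ?_
  intro x
  exact ⟨fun _ => List.mem_flatMap.2 ⟨_, List.mem_finRange _, (mem_map_root β i _ x).2 rfl⟩,
    fun _ => List.mem_finRange x⟩

theorem act_comp (θ : Fin (k + 1) →o Fin (n + 1)) (η : Fin (l + 1) →o Fin (k + 1))
    (x : NerveSimplex Q n) : act (θ.comp η) x = (act θ x).flatMap (act η) := by
  have e := finRange_eq_flatMap (x.shape.pull θ) (η (Fin.last l))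
  refine (congrArg (List.map _) e).trans (List.map_flatMap.trans
    (Eq.trans ?_ (List.flatMap_map _ _ _).symm))
  refine congrArg (fun f => List.flatMap f _) (funext fun b => ?_)
  refine List.map_map.trans (List.map_congr_left fun a' _ => ?_)
  refine Eq.trans ?_ (restrict_restrict x.hom _ _ _).symm
  have hr := (x.shape.pull (θ.comp η)).root_isRooted ((ShapeHom.root (x.shape.pull θ) b).φ _ a')
  have hr' := (((x.shape.pull θ).root b).pull η).root_isRooted a'
  refine restrict_eq x.hom _ _ _ _ rfl ⟨0, Nat.one_pos.trans_eq (Eq.symm hr)⟩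
    ⟨0, Nat.one_pos.trans_eq (Eq.symm hr')⟩ ?_
  refine congrArg (fun y => (⟨θ (η (Fin.last l)), y⟩ : x.shape.Node)) ?_
  exact (ShapeHom.root_φ_last (x.shape.pull (θ.comp η)) _ _).trans
    (congrArg ((ShapeHom.root (x.shape.pull θ) b).φ _)
      (ShapeHom.root_φ_last (((x.shape.pull θ).root b).pull η) _ _)).symm

end NerveSimplex

/-- The homotopy coherent list nerve of a simplicial operad. -/
noncomputable def listNerve (Q : SimplicialOperad.{w, u}) : SimplicialList.{max w u} where
  obj m := NerveSimplex Q m.unop.len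
  map p := fun x => NerveSimplex.act p.unop.toOrderHom x
  map_id _ := funext fun x => NerveSimplex.act_id x
  map_comp p q := funext fun x => NerveSimplex.act_comp p.unop.toOrderHom q.unop.toOrderHom x

end ListNerve

/-!
The argument has three parts.

*Homotopy coherent nerves of locally Kan simplicial categories are quasi-categories*
(`SimplicialNerve.quasicategory`). Consider an inner horn `Λ[n, i] → N_Δ C`. A chain of paths in a
mapping space `𝚫ⁿ(p, q)` that stays in a face of the horn has a value in `C`, which does not depend on
the face; a chain of paths that all pass through some vertex strictly between `p` and `q` is a
composite of two such chains, and its value does not depend on where it is cut (`IsValue.unique`).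
This defines a map on the cubical horn in `𝚫ⁿ(p, q)`, the union of all the faces of the cube but the
one of the paths avoiding `i`. The inclusion of the cubical horn is a retract of a pushout-product of
a monomorphism with an endpoint of the interval, hence it is anodyne, and the map extends to
`𝚫ⁿ(p, q)` (`exists_extension_cubicalHorn`). If `p` and `q` are not on different sides of `i`, the
cubical horn is everything. The extensions form a simplicial functor, because all composites of
non-identity arrows lie in the cubical horns.

*The mapping spaces of `𝓛 Q` are Kan complexes* (`Envelope.kanComplex_homSpace`). Simplicial operators
preserve the sources of the operations in a sequence, and horns are connected, so a horn in a mapping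
space of `𝓛 Q` is a horn in a product of spaces of operations.

*The simplicial sets `𝓛 (N^l_Δ Q)` and `N_Δ (𝓛 Q)` are isomorphic* (`toSimplicialNerve`). For an
`n`-simplex `α` of `N(Δ₊)`, not necessarily rooted, a morphism `x : 𝕍_α → Q` has an adjoint simplicial
functor `𝚫ⁿ → 𝓛 Q`, which sends `f` to the sequence of the operations `x (f, a)`. A list of simplices of
`N^l_Δ Q` is sent to the concatenation of the adjoint functors; `α` being the concatenation of its
rooted components, this is compatible with simplicial operators (`adjointList_components`).
Conversely, a simplicial functor `F : 𝚫ⁿ → 𝓛 Q` determines `α`: the set `Aᵢ` is the set of positions in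
the sequence `F i`, and `Aᵢ → Aⱼ` is the monotone map whose fibers have the lengths of the sources of
the operations `F f`, for any `f : i ⟶ j`. This does not depend on `f`, because `𝚫ⁿ(i, j)` is connected,
and it is functorial, because a monotone map is determined by the cardinalities of its fibers
(`monotone_ext`). So each `F` is adjoint to a unique morphism `𝕍_α → Q` (`adjoint_injective`,
`adjoint_homOf`), and cutting `α` into its rooted components gives the inverse map.
-/


/-! ### Extending maps along cubical horns -/

namespace CategoryTheory.SimplicialThickening

open Simplicial

variable {J : Type u} [LinearOrder J] {a b c d : SimplicialThickening J} {m k : SimplexCategoryᵒᵖ}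

/-- The set of elements of `J` visited by the `x`-th path of a chain of paths. -/
def pathAt (f : (nerve (a ⟶ b)).obj m) (x : Fin (m.unop.len + 1)) : Set J := (f.obj x).I

theorem pathAt_mono (f : (nerve (a ⟶ b)).obj m) {x y : Fin (m.unop.len + 1)} (h : x ≤ y) :
    pathAt f x ⊆ pathAt f y :=
  (f.map (homOfLE h)).1.1.1

theorem left_mem_pathAt (f : (nerve (a ⟶ b)).obj m) (x : Fin (m.unop.len + 1)) :
    a.as ∈ pathAt f x := (f.obj x).left

theorem right_mem_pathAt (f : (nerve (a ⟶ b)).obj m) (x : Fin (m.unop.len + 1)) :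
    b.as ∈ pathAt f x := (f.obj x).right

theorem le_of_mem_pathAt (f : (nerve (a ⟶ b)).obj m) {x : Fin (m.unop.len + 1)} {j : J}
    (h : j ∈ pathAt f x) : a.as ≤ j := (f.obj x).left_le j h

theorem ge_of_mem_pathAt (f : (nerve (a ⟶ b)).obj m) {x : Fin (m.unop.len + 1)} {j : J}
    (h : j ∈ pathAt f x) : j ≤ b.as := (f.obj x).le_right j h

theorem chain_ext {f g : (nerve (a ⟶ b)).obj m} (h : ∀ x, pathAt f x = pathAt g x) : f = g :=
  Functor.ext (fun x => Path.ext (h x))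
    (fun _ _ _ => InducedCategory.hom_ext (Subsingleton.elim _ _))

/-- The chain of paths with given sets of visited elements. -/
def mkChain (I : Fin (m.unop.len + 1) → Set J) (hI : Monotone I) (ha : ∀ x, a.as ∈ I x)
    (hb : ∀ x, b.as ∈ I x) (hab : ∀ x, ∀ j ∈ I x, a.as ≤ j ∧ j ≤ b.as) :
    (nerve (a ⟶ b)).obj m where
  obj x := ⟨I x, ha x, hb x, fun j hj => (hab x j hj).1, fun j hj => (hab x j hj).2⟩
  map {_ _} h := ⟨⟨⟨hI h.le⟩⟩⟩
  map_id _ := InducedCategory.hom_ext (Subsingleton.elim _ _)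
  map_comp _ _ := InducedCategory.hom_ext (Subsingleton.elim _ _)

variable (a b)

/-- The faces of the cube of paths from `a` to `b` in the directions other than `i`: chains of paths
all of which avoid, or all of which visit, some fixed element different from `i`. -/
def sideFaces (i : J) : (nerve (a ⟶ b)).Subcomplex where
  obj _ := {f | (∃ j, j ≠ i ∧ ∀ x, j ∉ pathAt f x) ∨
    ∃ j, j ≠ i ∧ a.as < j ∧ j < b.as ∧ ∀ x, j ∈ pathAt f x}
  map p _ hf := hf.imp (fun ⟨j, hj, h⟩ => ⟨j, hj, fun x => h (p.unop.toOrderHom x)⟩)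
    (fun ⟨j, hj, h1, h2, h⟩ => ⟨j, hj, h1, h2, fun x => h (p.unop.toOrderHom x)⟩)

/-- The cubical horn in the cube of paths from `a` to `b`: all the faces but the one consisting of
the paths that avoid `i`. -/
def cubicalHorn (i : J) : (nerve (a ⟶ b)).Subcomplex where
  obj _ := {f | (∃ j, j ≠ i ∧ ∀ x, j ∉ pathAt f x) ∨
    ∃ j, a.as < j ∧ j < b.as ∧ ∀ x, j ∈ pathAt f x}
  map p _ hf := hf.imp (fun ⟨j, hj, h⟩ => ⟨j, hj, fun x => h (p.unop.toOrderHom x)⟩)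
    (fun ⟨j, h1, h2, h⟩ => ⟨j, h1, h2, fun x => h (p.unop.toOrderHom x)⟩)

variable {a b}

open Classical in
/-- The map from the cube of paths to the interval which records whether `i` is visited. -/
noncomputable def visits (i : J) : nerve (a ⟶ b) ⟶ (Δ[1] : SSet.{u}) where
  app m := ↾fun f => SSet.stdSimplex.objMk (n := ⦋1⦌) (m := m)
    ⟨fun x => if i ∈ pathAt f x then 1 else 0, fun x y h => by
      by_cases hx : i ∈ pathAt f x
      · simp [hx, pathAt_mono f h hx]
      · simp [hx]⟩
  naturality _ _ _ := rfl

theorem visits_apply_eq_one (i : J) (f : (nerve (a ⟶ b)).obj m) (x : Fin (m.unop.len + 1)) :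
    SSet.stdSimplex.asOrderHom ((visits i).app m f) x = 1 ↔ i ∈ pathAt f x := by
  classical
  change (if i ∈ pathAt f x then (1 : Fin 2) else 0) = 1 ↔ _
  by_cases h : i ∈ pathAt f x <;> simp [h]

/-- The map that replaces the coordinate of the cube of paths which records whether `i` is
visited. -/
noncomputable def setVisits {i : J} (ha : a.as < i) (hb : i < b.as) :
    nerve (a ⟶ b) ⊗ (Δ[1] : SSet.{u}) ⟶ nerve (a ⟶ b) where
  app _ := ↾fun y => mkChain
    (fun x => {j | (j ≠ i ∧ j ∈ pathAt y.1 x) ∨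
      (j = i ∧ SSet.stdSimplex.asOrderHom y.2 x = 1)})
    (fun _ _ h _ hj => hj.imp (fun hj => ⟨hj.1, pathAt_mono y.1 h hj.2⟩) fun hj =>
      ⟨hj.1, le_antisymm (Fin.le_last _)
        (hj.2.symm.le.trans ((SSet.stdSimplex.asOrderHom y.2).monotone h))⟩)
    (fun x => Or.inl ⟨ha.ne, left_mem_pathAt y.1 x⟩)
    (fun x => Or.inl ⟨hb.ne', right_mem_pathAt y.1 x⟩)
    (fun _ _ hj => hj.elim (fun h => ⟨le_of_mem_pathAt y.1 h.2, ge_of_mem_pathAt y.1 h.2⟩)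
      fun h => h.1 ▸ ⟨ha.le, hb.le⟩)
  naturality _ _ _ := rfl

theorem mem_pathAt_setVisits {i : J} (ha : a.as < i) (hb : i < b.as)
    (y : (nerve (a ⟶ b) ⊗ (Δ[1] : SSet.{u})).obj m) (x : Fin (m.unop.len + 1)) (j : J) :
    j ∈ pathAt ((setVisits ha hb).app m y) x ↔ (j ≠ i ∧ j ∈ pathAt y.1 x) ∨
      (j = i ∧ SSet.stdSimplex.asOrderHom y.2 x = 1) := Iff.rfl

open HomotopicalAlgebra SSet.modelCategoryQuillen in
/-- Maps to Kan complexes extend along the inclusion of a cubical horn: the latter is a retract of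
the pushout-product of the inclusion of the faces in the other directions with the inclusion of an
endpoint of the interval, which is anodyne. -/
theorem exists_extension_cubicalHorn {i : J} (ha : a.as < i) (hb : i < b.as) {Z : SSet.{u}}
    [SSet.KanComplex Z] (φ : (cubicalHorn a b i : SSet.{u}) ⟶ Z) :
    ∃ Φ : nerve (a ⟶ b) ⟶ Z, (cubicalHorn a b i).ι ≫ Φ = φ := by
  let K := (sideFaces a b i).unionProd (Λ[1, 1] : (Δ[1] : SSet.{u}).Subcomplex)
  have one_of_mem : ∀ {m} (e : (Δ[1] : SSet.{u}).obj m), e ∈ (Λ[1, 1] : SSet.Subcomplex _).obj m ↔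
      ∀ x, SSet.stdSimplex.asOrderHom e x = 1 := by
    intro m e
    rw [SSet.mem_horn_iff]
    constructor
    · intro h x
      by_contra hx
      refine h (Set.eq_univ_of_forall fun z => ?_)
      have : z = 0 ∨ z = 1 := by lia
      rcases this with rfl | rfl
      · exact Or.inl ⟨x, by lia⟩
      · exact Or.inr rfl
    · intro h h'
      have : (0 : Fin 2) ∈ Set.range (SSet.stdSimplex.asOrderHom e) ∪ {1} := h' ▸ Set.mem_univ _
      rcases this with ⟨x, hx⟩ | hx
      · rw [h x] at hx; exact absurd hx (by decide)
      · exact absurd hx (by decide)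
  -- setting the coordinate `i` maps the pushout-product to the cubical horn, and recording it maps
  -- the cubical horn to the pushout-product
  have hr : ∀ {m} (y : (nerve (a ⟶ b) ⊗ (Δ[1] : SSet.{u})).obj m), y ∈ K.obj m →
      (setVisits ha hb).app m y ∈ (cubicalHorn a b i).obj m := by
    intro m y hy
    rcases (SSet.Subcomplex.mem_unionProd_iff _ _ y).1 hy with h | h
    · exact Or.inr ⟨i, ha, hb, fun x => Or.inr ⟨rfl, (one_of_mem _).1 h x⟩⟩
    · refine h.imp ?_ ?_
      · rintro ⟨j, hj, h⟩
        refine ⟨j, hj, fun x hx => ?_⟩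
        rcases hx with hx | hx
        exacts [h x hx.2, hj hx.1]
      · rintro ⟨j, hj, h1, h2, h⟩
        exact ⟨j, h1, h2, fun x => Or.inl ⟨hj, h x⟩⟩
  have hs : ∀ {m} (f : (nerve (a ⟶ b)).obj m), f ∈ (cubicalHorn a b i).obj m →
      (f, (visits i).app m f) ∈ K.obj m := by
    intro m f hf
    refine (SSet.Subcomplex.mem_unionProd_iff _ _ _).2 ?_
    rcases hf with ⟨j, hj, h⟩ | ⟨j, h1, h2, h⟩
    · exact Or.inr (Or.inl ⟨j, hj, h⟩)
    · by_cases hj : j = i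
      · subst hj
        exact Or.inl ((one_of_mem _).2 fun x => (visits_apply_eq_one j f x).2 (h x))
      · exact Or.inr (Or.inr ⟨j, hj, h1, h2, h⟩)
  have hrs : ∀ {m} (f : (nerve (a ⟶ b)).obj m),
      (setVisits ha hb).app m (f, (visits i).app m f) = f := by
    intro m f
    refine chain_ext fun x => Set.ext fun j => ?_
    refine (mem_pathAt_setVisits ha hb _ x j).trans ?_
    rw [visits_apply_eq_one]
    by_cases hj : j = i <;> simp [hj]
  let r : (K : SSet.{u}) ⟶ (cubicalHorn a b i : SSet.{u}) :=
    SSet.Subcomplex.lift (K.ι ≫ setVisits ha hb) (by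
      rintro m _ ⟨y, rfl⟩
      exact hr y.1 y.2)
  have hK : SSet.anodyneExtensions K.ι :=
    SSet.anodyneExtensions_unionProd_ι _ _ (SSet.anodyneExtensions.horn_ι _)
  have hlift : HasLiftingProperty K.ι (Limits.terminal.from Z) :=
    hK _ ((isFibrant_iff Z).1 inferInstance).mem
  have sq : CommSq (r ≫ φ) K.ι (Limits.terminal.from Z) (Limits.terminal.from _) := ⟨by simp⟩
  refine ⟨CartesianMonoidalCategory.lift (𝟙 _) (visits i) ≫ sq.lift, ?_⟩
  ext m f
  have e := congrArg (fun F => F.app m ⟨_, hs f.1 f.2⟩) sq.fac_left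
  refine Eq.trans e (congrArg (φ.app m) (Subtype.ext (hrs f.1)))

end CategoryTheory.SimplicialThickening

/-! ### Simplices of the mapping spaces of a simplicial category -/

namespace CategoryTheory.SimplicialArrow

open Simplicial SimplicialThickening

section General

variable {C : Type u} [Category.{w} C] [SimplicialCategory C] {m k : SimplexCategoryᵒᵖ}

/-- The identity `m`-simplex of a mapping space. -/
def idAt (x : C) (m : SimplexCategoryᵒᵖ) : (x ⟶[SSet.{w}] x).obj m :=
  (eId SSet.{w} x).app m PUnit.unit

/-- Composition of `m`-simplices of mapping spaces. -/
def compAt {x y z : C} (f : (x ⟶[SSet.{w}] y).obj m) (g : (y ⟶[SSet.{w}] z).obj m) :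
    (x ⟶[SSet.{w}] z).obj m :=
  (eComp SSet.{w} x y z).app m (f, g)

theorem idAt_compAt {x y : C} (f : (x ⟶[SSet.{w}] y).obj m) : compAt (idAt x m) f = f :=
  congrArg (fun F => F.app m f) (e_id_comp SSet.{w} x y)

theorem compAt_idAt {x y : C} (f : (x ⟶[SSet.{w}] y).obj m) : compAt f (idAt y m) = f :=
  congrArg (fun F => F.app m f) (e_comp_id SSet.{w} x y)

theorem compAt_assoc {x y z t : C} (f : (x ⟶[SSet.{w}] y).obj m) (g : (y ⟶[SSet.{w}] z).obj m)
    (h : (z ⟶[SSet.{w}] t).obj m) : compAt (compAt f g) h = compAt f (compAt g h) :=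
  congrArg (fun F => F.app m (f, g, h)) (e_assoc SSet.{w} x y z t)

theorem map_compAt {x y z : C} (p : m ⟶ k) (f : (x ⟶[SSet.{w}] y).obj m)
    (g : (y ⟶[SSet.{w}] z).obj m) : (x ⟶[SSet.{w}] z).map p (compAt f g) =
      compAt ((x ⟶[SSet.{w}] y).map p f) ((y ⟶[SSet.{w}] z).map p g) :=
  (congrArg (fun F => F (show ((x ⟶[SSet.{w}] y) ⊗ (y ⟶[SSet.{w}] z)).obj m from (f, g)))
    ((eComp SSet.{w} x y z).naturality p)).symm

end General

end CategoryTheory.SimplicialArrow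

namespace CategoryTheory

open Simplicial SimplicialThickening

/-- An `m`-simplex of some mapping space of a simplicial category. Bundling the objects makes it
possible to compare simplices of mapping spaces whose ends are not definitionally equal. -/
structure SimplicialArrow (C : Type u) [Category.{w} C] [SimplicialCategory C]
    (m : SimplexCategoryᵒᵖ) where
  {src tgt : C}
  hom : (src ⟶[SSet.{w}] tgt).obj m

namespace SimplicialArrow

variable {C : Type u} [Category.{w} C] [SimplicialCategory C] {D : Type u'} [Category.{w} D]
  [SimplicialCategory D] {m k : SimplexCategoryᵒᵖ}

theorem mk_injective {x y : C} {f g : (x ⟶[SSet.{w}] y).obj m} (h : mk f = mk g) : f = g := by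
  cases h; rfl

theorem mk_compAt_congr {x y z x' y' z' : C} {f : (x ⟶[SSet.{w}] y).obj m}
    {g : (y ⟶[SSet.{w}] z).obj m} {f' : (x' ⟶[SSet.{w}] y').obj m}
    {g' : (y' ⟶[SSet.{w}] z').obj m} (hf : mk f = mk f') (hg : mk g = mk g') :
    mk (compAt f g) = mk (compAt f' g') := by
  cases hf; cases hg; rfl

theorem mk_idAt_congr {x y : C} (h : x = y) : mk (idAt x m) = mk (idAt y m) := by
  cases h; rfl

/-- The action of a simplicial operator. -/
def map (p : m ⟶ k) (a : SimplicialArrow C m) : SimplicialArrow C k :=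
  mk ((a.src ⟶[SSet.{w}] a.tgt).map p a.hom)

/-- The action of an enriched functor. -/
def image (F : EnrichedFunctor SSet.{w} C D) (a : SimplicialArrow C m) : SimplicialArrow D m :=
  mk ((F.map a.src a.tgt).app m a.hom)

theorem image_mk (F : EnrichedFunctor SSet.{w} C D) {x y : C} (f : (x ⟶[SSet.{w}] y).obj m) :
    image F (mk f) = mk ((F.map x y).app m f) := rfl

theorem image_map (F : EnrichedFunctor SSet.{w} C D) (p : m ⟶ k) (a : SimplicialArrow C m) :
    image F (a.map p) = (image F a).map p :=
  congrArg mk (congrArg (fun G => G a.hom) ((F.map a.src a.tgt).naturality p))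

theorem map_compAt_enrichedFunctor (F : EnrichedFunctor SSet.{w} C D) {x y z : C}
    (f : (x ⟶[SSet.{w}] y).obj m) (g : (y ⟶[SSet.{w}] z).obj m) :
    (F.map x z).app m (compAt f g) = compAt ((F.map x y).app m f) ((F.map y z).app m g) :=
  congrArg (fun G => G.app m (f, g)) (F.map_comp x y z)

theorem map_idAt_enrichedFunctor (F : EnrichedFunctor SSet.{w} C D) (x : C) :
    (F.map x x).app m (idAt x m) = idAt (F.obj x) m :=
  congrArg (fun G => G.app m PUnit.unit) (F.map_id x)

/-- Transport of the underlying simplex along equalities of the ends. -/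
def castHom (a : SimplicialArrow C m) {x y : C} (hx : a.src = x) (hy : a.tgt = y) :
    (x ⟶[SSet.{w}] y).obj m :=
  cast (by rw [hx, hy]) a.hom

theorem mk_castHom (a : SimplicialArrow C m) {x y : C} (hx : a.src = x) (hy : a.tgt = y) :
    mk (a.castHom hx hy) = a := by
  obtain ⟨f⟩ := a
  subst hx hy
  rfl

theorem enrichedFunctor_ext {F G : EnrichedFunctor SSet.{w} C D} (hobj : ∀ x, F.obj x = G.obj x)
    (h : ∀ (m : SimplexCategoryᵒᵖ) (a : SimplicialArrow C m), image F a = image G a) : F = G := by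
  obtain ⟨Fo, Fm, _, _⟩ := F
  obtain ⟨Go, Gm, _, _⟩ := G
  obtain rfl : Fo = Go := funext hobj
  obtain rfl : Fm = Gm := by
    funext x y
    ext m f
    exact mk_injective (h m (mk f))
  rfl

theorem ext_thickening {J : Type w} [LinearOrder J] {a b a' b' : SimplicialThickening J}
    {f : (a ⟶[SSet.{w}] b).obj m} {g : (a' ⟶[SSet.{w}] b').obj m} (ha : a = a') (hb : b = b')
    (h : ∀ x, pathAt (a := a) (b := b) f x = pathAt (a := a') (b := b') g x) : mk f = mk g := by
  subst ha hb
  exact congrArg mk (chain_ext (a := a) (b := b) h)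

theorem pathAt_compAt {J : Type w} [LinearOrder J] {a b c : SimplicialThickening J}
    (f : (a ⟶[SSet.{w}] b).obj m) (g : (b ⟶[SSet.{w}] c).obj m) (x : Fin (m.unop.len + 1)) :
    pathAt (a := a) (b := c) (compAt f g) x =
      pathAt (a := a) (b := b) f x ∪ pathAt (a := b) (b := c) g x := rfl

theorem pathAt_idAt {J : Type w} [LinearOrder J] (a : SimplicialThickening J)
    (x : Fin (m.unop.len + 1)) : pathAt (a := a) (b := a) (idAt a m) x = {a.as} := rfl

theorem pathAt_functor {J K : Type w} [LinearOrder J] [LinearOrder K] (θ : J →o K)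
    {a b : SimplicialThickening J} (f : (a ⟶[SSet.{w}] b).obj m) (x : Fin (m.unop.len + 1)) :
    pathAt (a := ⟨θ a.as⟩) (b := ⟨θ b.as⟩)
      (((SimplicialThickening.functor θ).map a b).app m f) x =
        θ '' pathAt (a := a) (b := b) f x := rfl

end SimplicialArrow

end CategoryTheory

/-! ### The homotopy coherent nerve of a locally Kan simplicial category -/

namespace CategoryTheory.SimplicialNerve

open Simplicial SimplicialThickening SimplicialArrow
open ListNerve (Thick)

theorem exists_retraction {n : ℕ} {S : Set (Fin (n + 1))} (hS : S.Nonempty) :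
    ∃ ρ : Fin (n + 1) →o Fin (n + 1), (∀ x, ρ x ∈ S) ∧ ∀ x ∈ S, ρ x = x := by
  -- send `x` to the greatest element of `S` below `x`, or to the least element of `S`
  refine ⟨⟨fun x => sSup (S ∩ Set.Iic x) ⊔ sInf S, fun x y h => sup_le_sup_right (sSup_le_sSup
    (Set.inter_subset_inter_right _ (Set.Iic_subset_Iic.2 h))) _⟩, fun x => ?_, fun x hx => ?_⟩
  · change sSup (S ∩ Set.Iic x) ⊔ sInf S ∈ S
    rcases (S ∩ Set.Iic x).eq_empty_or_nonempty with h | h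
    · rw [h, sSup_empty, bot_sup_eq]
      exact hS.csInf_mem (Set.toFinite _)
    · have := h.csSup_mem (Set.toFinite _)
      rw [sup_eq_left.2 (sInf_le this.1)]
      exact this.1
  · change sSup (S ∩ Set.Iic x) ⊔ sInf S = x
    have h : IsGreatest (S ∩ Set.Iic x) x := ⟨⟨hx, Set.self_mem_Iic⟩, fun y hy => hy.2⟩
    rw [h.csSup_eq, sup_eq_left.2 (sInf_le hx)]

/-- A nonempty set of vertices that spans a simplex of the horn `Λ[n, i]`. -/
def IsFace {n : ℕ} (i : Fin (n + 1)) (S : Set (Fin (n + 1))) : Prop :=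
  S.Nonempty ∧ ∃ j, j ≠ i ∧ j ∉ S

/-- An order-preserving retraction onto a nonempty set of vertices. -/
noncomputable def retraction {n : ℕ} {S : Set (Fin (n + 1))} (hS : S.Nonempty) :
    Fin (n + 1) →o Fin (n + 1) := (exists_retraction hS).choose

theorem retraction_mem {n : ℕ} {S : Set (Fin (n + 1))} (hS : S.Nonempty) (x : Fin (n + 1)) :
    retraction hS x ∈ S := (exists_retraction hS).choose_spec.1 x

theorem retraction_eq {n : ℕ} {S : Set (Fin (n + 1))} (hS : S.Nonempty) {x : Fin (n + 1)}
    (hx : x ∈ S) : retraction hS x = x := (exists_retraction hS).choose_spec.2 x hx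

variable {C : Type u} [Category.{w} C] [SimplicialCategory C] {n : ℕ} {i : Fin (n + 1)}
  {m k : SimplexCategoryᵒᵖ}

section Support

/-- All the paths in a simplex of a mapping space of `𝚫ⁿ` stay in the set `S` of vertices. -/
def SupportedIn (a : SimplicialArrow (Thick.{w} n) m) (S : Set (Fin (n + 1))) : Prop :=
  ∀ x, ∀ j ∈ pathAt (a := a.src) (b := a.tgt) a.hom x, j.down ∈ S

theorem SupportedIn.inter {a : SimplicialArrow (Thick.{w} n) m} {S T : Set (Fin (n + 1))}
    (h : SupportedIn a S) (h' : SupportedIn a T) : SupportedIn a (S ∩ T) :=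
  fun x j hj => ⟨h x j hj, h' x j hj⟩

theorem SupportedIn.map {a : SimplicialArrow (Thick.{w} n) m} {S : Set (Fin (n + 1))}
    (h : SupportedIn a S) (p : m ⟶ k) : SupportedIn (a.map p) S :=
  fun x j hj => h (p.unop.toOrderHom x) j hj

theorem SupportedIn.left_mem {a : SimplicialArrow (Thick.{w} n) m} {S : Set (Fin (n + 1))}
    (h : SupportedIn a S) : a.src.as.down ∈ S :=
  h 0 _ (left_mem_pathAt (a := a.src) (b := a.tgt) a.hom 0)

theorem SupportedIn.right_mem {a : SimplicialArrow (Thick.{w} n) m} {S : Set (Fin (n + 1))}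
    (h : SupportedIn a S) : a.tgt.as.down ∈ S :=
  h 0 _ (right_mem_pathAt (a := a.src) (b := a.tgt) a.hom 0)

theorem supportedIn_compAt {p q r : Thick.{w} n} {f : (p ⟶[SSet.{w}] q).obj m}
    {g : (q ⟶[SSet.{w}] r).obj m} {S : Set (Fin (n + 1))} :
    SupportedIn (mk (compAt f g)) S ↔ SupportedIn (mk f) S ∧ SupportedIn (mk g) S :=
  ⟨fun h => ⟨fun x j hj => h x j (Or.inl hj), fun x j hj => h x j (Or.inr hj)⟩,
    fun h x j hj => hj.elim (h.1 x j) (h.2 x j)⟩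

theorem supportedIn_idAt (p : Thick.{w} n) {S : Set (Fin (n + 1))} (hp : p.as.down ∈ S) :
    SupportedIn (mk (idAt p m)) S := by
  rintro x j rfl
  exact hp

theorem image_functor_of_supportedIn {a : SimplicialArrow (Thick.{w} n) m} {S : Set (Fin (n + 1))}
    (h : SupportedIn a S) (ρ : Fin (n + 1) →o Fin (n + 1)) (hρ : ∀ x ∈ S, ρ x = x) :
    image (SimplicialThickening.functor ρ.uliftMap) a = a := by
  obtain ⟨f⟩ := a
  refine ext_thickening ?_ ?_ fun x => ?_
  · exact congrArg SimplicialThickening.mk (ULift.ext _ _ (hρ _ h.left_mem))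
  · exact congrArg SimplicialThickening.mk (ULift.ext _ _ (hρ _ h.right_mem))
  · refine (pathAt_functor ρ.uliftMap f x).trans ?_
    refine (Set.image_congr fun j hj => ?_).trans (Set.image_id _)
    exact ULift.ext _ _ (hρ _ (h x j hj))

end Support

section Diagram

variable (σ : (Λ[n, i] : SSet.{max u w}) ⟶ SimplicialNerve C)

/-- The value of a map from a horn to the homotopy coherent nerve on a simplex of the horn. -/
def diagram {l : ℕ} (θ : Fin (l + 1) →o Fin (n + 1)) (hθ : ∃ j, j ≠ i ∧ ∀ x, θ x ≠ j) :
    EnrichedFunctor SSet.{w} (Thick.{w} l) C :=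
  σ.app (op ⦋l⦌) ⟨SSet.stdSimplex.objMk (n := ⦋n⦌) (m := op ⦋l⦌) θ,
    (SSet.mem_horn_iff_notMem_range _ _).2 (by
      obtain ⟨j, hj, h⟩ := hθ
      exact ⟨j, hj, fun ⟨x, hx⟩ => h x hx⟩)⟩

theorem diagram_comp {l l' : ℕ} (θ : Fin (l + 1) →o Fin (n + 1)) (hθ : ∃ j, j ≠ i ∧ ∀ x, θ x ≠ j)
    (η : Fin (l' + 1) →o Fin (l + 1)) (h : ∃ j, j ≠ i ∧ ∀ x, (θ.comp η) x ≠ j) :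
    diagram σ (θ.comp η) h =
      (SimplicialThickening.functor η.uliftMap).comp SSet.{w} (diagram σ θ hθ) :=
  congrArg (fun F => F (⟨SSet.stdSimplex.objMk (n := ⦋n⦌) (m := op ⦋l⦌) θ,
    (SSet.mem_horn_iff_notMem_range _ _).2 (by
      obtain ⟨j, hj, h⟩ := hθ
      exact ⟨j, hj, fun ⟨x, hx⟩ => h x hx⟩)⟩ : (Λ[n, i] : SSet.{max u w}).obj (op ⦋l⦌)))
    (σ.naturality (Quiver.Hom.op (SimplexCategory.Hom.mk η : ⦋l'⦌ ⟶ ⦋l⦌)))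

theorem image_diagram {l l' : ℕ} (θ : Fin (l + 1) →o Fin (n + 1))
    (hθ : ∃ j, j ≠ i ∧ ∀ x, θ x ≠ j) (η : Fin (l' + 1) →o Fin (l + 1))
    (θ' : Fin (l' + 1) →o Fin (n + 1)) (hθ' : ∃ j, j ≠ i ∧ ∀ x, θ' x ≠ j)
    (h : ∀ x, θ (η x) = θ' x) (a : SimplicialArrow (Thick.{w} l') m) :
    image (diagram σ θ hθ) (image (SimplicialThickening.functor η.uliftMap) a) =
      image (diagram σ θ' hθ') a := by
  obtain rfl : θ.comp η = θ' := OrderHom.ext _ _ (funext h)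
  rw [diagram_comp σ θ hθ η]
  rfl

variable {S T : Set (Fin (n + 1))}

/-- The value of a map from a horn to the homotopy coherent nerve on the degenerate simplex given by
a retraction onto a face. -/
noncomputable def faceDiagram (hS : IsFace i S) : EnrichedFunctor SSet.{w} (Thick.{w} n) C :=
  diagram σ (retraction hS.1) (by
    obtain ⟨j, hj, h⟩ := hS.2
    exact ⟨j, hj, fun x hx => h (hx ▸ retraction_mem hS.1 x)⟩)

theorem image_faceDiagram_mono (hS : IsFace i S) (hT : IsFace i T) (hTS : T ⊆ S)
    {a : SimplicialArrow (Thick.{w} n) m} (ha : SupportedIn a T) :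
    image (faceDiagram σ hS) a = image (faceDiagram σ hT) a := by
  conv_lhs => rw [← image_functor_of_supportedIn ha (retraction hT.1)
    (fun x hx => retraction_eq hT.1 hx)]
  exact image_diagram σ _ _ _ _ _ (fun x => retraction_eq hS.1 (hTS (retraction_mem hT.1 x))) a

/-- The value on a simplex of a mapping space of `𝚫ⁿ` that is supported in a face of the horn does
not depend on the choice of this face. -/
theorem image_faceDiagram_eq (hS : IsFace i S) (hT : IsFace i T)
    {a : SimplicialArrow (Thick.{w} n) m} (haS : SupportedIn a S) (haT : SupportedIn a T) :
    image (faceDiagram σ hS) a = image (faceDiagram σ hT) a := by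
  have ha := haS.inter haT
  have h : IsFace i (S ∩ T) := by
    obtain ⟨j, hj, h⟩ := hS.2
    exact ⟨⟨_, ha.left_mem⟩, j, hj, fun h' => h h'.1⟩
  rw [image_faceDiagram_mono σ hS h Set.inter_subset_left ha,
    image_faceDiagram_mono σ hT h Set.inter_subset_right ha]

variable (hi : 0 < i) (hi' : i < Fin.last n)

include hi hi' in
theorem isFace_singleton (p : Fin (n + 1)) : IsFace i {p} := by
  refine ⟨⟨p, rfl⟩, ?_⟩
  by_cases h : p = 0
  · exact ⟨Fin.last n, hi'.ne', fun h' => (hi.trans hi').ne' (h'.trans h)⟩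
  · exact ⟨0, hi.ne, fun h' => h h'.symm⟩

/-- The image of a vertex of the horn. -/
noncomputable def vertex (p : Thick.{w} n) : C :=
  (faceDiagram σ (isFace_singleton hi hi' p.as.down)).obj p

theorem faceDiagram_obj (hS : IsFace i S) (p : Thick.{w} n) (hp : p.as.down ∈ S) :
    (faceDiagram σ hS).obj p = vertex σ hi hi' p :=
  congrArg SimplicialArrow.src (image_faceDiagram_eq σ hS (isFace_singleton hi hi' p.as.down)
    (supportedIn_idAt (m := op ⦋0⦌) p hp) (supportedIn_idAt p rfl))

/-- The value on a simplex of a mapping space of `𝚫ⁿ` that is supported in a face of the horn. -/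
noncomputable def faceValue (hS : IsFace i S) {p q : Thick.{w} n} (f : (p ⟶[SSet.{w}] q).obj m)
    (hf : SupportedIn (mk f) S) : (vertex σ hi hi' p ⟶[SSet.{w}] vertex σ hi hi' q).obj m :=
  castHom (image (faceDiagram σ hS) (mk f)) (faceDiagram_obj σ hi hi' hS p hf.left_mem)
    (faceDiagram_obj σ hi hi' hS q hf.right_mem)

theorem mk_faceValue (hS : IsFace i S) {p q : Thick.{w} n} (f : (p ⟶[SSet.{w}] q).obj m)
    (hf : SupportedIn (mk f) S) :
    mk (faceValue σ hi hi' hS f hf) = image (faceDiagram σ hS) (mk f) :=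
  mk_castHom _ _ _

theorem faceValue_eq (hS : IsFace i S) (hT : IsFace i T) {p q : Thick.{w} n}
    (f : (p ⟶[SSet.{w}] q).obj m) (hf : SupportedIn (mk f) S) (hf' : SupportedIn (mk f) T) :
    faceValue σ hi hi' hS f hf = faceValue σ hi hi' hT f hf' :=
  mk_injective (by rw [mk_faceValue, mk_faceValue, image_faceDiagram_eq σ hS hT hf hf'])

theorem faceValue_compAt (hS : IsFace i S) {p q r : Thick.{w} n} (f : (p ⟶[SSet.{w}] q).obj m)
    (g : (q ⟶[SSet.{w}] r).obj m) (hf : SupportedIn (mk f) S) (hg : SupportedIn (mk g) S)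
    (h : SupportedIn (mk (compAt f g)) S) :
    faceValue σ hi hi' hS (compAt f g) h =
      compAt (faceValue σ hi hi' hS f hf) (faceValue σ hi hi' hS g hg) := by
  refine mk_injective ((mk_faceValue σ hi hi' hS _ h).trans ?_)
  rw [image_mk, map_compAt_enrichedFunctor]
  exact mk_compAt_congr (mk_faceValue σ hi hi' hS f hf).symm (mk_faceValue σ hi hi' hS g hg).symm

theorem faceValue_idAt (hS : IsFace i S) (p : Thick.{w} n) (h : SupportedIn (mk (idAt p m)) S) :
    faceValue σ hi hi' hS (idAt p m) h = idAt _ m := by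
  refine mk_injective ((mk_faceValue σ hi hi' hS _ h).trans ?_)
  rw [image_mk, map_idAt_enrichedFunctor]
  exact mk_idAt_congr (faceDiagram_obj σ hi hi' hS p h.left_mem)

theorem map_faceValue (hS : IsFace i S) {p q : Thick.{w} n} (f : (p ⟶[SSet.{w}] q).obj m)
    (hf : SupportedIn (mk f) S) (s : m ⟶ k) :
    (vertex σ hi hi' p ⟶[SSet.{w}] vertex σ hi hi' q).map s (faceValue σ hi hi' hS f hf) =
      faceValue σ hi hi' hS ((p ⟶[SSet.{w}] q).map s f) (hf.map s) := by
  refine mk_injective (Eq.trans ?_ (mk_faceValue σ hi hi' hS _ (hf.map s)).symm)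
  exact (congrArg (SimplicialArrow.map s) (mk_faceValue σ hi hi' hS f hf)).trans
    (image_map (faceDiagram σ hS) s (mk f)).symm

/-! ### Cutting chains of paths -/

theorem pathAt_left_of_compAt {p r q : Thick.{w} n} (f : (p ⟶[SSet.{w}] r).obj m)
    (g : (r ⟶[SSet.{w}] q).obj m) (x : Fin (m.unop.len + 1)) :
    pathAt (a := p) (b := r) f x = pathAt (a := p) (b := q) (compAt f g) x ∩ Set.Iic r.as := by
  rw [pathAt_compAt]
  ext j
  refine ⟨fun h => ⟨Or.inl h, ge_of_mem_pathAt (a := p) (b := r) f h⟩, fun ⟨h, h'⟩ => ?_⟩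
  rcases h with h | h
  · exact h
  · rw [le_antisymm h' (le_of_mem_pathAt (a := r) (b := q) g h)]
    exact right_mem_pathAt (a := p) (b := r) f x

theorem pathAt_right_of_compAt {p r q : Thick.{w} n} (f : (p ⟶[SSet.{w}] r).obj m)
    (g : (r ⟶[SSet.{w}] q).obj m) (x : Fin (m.unop.len + 1)) :
    pathAt (a := r) (b := q) g x = pathAt (a := p) (b := q) (compAt f g) x ∩ Set.Ici r.as := by
  rw [pathAt_compAt]
  ext j
  refine ⟨fun h => ⟨Or.inr h, le_of_mem_pathAt (a := r) (b := q) g h⟩, fun ⟨h, h'⟩ => ?_⟩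
  rcases h with h | h
  · rw [le_antisymm (ge_of_mem_pathAt (a := p) (b := r) f h) h']
    exact left_mem_pathAt (a := r) (b := q) g x
  · exact h

/-- The part between `r` and `s` of a chain of paths that all visit `r` and `s`. -/
def between {p q : Thick.{w} n} (f : (p ⟶[SSet.{w}] q).obj m) (r s : Thick.{w} n) (hrs : r.as ≤ s.as)
    (hr : ∀ x, r.as ∈ pathAt (a := p) (b := q) f x)
    (hs : ∀ x, s.as ∈ pathAt (a := p) (b := q) f x) : (r ⟶[SSet.{w}] s).obj m :=
  mkChain (a := r) (b := s) (fun x => pathAt (a := p) (b := q) f x ∩ Set.Icc r.as s.as)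
    (fun _ _ h => Set.inter_subset_inter_left _ (pathAt_mono (a := p) (b := q) f h))
    (fun x => ⟨hr x, le_rfl, hrs⟩) (fun x => ⟨hs x, hrs, le_rfl⟩) (fun _ _ hj => hj.2)

theorem pathAt_between {p q : Thick.{w} n} (f : (p ⟶[SSet.{w}] q).obj m) (r s : Thick.{w} n)
    (hrs : r.as ≤ s.as) (hr : ∀ x, r.as ∈ pathAt (a := p) (b := q) f x)
    (hs : ∀ x, s.as ∈ pathAt (a := p) (b := q) f x) (x : Fin (m.unop.len + 1)) :
    pathAt (a := r) (b := s) (between f r s hrs hr hs) x =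
      pathAt (a := p) (b := q) f x ∩ Set.Icc r.as s.as := rfl

/-! ### From inner horns to cubical horns -/

/-- `g` is the value of the horn on a chain `f` of paths which is a composite of two chains supported
in faces of the horn. -/
def IsValue {p q : Thick.{w} n} (f : (p ⟶[SSet.{w}] q).obj m)
    (g : (vertex σ hi hi' p ⟶[SSet.{w}] vertex σ hi hi' q).obj m) : Prop :=
  ∃ (r : Thick.{w} n) (f₁ : (p ⟶[SSet.{w}] r).obj m) (f₂ : (r ⟶[SSet.{w}] q).obj m)
    (S T : Set (Fin (n + 1))) (hS : IsFace i S) (hT : IsFace i T) (h₁ : SupportedIn (mk f₁) S)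
    (h₂ : SupportedIn (mk f₂) T), compAt f₁ f₂ = f ∧
      g = compAt (faceValue σ hi hi' hS f₁ h₁) (faceValue σ hi hi' hT f₂ h₂)

variable {σ hi hi'}

/-- The values given by two decompositions of the same chain of paths are compared by cutting it
at both of the intermediate vertices. -/
theorem IsValue.unique {p q : Thick.{w} n} {f : (p ⟶[SSet.{w}] q).obj m}
    {g g' : (vertex σ hi hi' p ⟶[SSet.{w}] vertex σ hi hi' q).obj m} (h : IsValue σ hi hi' f g)
    (h' : IsValue σ hi hi' f g') : g = g' := by
  obtain ⟨r, f₁, f₂, S, T, hS, hT, h₁, h₂, hf, rfl⟩ := h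
  obtain ⟨r', f₁', f₂', S', T', hS', hT', h₁', h₂', hf', rfl⟩ := h'
  wlog hr : r.as ≤ r'.as generalizing r f₁ f₂ S T r' f₁' f₂' S' T'
  · exact (this r' f₁' f₂' S' T' hS' hT' h₁' h₂' hf' r f₁ f₂ S T hS hT h₁ h₂ hf
      (le_of_not_ge hr)).symm
  have l := fun x => hf ▸ pathAt_left_of_compAt f₁ f₂ x
  have l' := fun x => hf' ▸ pathAt_left_of_compAt f₁' f₂' x
  have e := fun x => hf ▸ pathAt_right_of_compAt f₁ f₂ x
  have e' := fun x => hf' ▸ pathAt_right_of_compAt f₁' f₂' x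
  have hr1 : ∀ x, r.as ∈ pathAt (a := p) (b := q) f x := fun x =>
    ((l x).le (right_mem_pathAt (a := p) (b := r) f₁ x)).1
  have hr1' : ∀ x, r'.as ∈ pathAt (a := p) (b := q) f x := fun x =>
    ((l' x).le (right_mem_pathAt (a := p) (b := r') f₁' x)).1
  have c1 : compAt f₁ (between f r r' hr hr1 hr1') = f₁' := by
    refine chain_ext (a := p) (b := r') fun x => ?_
    rw [pathAt_compAt, l x, l' x, pathAt_between]
    ext j
    simp only [Set.mem_union, Set.mem_inter_iff, Set.mem_Iic, Set.mem_Icc]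
    constructor
    · rintro (h | h)
      exacts [⟨h.1, h.2.trans hr⟩, ⟨h.1, h.2.2⟩]
    · rintro ⟨h, h'⟩
      exact (le_total j r.as).imp (fun hj => ⟨h, hj⟩) fun hj => ⟨h, hj, h'⟩
  have c2 : compAt (between f r r' hr hr1 hr1') f₂' = f₂ := by
    refine chain_ext (a := r) (b := q) fun x => ?_
    rw [pathAt_compAt, e x, e' x, pathAt_between]
    ext j
    simp only [Set.mem_union, Set.mem_inter_iff, Set.mem_Ici, Set.mem_Icc]
    constructor
    · rintro (h | h)
      exacts [⟨h.1, h.2.1⟩, ⟨h.1, hr.trans h.2⟩]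
    · rintro ⟨h, h'⟩
      exact (le_total j r'.as).imp (fun hj => ⟨h, h', hj⟩) fun hj => ⟨h, hj⟩
  subst c1 c2
  obtain ⟨h₁'', hm⟩ := supportedIn_compAt.1 h₁'
  obtain ⟨hm', h₂''⟩ := supportedIn_compAt.1 h₂
  rw [faceValue_compAt σ hi hi' hS' _ _ h₁'' hm, faceValue_compAt σ hi hi' hT _ _ hm' h₂'',
    compAt_assoc, faceValue_eq σ hi hi' hS hS' f₁ h₁ h₁'', faceValue_eq σ hi hi' hT hS' _ hm' hm,
    faceValue_eq σ hi hi' hT hT' f₂' h₂'' h₂']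

theorem IsValue.map {p q : Thick.{w} n} {f : (p ⟶[SSet.{w}] q).obj m}
    {g : (vertex σ hi hi' p ⟶[SSet.{w}] vertex σ hi hi' q).obj m} (h : IsValue σ hi hi' f g)
    (s : m ⟶ k) : IsValue σ hi hi' ((p ⟶[SSet.{w}] q).map s f)
      ((vertex σ hi hi' p ⟶[SSet.{w}] vertex σ hi hi' q).map s g) := by
  obtain ⟨r, f₁, f₂, S, T, hS, hT, h₁, h₂, rfl, rfl⟩ := h
  refine ⟨r, _, _, S, T, hS, hT, h₁.map s, h₂.map s, (map_compAt s f₁ f₂).symm, ?_⟩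
  rw [map_compAt, map_faceValue, map_faceValue]

theorem isValue_faceValue {p q : Thick.{w} n} (f : (p ⟶[SSet.{w}] q).obj m) {S : Set (Fin (n + 1))}
    (hS : IsFace i S) (hf : SupportedIn (mk f) S) :
    IsValue σ hi hi' f (faceValue σ hi hi' hS f hf) :=
  ⟨p, idAt p m, f, S, S, hS, hS, supportedIn_idAt p hf.left_mem, hf, idAt_compAt f, by
    rw [faceValue_idAt, idAt_compAt]⟩

theorem isFace_compl_singleton {j : Fin (n + 1)} (hj : j ≠ i) : IsFace i {j}ᶜ :=
  ⟨⟨i, fun h => hj h.symm⟩, j, hj, fun h => h rfl⟩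

theorem exists_isValue {p q : Thick.{w} n} (f : (p ⟶[SSet.{w}] q).obj m)
    (hf : f ∈ (cubicalHorn p q (ULift.up i)).obj m) : ∃ g, IsValue σ hi hi' f g := by
  rcases hf with ⟨j, hj, h⟩ | ⟨j, h1, h2, h⟩
  · have hj' : j.down ≠ i := fun h => hj (ULift.ext _ _ h)
    exact ⟨_, isValue_faceValue f (isFace_compl_singleton hj')
      fun x l hl hl' => h x (ULift.ext l j hl' ▸ hl)⟩
  · -- cut at `j`: the part before `j` avoids the last vertex, the part after `j` avoids the first one
    have hp := fun x => left_mem_pathAt (a := p) (b := q) f x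
    have hq := fun x => right_mem_pathAt (a := p) (b := q) f x
    refine ⟨_, ⟨j⟩, between f p ⟨j⟩ h1.le hp h, between f ⟨j⟩ q h2.le h hq, _, _,
      isFace_compl_singleton hi'.ne', isFace_compl_singleton hi.ne, ?_, ?_, ?_, rfl⟩
    · rintro x l ⟨-, -, hl⟩ hl'
      have : l.down ≤ j.down := hl
      have h2' : j.down < q.as.down := h2
      exact absurd (hl' ▸ this.trans_lt h2') (Fin.le_last _).not_gt
    · rintro x l ⟨-, hl, -⟩ hl'
      have : j.down ≤ l.down := hl
      have h1' : p.as.down < j.down := h1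
      exact absurd (hl' ▸ h1'.trans_le this) (Fin.zero_le _).not_gt
    · refine chain_ext (a := p) (b := q) fun x => ?_
      rw [pathAt_compAt, pathAt_between, pathAt_between]
      ext l
      constructor
      · rintro (h | h) <;> exact h.1
      · intro hl
        exact (le_total l j).imp (fun h => ⟨hl, le_of_mem_pathAt (a := p) (b := q) f hl, h⟩)
          fun h => ⟨hl, h, ge_of_mem_pathAt (a := p) (b := q) f hl⟩

variable (σ hi hi')

/-- The map from a cubical horn to a mapping space determined by a map from a horn to the homotopy
coherent nerve. -/
noncomputable def cubicalHornMap (p q : Thick.{w} n) :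
    (cubicalHorn p q (ULift.up i) : SSet.{w}) ⟶
      (vertex σ hi hi' p ⟶[SSet.{w}] vertex σ hi hi' q) where
  app _ := ↾fun f => (exists_isValue (σ := σ) (hi := hi) (hi' := hi') f.1 f.2).choose
  naturality m k s := by
    ext f
    exact (exists_isValue _ (Subtype.prop ((cubicalHorn p q (ULift.up i) : SSet.{w}).map s f))
      ).choose_spec.unique ((exists_isValue f.1 f.2).choose_spec.map s)

theorem exists_extension [∀ x y : C, SSet.KanComplex (x ⟶[SSet.{w}] y)] (p q : Thick.{w} n) :
    ∃ Φ : (p ⟶[SSet.{w}] q) ⟶ (vertex σ hi hi' p ⟶[SSet.{w}] vertex σ hi hi' q),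
      ∀ (m : SimplexCategoryᵒᵖ) (f : (p ⟶[SSet.{w}] q).obj m),
        f ∈ (cubicalHorn p q (ULift.up i)).obj m → IsValue σ hi hi' f (Φ.app m f) := by
  suffices ∃ Φ : nerve (p ⟶ q) ⟶ (vertex σ hi hi' p ⟶[SSet.{w}] vertex σ hi hi' q),
      (cubicalHorn p q (ULift.up i)).ι ≫ Φ = cubicalHornMap σ hi hi' p q by
    obtain ⟨Φ, hΦ⟩ := this
    refine ⟨Φ, fun m f hf => ?_⟩
    rw [show Φ.app m f = (cubicalHornMap σ hi hi' p q).app m ⟨f, hf⟩ from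
      congrArg (fun F => F.app m ⟨f, hf⟩) hΦ]
    exact (exists_isValue f hf).choose_spec
  by_cases h : p.as < ULift.up i ∧ ULift.up i < q.as
  · exact exists_extension_cubicalHorn h.1 h.2 _
  · -- in this case all paths from `p` to `q` avoid the first vertex, or all avoid the last one
    have htop : ∀ (m : SimplexCategoryᵒᵖ) (f : (nerve (p ⟶ q)).obj m),
        f ∈ (cubicalHorn p q (ULift.up i)).obj m := by
      intro m f
      rw [not_and_or, not_lt, not_lt] at h
      rcases h with h | h
      · refine Or.inl ⟨ULift.up 0, fun h' => hi.ne (congrArg ULift.down h'), fun x hx => ?_⟩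
        exact absurd (h.trans (le_of_mem_pathAt f hx)) hi.not_ge
      · refine Or.inl ⟨ULift.up (Fin.last n), fun h' => hi'.ne' (congrArg ULift.down h'),
          fun x hx => ?_⟩
        exact absurd ((ge_of_mem_pathAt f hx).trans h) hi'.not_ge
    refine ⟨SSet.Subcomplex.lift (𝟙 _) ?_ ≫ cubicalHornMap σ hi hi' p q, rfl⟩
    rintro m _ ⟨f, rfl⟩
    exact htop m f

theorem idAt_mem_cubicalHorn (p : Thick.{w} n) (hi : 0 < i) (hi' : i < Fin.last n) :
    idAt p m ∈ (cubicalHorn p p (ULift.up i)).obj m := by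
  obtain ⟨-, j, hj, h⟩ := isFace_singleton hi hi' p.as.down
  exact Or.inl ⟨ULift.up j, fun h' => hj (congrArg ULift.down h'),
    fun x hx => h (congrArg ULift.down hx)⟩

theorem eq_idAt (p : Thick.{w} n) (f : (p ⟶[SSet.{w}] p).obj m) : f = idAt p m := by
  refine chain_ext (a := p) (b := p) fun x => Set.ext fun j => ?_
  rw [pathAt_idAt]
  exact ⟨fun h => le_antisymm (ge_of_mem_pathAt (a := p) (b := p) f h)
    (le_of_mem_pathAt (a := p) (b := p) f h), fun h => h ▸ left_mem_pathAt (a := p) (b := p) f x⟩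

/-- A map from an inner horn to the homotopy coherent nerve of a locally Kan simplicial category
extends to a simplicial functor. -/
theorem exists_filler [∀ x y : C, SSet.KanComplex (x ⟶[SSet.{w}] y)] :
    ∃ τ : EnrichedFunctor SSet.{w} (Thick.{w} n) C,
      ∀ {m : SimplexCategoryᵒᵖ} {p q : Thick.{w} n} (f : (p ⟶[SSet.{w}] q).obj m),
        f ∈ (cubicalHorn p q (ULift.up i)).obj m →
          ∃ g, IsValue σ hi hi' f g ∧ mk ((τ.map p q).app m f) = mk g := by
  choose Φ hΦ using exists_extension σ hi hi'
  have hid : ∀ p m, (Φ p p).app m (idAt p m) = idAt _ m := fun p m =>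
    (hΦ p p m _ (idAt_mem_cubicalHorn p hi hi')).unique
      ((faceValue_idAt σ hi hi' (isFace_singleton hi hi' p.as.down) p
        (supportedIn_idAt p rfl)) ▸ isValue_faceValue _ _ _)
  refine ⟨⟨vertex σ hi hi', Φ, fun p => ?_, fun p r q => ?_⟩,
    fun f hf => ⟨_, hΦ _ _ _ f hf, rfl⟩⟩
  · ext m x
    exact hid p m
  · ext m ⟨f, g⟩
    change (Φ p q).app m (compAt f g) = compAt ((Φ p r).app m f) ((Φ r q).app m g)
    have hpr := Path.le (f.obj 0)
    have hrq := Path.le (g.obj 0)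
    by_cases h1 : p = r
    · subst h1
      rw [eq_idAt p f, hid, idAt_compAt, idAt_compAt]
    by_cases h2 : r = q
    · subst h2
      rw [eq_idAt r g, hid, compAt_idAt, compAt_idAt]
    -- `f` avoids the last vertex and `g` avoids the first one, so both lie in faces of the horn, and
    -- their composite lies in the cubical horn
    have h1' : p.as < r.as := lt_of_le_of_ne hpr fun h => h1 (congrArg SimplicialThickening.mk h)
    have h2' : r.as < q.as := lt_of_le_of_ne hrq fun h => h2 (congrArg SimplicialThickening.mk h)
    have hf : SupportedIn (mk f) {Fin.last n}ᶜ := fun x j hj hj' =>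
      (Fin.le_last q.as.down).not_gt ((hj' ▸ ge_of_mem_pathAt (a := p) (b := r) f hj :
        Fin.last n ≤ r.as.down).trans_lt h2')
    have hg : SupportedIn (mk g) {0}ᶜ := fun x j hj hj' =>
      (Fin.zero_le p.as.down).not_gt (h1'.trans_le (hj' ▸ le_of_mem_pathAt (a := r) (b := q) g hj :
        r.as.down ≤ 0))
    have hF := isFace_compl_singleton hi'.ne'
    have hG := isFace_compl_singleton hi.ne
    have v1 : (Φ p r).app m f = faceValue σ hi hi' hF f hf :=
      (hΦ p r m f (Or.inl ⟨ULift.up (Fin.last n), fun h' => hi'.ne' (congrArg ULift.down h'),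
        fun x hx => hf x _ hx rfl⟩)).unique (isValue_faceValue f hF hf)
    have v2 : (Φ r q).app m g = faceValue σ hi hi' hG g hg :=
      (hΦ r q m g (Or.inl ⟨ULift.up 0, fun h' => hi.ne (congrArg ULift.down h'),
        fun x hx => hg x _ hx rfl⟩)).unique (isValue_faceValue g hG hg)
    rw [v1, v2]
    exact (hΦ p q m (compAt f g) (Or.inr ⟨r.as, h1', h2', fun x =>
      Or.inl (right_mem_pathAt (a := p) (b := r) f x)⟩)).unique
        ⟨r, f, g, _, _, hF, hG, hf, hg, rfl, rfl⟩

end Diagram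

/-- The homotopy coherent nerve of a locally Kan simplicial category is a quasi-category. -/
theorem quasicategory [∀ x y : C, SSet.KanComplex (x ⟶[SSet.{w}] y)] :
    SSet.Quasicategory (SimplicialNerve C) := by
  refine SSet.quasicategory_of_filler _ fun n i σ hi hi' => ?_
  obtain ⟨τ, h⟩ := exists_filler σ hi hi'
  refine ⟨τ, fun j hj => ?_⟩
  let δ : Fin (n + 2) →o Fin (n + 3) := (SimplexCategory.δ j).toOrderHom
  have hδ : ∃ l, l ≠ i ∧ ∀ x, δ x ≠ l := ⟨j, hj, fun x => Fin.succAbove_ne j x⟩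
  change (SimplicialThickening.functor δ.uliftMap).comp SSet.{w} τ = diagram σ δ hδ
  have himage : ∀ (m : SimplexCategoryᵒᵖ) (a : SimplicialArrow (Thick.{w} (n + 1)) m),
      image ((SimplicialThickening.functor δ.uliftMap).comp SSet.{w} τ) a =
        image (diagram σ δ hδ) a := by
    intro m a
    have hF := isFace_compl_singleton hj
    have ha : SupportedIn (image (SimplicialThickening.functor δ.uliftMap) a) {j}ᶜ := by
      rintro x l ⟨l', -, rfl⟩
      exact Fin.succAbove_ne j l'.down
    obtain ⟨g, hg, hg'⟩ := h (image (SimplicialThickening.functor δ.uliftMap) a).hom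
      (Or.inl ⟨ULift.up j, fun h' => hj (congrArg ULift.down h'), fun x hx => ha x _ hx rfl⟩)
    rw [hg.unique (isValue_faceValue _ hF ha)] at hg'
    refine hg'.trans ((mk_faceValue σ hi hi' hF _ ha).trans ?_)
    exact image_diagram σ _ _ δ δ hδ
      (fun x => retraction_eq hF.1 (Fin.succAbove_ne j x)) a
  refine enrichedFunctor_ext (fun p => ?_) himage
  exact congrArg SimplicialArrow.src (himage (op ⦋0⦌) (mk (idAt p _)))

end CategoryTheory.SimplicialNerve

/-! ### Mapping spaces of the monoidal envelope -/

namespace SSet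

open Simplicial HomotopicalAlgebra

/-- Horns are connected: a function on the simplices of a horn that is invariant under simplicial
operators is constant. -/
theorem eq_const_of_horn {n : ℕ} (i : Fin (n + 2)) {D : Type*}
    (d : ∀ {m : SimplexCategoryᵒᵖ}, (Λ[n + 1, i] : SSet.{u}).obj m → D)
    (hd : ∀ {m k : SimplexCategoryᵒᵖ} (p : m ⟶ k) (x : (Λ[n + 1, i] : SSet.{u}).obj m),
      d ((Λ[n + 1, i] : SSet.{u}).map p x) = d x) :
    ∃ c, ∀ (m : SimplexCategoryᵒᵖ) (x : (Λ[n + 1, i] : SSet.{u}).obj m), d x = c := by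
  let vert (v : Fin (n + 2)) (hv : ∃ j, j ≠ i ∧ v ≠ j) :
      (Λ[n + 1, i] : SSet.{u}).obj (op ⦋0⦌) :=
    ⟨stdSimplex.objMk (n := ⦋n + 1⦌) (m := op ⦋0⦌) (OrderHom.const _ v),
      (mem_horn_iff_notMem_range _ _).2 (by
        obtain ⟨j, hj, hv⟩ := hv
        exact ⟨j, hj, fun ⟨x, hx⟩ => hv hx⟩)⟩
  -- vertices lying in a common face of the horn are joined by an edge of the horn
  have edge : ∀ (v v' : Fin (n + 2)) (hv : ∃ j, j ≠ i ∧ v ≠ j) (hv' : ∃ j, j ≠ i ∧ v' ≠ j),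
      v ≤ v' → (∃ j, j ≠ i ∧ v ≠ j ∧ v' ≠ j) → d (vert v hv) = d (vert v' hv') := by
    intro v v' hv hv' hvv' hj
    let e : (Λ[n + 1, i] : SSet.{u}).obj (op ⦋1⦌) :=
      ⟨stdSimplex.objMk (n := ⦋n + 1⦌) (m := op ⦋1⦌)
        ⟨fun x => if x = 0 then v else v', fun x y h => by
          by_cases hx : x = 0 <;> by_cases hy : y = 0 <;> simp [hx, hy, hvv']
          exact absurd (le_antisymm (hy ▸ h) (Fin.zero_le _)) hx⟩,
        (mem_horn_iff_notMem_range _ _).2 (by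
          obtain ⟨j, hj, h1, h2⟩ := hj
          refine ⟨j, hj, fun ⟨x, hx⟩ => ?_⟩
          change (if x = 0 then v else v') = j at hx
          split_ifs at hx
          exacts [h1 hx, h2 hx])⟩
    have e0 : (Λ[n + 1, i] : SSet.{u}).map (SimplexCategory.const ⦋0⦌ ⦋1⦌ 0).op e = vert v hv := rfl
    have e1 : (Λ[n + 1, i] : SSet.{u}).map (SimplexCategory.const ⦋0⦌ ⦋1⦌ 1).op e =
      vert v' hv' := rfl
    rw [← e0, ← e1, hd, hd]
  have hi : ∃ j, j ≠ i ∧ i ≠ j := by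
    obtain ⟨j, hj⟩ := exists_ne i
    exact ⟨j, hj, hj.symm⟩
  refine ⟨d (vert i hi), fun m x => ?_⟩
  let v := stdSimplex.asOrderHom x.1 0
  obtain ⟨j, hj, hx⟩ := (mem_horn_iff_notMem_range (d := m.unop.len) x.1 i).1 x.2
  have hv : v ≠ j := fun h => hx ⟨0, h⟩
  have e : (Λ[n + 1, i] : SSet.{u}).map (SimplexCategory.const ⦋0⦌ m.unop 0).op x =
    vert v ⟨j, hj, hv⟩ := rfl
  rw [← hd (SimplexCategory.const ⦋0⦌ m.unop 0).op x, e]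
  rcases le_total v i with h | h
  · exact edge v i ⟨j, hj, hv⟩ hi h ⟨j, hj, hv, hj.symm⟩
  · exact (edge i v hi ⟨j, hj, hv⟩ h ⟨j, hj, hj.symm, hv⟩).symm

open modelCategoryQuillen in
theorem kanComplex_of_hornFilling (S : SSet.{u})
    (h : ∀ {n : ℕ} {i : Fin (n + 2)} (σ : (Λ[n + 1, i] : SSet) ⟶ S),
      ∃ τ : Δ[n + 1] ⟶ S, Λ[n + 1, i].ι ≫ τ = σ) : KanComplex S := by
  refine (isFibrant_iff _).2 ⟨?_⟩
  rw [fibrations_eq]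
  intro _ _ _ hf
  simp only [J, MorphismProperty.iSup_iff] at hf
  obtain ⟨n, ⟨i⟩⟩ := hf
  refine ⟨fun {t _} _ ↦ ?_⟩
  obtain ⟨τ, hτ⟩ := h t
  exact ⟨⟨{ l := τ, fac_left := hτ, fac_right := by subsingleton }⟩⟩

end SSet

namespace ListNerve.Envelope

open Simplicial

variable {Q : SimplicialOperad.{w, u}}

theorem map_src_map {a b : Envelope Q} {m k : SimplexCategoryᵒᵖ} (p : m ⟶ k)
    (fs : (homSpace a b).obj m) :
    ((homSpace a b).map p fs).1.map (Q.level k).src = fs.1.map (Q.level m).src := by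
  change (fs.1.map _).map _ = _
  rw [List.map_map]
  exact List.map_congr_left fun f _ => ((Q.map p).src_op f).trans (List.map_id _)

theorem length_homSpace {a b : Envelope Q} {m : SimplexCategoryᵒᵖ} (fs : (homSpace a b).obj m) :
    fs.1.length = b.cols.length := by
  have := congrArg List.length fs.2.2
  rwa [List.length_map] at this

/-- The mapping spaces of the monoidal envelope are disjoint unions of products of spaces of
operations, hence they are Kan complexes if the spaces of operations are. -/
theorem kanComplex_homSpace (hQ : ∀ (as : List Q.Col) (b : Q.Col), SSet.KanComplex (Q.opSpace as b))
    (a b : Envelope Q) : SSet.KanComplex (homSpace a b) := by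
  refine SSet.kanComplex_of_hornFilling _ fun {n i} σ => ?_
  -- all the simplices of the horn have the same lists of sources
  obtain ⟨srcs, hc⟩ := SSet.eq_const_of_horn i (fun {m} x => (σ.app m x).1.map (Q.level m).src)
    (fun {m k} p x => by
      rw [NatTrans.naturality_apply σ p x]
      exact map_src_map p _)
  obtain ⟨x₀⟩ : Nonempty ((Λ[n + 1, i] : SSet.{u}).obj (op ⦋0⦌)) := by
    obtain ⟨j, hj⟩ := exists_ne i
    exact ⟨⟨SSet.stdSimplex.objMk (n := ⦋n + 1⦌) (m := op ⦋0⦌) (OrderHom.const _ i),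
      (SSet.mem_horn_iff_notMem_range _ _).2 ⟨j, hj, fun ⟨x, hx⟩ => hj hx.symm⟩⟩⟩
  have hlen : srcs.length = b.cols.length := by
    rw [← hc _ x₀, List.length_map, length_homSpace]
  have hflat : srcs.flatten = a.cols := by
    rw [← hc _ x₀, ← List.flatMap_def, (σ.app _ x₀).2.1]
  let comp (l : Fin b.cols.length) : (Λ[n + 1, i] : SSet.{u}) ⟶
      Q.opSpace (srcs[l.1]'(l.2.trans_eq hlen.symm)) (b.cols[l.1]) :=
    { app m := ↾fun x => ⟨(σ.app m x).1[l.1]'((length_homSpace _).symm ▸ l.2), by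
          simp only [← hc m x, List.getElem_map], by
          simp only [← (σ.app m x).2.2, List.getElem_map]⟩
      naturality m k p := by
        ext x
        refine Subtype.ext ?_
        change (σ.app k ((Λ[n + 1, i] : SSet.{u}).map p x)).1[l.1]'_ =
          (Q.map p).op ((σ.app m x).1[l.1]'_)
        simp only [NatTrans.naturality_apply σ p x]
        exact List.getElem_map _ }
  have hfill (l : Fin b.cols.length) :=
    (hQ (srcs[l.1]'(l.2.trans_eq hlen.symm)) b.cols[l.1]).hornFilling (comp l)
  choose τ hτ using hfill
  refine ⟨{ app m := ↾fun y => ⟨List.ofFn fun l => ((τ l).app m y).1, ?_, ?_⟩, naturality := ?_ }, ?_⟩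
  · rw [List.flatMap_def, List.map_ofFn, ← hflat]
    congr 1
    refine List.ext_getElem (by simp [hlen]) fun l h1 h2 => ?_
    simp only [List.getElem_ofFn, Function.comp_apply]
    exact ((τ _).app m y).2.1
  · rw [List.map_ofFn]
    refine List.ext_getElem (by simp) fun l h1 h2 => ?_
    simp only [List.getElem_ofFn, Function.comp_apply]
    exact ((τ _).app m y).2.2
  · intro m k p
    ext y
    refine Subtype.ext ?_
    change (List.ofFn fun l => ((τ l).app k (Δ[n + 1].map p y)).1) = List.map _ (List.ofFn _)
    rw [List.map_ofFn]
    congr 1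
    funext l
    exact congrArg Subtype.val (NatTrans.naturality_apply (τ l) p y)
  · ext m x
    refine Subtype.ext (List.ext_getElem (by simp [length_homSpace]) fun l h1 h2 => ?_)
    have hl : l < b.cols.length := by rwa [length_homSpace] at h2
    have := congrArg (fun F => (F.app m x).1) (hτ ⟨l, hl⟩)
    exact (List.getElem_ofFn (f := fun l => ((τ l).app m x.1).1) _).trans this.symm

end ListNerve.Envelope

/-! ### Monotone maps of finite ordinals and cutting lists into blocks -/

namespace ListNerve

/-- The preimage of `b` under a map of finite ordinals, as an increasing sequence. -/
abbrev fiberList {k n : ℕ} (p : Fin k → Fin n) (b : Fin n) : List (Fin k) :=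
  (List.finRange k).filter fun x => p x = b

theorem finRange_eq_flatMap_fiberList {k n : ℕ} {p : Fin k → Fin n} (hp : Monotone p) :
    List.finRange k = (List.finRange n).flatMap (fiberList p) := by
  refine List.Pairwise.eq_of_mem_iff (List.pairwise_lt_finRange _)
    (flatMap_pairwise_lt (List.pairwise_lt_finRange _) p hp _
      (fun b => (List.pairwise_lt_finRange _).filter _) fun b x hx => by simpa using hx) ?_
  simp

theorem count_map_finRange {k n : ℕ} (p : Fin k → Fin n) (b : Fin n) :
    ((List.finRange k).map p).count b = (fiberList p b).length := by
  rw [List.count, List.countP_map, List.countP_eq_length_filter]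
  congr 1

theorem pairwise_map_finRange {k n : ℕ} {p : Fin k → Fin n} (hp : Monotone p) :
    ((List.finRange k).map p).Pairwise (· ≤ ·) :=
  List.pairwise_map.2 ((List.pairwise_lt_finRange k).imp fun h => hp h.le)

/-- A monotone map of finite ordinals is determined by the cardinalities of its fibers. -/
theorem monotone_ext {k n : ℕ} {p q : Fin k → Fin n} (hp : Monotone p) (hq : Monotone q)
    (h : ∀ b, (fiberList p b).length = (fiberList q b).length) : p = q := by
  have e : (List.finRange k).map p = (List.finRange k).map q := by
    refine List.Perm.eq_of_pairwise (fun _ _ _ _ => le_antisymm) (pairwise_map_finRange hp)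
      (pairwise_map_finRange hq) (List.perm_iff_count.2 fun b => ?_)
    rw [count_map_finRange, count_map_finRange, h]
  exact funext fun x => List.map_inj_left.1 e x (List.mem_finRange x)

theorem exists_monotone {k n : ℕ} (l : Fin n → ℕ) (hl : ((List.finRange n).map l).sum = k) :
    ∃ p : Fin k → Fin n, Monotone p ∧ ∀ b, (fiberList p b).length = l b := by
  -- the sequence of the values of `p`: each `b` is repeated `l b` times
  let R := (List.finRange n).flatMap fun b => List.replicate (l b) b
  have hR : R.length = k := by simp [R, List.length_flatMap, hl]
  have hs : R.Pairwise (· ≤ ·) := by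
    refine List.pairwise_flatMap.2 ⟨fun b _ => ?_, (List.pairwise_lt_finRange n).imp ?_⟩
    · exact List.pairwise_replicate.2 (Or.inr le_rfl)
    · intro b b' hb x hx y hy
      rw [List.eq_of_mem_replicate hx, List.eq_of_mem_replicate hy]
      exact hb.le
  have hmap : (List.finRange k).map (fun x => R[x.1]'(x.2.trans_eq hR.symm)) = R := by
    refine List.ext_getElem (by simp [hR]) fun i h1 h2 => ?_
    simp
  refine ⟨fun x => R[x.1]'(x.2.trans_eq hR.symm), fun x y hxy => ?_, fun b => ?_⟩
  · rcases hxy.eq_or_lt with rfl | h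
    · exact le_rfl
    · exact List.pairwise_iff_getElem.1 hs _ _ _ _ h
  · rw [← count_map_finRange, hmap, List.count_flatMap]
    have : (List.count b ∘ fun b' => List.replicate (l b') b') = fun b' =>
        if b' = b then l b' else 0 := by
      funext b'
      simp [List.count_replicate]
    rw [this, ← List.ofFn_eq_map, List.sum_ofFn]
    simp

theorem eqOn_of_flatMap_eq {A B : Type*} {l : List A} {f g : A → List B}
    (h : l.flatMap f = l.flatMap g) (hl : ∀ x ∈ l, (f x).length = (g x).length) :
    ∀ x ∈ l, f x = g x := by
  induction l with
  | nil => simp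
  | cons x l ih =>
    rw [List.flatMap_cons, List.flatMap_cons] at h
    obtain ⟨h1, h2⟩ := List.append_inj h (hl x List.mem_cons_self)
    intro y hy
    rcases List.mem_cons.1 hy with rfl | hy
    · exact h1
    · exact ih h2 (fun z hz => hl z (List.mem_cons_of_mem _ hz)) y hy

theorem length_fiberList_comp {k n l : ℕ} {p : Fin k → Fin n} (hp : Monotone p) {q : Fin n → Fin l}
    (b : Fin l) : (fiberList (q ∘ p) b).length =
      ((fiberList q b).map fun x => (fiberList p x).length).sum := by
  have e : fiberList (q ∘ p) b = (fiberList q b).flatMap (fiberList p) := by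
    refine List.Pairwise.eq_of_mem_iff ((List.pairwise_lt_finRange _).filter _)
      (flatMap_pairwise_lt ((List.pairwise_lt_finRange _).filter _) p hp _
        (fun b => (List.pairwise_lt_finRange _).filter _) fun b x hx => by simpa using hx) ?_
    simp
  rw [e, List.length_flatMap]

namespace OperadData

variable {C : Type w} (P : OperadData.{w, u} C)

/-- If the list of operations plugged into the `γ b` is given as a concatenation of blocks of the right
sizes, composition of lists of operations composes each `γ b` with its block. -/
theorem compList_flatMap {A B : Type*} (l : List B) (γ : B → P.Op) (F : B → List A)
    (φ : A → P.Op) (h : ∀ b, ((F b).map φ).map P.tgt = P.src (γ b))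
    (h' : ((l.flatMap F).map φ).map P.tgt = (l.map γ).flatMap P.src) :
    P.compList (l.map γ) ((l.flatMap F).map φ) h' =
      l.map fun b => P.comp (γ b) ((F b).map φ) (h b) := by
  induction l with
  | nil => rfl
  | cons b l ih =>
    have h'' : ((l.flatMap F).map φ).map P.tgt = (l.map γ).flatMap P.src := by
      simp only [List.map_flatMap, List.flatMap_map, h]
    refine (P.compList_congr List.map_cons (by rw [List.flatMap_cons, List.map_append]) h').trans ?_
    rw [P.compList_cons_append (γ b) (l.map γ) ((F b).map φ) ((l.flatMap F).map φ) (h b) h'', ih h'',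
      List.map_cons]

section Blocks

variable {k n : ℕ} {p : Fin k → Fin n} {γ : Fin n → P.Op} {φ : Fin k → P.Op}

/-- If the fibers of a monotone map have the lengths of the sources of the operations `γ b`, then
the operations indexed by the fiber over `b` can be plugged into `γ b`. -/
theorem map_tgt_fiberList (hp : Monotone p)
    (h : ((List.finRange k).map φ).map P.tgt = ((List.finRange n).map γ).flatMap P.src)
    (hl : ∀ b, (fiberList p b).length = (P.src (γ b)).length) (b : Fin n) :
    ((fiberList p b).map φ).map P.tgt = P.src (γ b) := by
  refine eqOn_of_flatMap_eq (l := List.finRange n)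
    (f := fun b => ((fiberList p b).map φ).map P.tgt) (g := fun b => P.src (γ b)) ?_
    (fun b _ => by simp only [List.length_map, hl]) b (List.mem_finRange b)
  rw [List.flatMap_map] at h
  rw [← h]
  conv_rhs => rw [finRange_eq_flatMap_fiberList hp]
  simp only [List.map_flatMap]

/-- Composition of lists of operations in terms of the map which sends the position of an operation
to the position of the operation it is plugged into. -/
theorem compList_finRange (hp : Monotone p)
    (hb : ∀ b, ((fiberList p b).map φ).map P.tgt = P.src (γ b))
    (h : ((List.finRange k).map φ).map P.tgt = ((List.finRange n).map γ).flatMap P.src) :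
    P.compList ((List.finRange n).map γ) ((List.finRange k).map φ) h =
      (List.finRange n).map fun b => P.comp (γ b) ((fiberList p b).map φ) (hb b) :=
  (P.compList_congr rfl (congrArg (List.map φ) (finRange_eq_flatMap_fiberList hp)) h).trans
    (P.compList_flatMap _ _ _ _ hb _)

end Blocks

end OperadData

end ListNerve

/-! ### Simplicial functors to the monoidal envelope -/

namespace ListNerve

open Simplicial SimplicialArrow

variable {Q : SimplicialOperad.{w, u}} {C : Type u'} [Category.{u} C] [SimplicialCategory C]
  {m k : SimplexCategoryᵒᵖ}

/-- The list of operations that a simplicial functor to the monoidal envelope assigns to a simplex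
of a mapping space. -/
def ops (F : EnrichedFunctor SSet.{u} C (Envelope Q)) {x y : C} (f : (x ⟶[SSet.{u}] y).obj m) :
    List (Q.level m).Op :=
  Subtype.val (p := fun fs : List (Q.level m).Op =>
    fs.flatMap (Q.level m).src = (F.obj x).cols ∧ fs.map (Q.level m).tgt = (F.obj y).cols)
    ((F.map x y).app m f)

section

variable (F : EnrichedFunctor SSet.{u} C (Envelope Q)) {x y z : C}

theorem flatMap_src_ops (f : (x ⟶[SSet.{u}] y).obj m) :
    (ops F f).flatMap (Q.level m).src = (F.obj x).cols :=
  let g : (Envelope.homSpace (F.obj x) (F.obj y)).obj m := (F.map x y).app m f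
  g.2.1

theorem map_tgt_ops (f : (x ⟶[SSet.{u}] y).obj m) :
    (ops F f).map (Q.level m).tgt = (F.obj y).cols :=
  let g : (Envelope.homSpace (F.obj x) (F.obj y)).obj m := (F.map x y).app m f
  g.2.2

theorem length_ops (f : (x ⟶[SSet.{u}] y).obj m) : (ops F f).length = (F.obj y).cols.length := by
  rw [← map_tgt_ops F f, List.length_map]

theorem ops_map (p : m ⟶ k) (f : (x ⟶[SSet.{u}] y).obj m) :
    ops F ((x ⟶[SSet.{u}] y).map p f) = (ops F f).map (Q.map p).op :=
  congrArg (fun G => Subtype.val (p := fun fs : List (Q.level k).Op =>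
    fs.flatMap (Q.level k).src = (F.obj x).cols ∧ fs.map (Q.level k).tgt = (F.obj y).cols) (G f))
    ((F.map x y).naturality p)

theorem ops_idAt (x : C) : ops F (idAt x m) = (F.obj x).cols.map (Q.level m).one :=
  congrArg Subtype.val (map_idAt_enrichedFunctor F x)

theorem ops_compAt (f : (x ⟶[SSet.{u}] y).obj m) (g : (y ⟶[SSet.{u}] z).obj m) :
    ops F (compAt f g) = (Q.level m).compList (ops F g) (ops F f)
      ((map_tgt_ops F f).trans (flatMap_src_ops F g).symm) :=
  congrArg Subtype.val (map_compAt_enrichedFunctor F f g)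

end

theorem mk_eq_of_val_eq {a b a' b' : Envelope Q} (f : (Envelope.homSpace a b).obj m)
    (f' : (Envelope.homSpace a' b').obj m) (ha : a = a') (hb : b = b') (h : f.1 = f'.1) :
    SimplicialArrow.mk (C := Envelope Q) (src := a) (tgt := b) f =
      SimplicialArrow.mk (src := a') (tgt := b') f' := by
  subst ha hb
  exact congrArg _ (Subtype.ext h)

/-- A simplicial functor to the monoidal envelope is determined by its lists of colors and
operations. -/
theorem enrichedFunctor_envelope_ext {F G : EnrichedFunctor SSet.{u} C (Envelope Q)}
    (hobj : ∀ x, (F.obj x).cols = (G.obj x).cols)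
    (h : ∀ (m : SimplexCategoryᵒᵖ) (x y : C) (f : (x ⟶[SSet.{u}] y).obj m), ops F f = ops G f) :
    F = G :=
  enrichedFunctor_ext (fun x => Envelope.ext (hobj x)) fun m a =>
    mk_eq_of_val_eq _ _ (Envelope.ext (hobj _)) (Envelope.ext (hobj _)) (h m _ _ a.hom)

/-- The simplicial functor to the monoidal envelope with given lists of colors and operations. -/
def functorOfOps (obj : C → List Q.Col)
    (op : ∀ {m : SimplexCategoryᵒᵖ} {x y : C}, (x ⟶[SSet.{u}] y).obj m → List (Q.level m).Op)
    (hsrc : ∀ {m : SimplexCategoryᵒᵖ} {x y : C} (f : (x ⟶[SSet.{u}] y).obj m),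
      (op f).flatMap (Q.level m).src = obj x)
    (htgt : ∀ {m : SimplexCategoryᵒᵖ} {x y : C} (f : (x ⟶[SSet.{u}] y).obj m),
      (op f).map (Q.level m).tgt = obj y)
    (hmap : ∀ {m k : SimplexCategoryᵒᵖ} {x y : C} (p : m ⟶ k) (f : (x ⟶[SSet.{u}] y).obj m),
      op ((x ⟶[SSet.{u}] y).map p f) = (op f).map (Q.map p).op)
    (hid : ∀ (m : SimplexCategoryᵒᵖ) (x : C), op (idAt x m) = (obj x).map (Q.level m).one)
    (hcomp : ∀ {m : SimplexCategoryᵒᵖ} {x y z : C} (f : (x ⟶[SSet.{u}] y).obj m)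
      (g : (y ⟶[SSet.{u}] z).obj m), op (compAt f g) =
        (Q.level m).compList (op g) (op f) ((htgt f).trans (hsrc g).symm)) :
    EnrichedFunctor SSet.{u} C (Envelope Q) where
  obj x := ⟨obj x⟩
  map x y :=
    { app m := ↾fun f => ⟨op f, hsrc f, htgt f⟩
      naturality m k p := by
        ext f
        exact Subtype.ext (hmap p f) }
  map_id x := by
    ext m f
    exact Subtype.ext (hid m x)
  map_comp x y z := by
    ext m f
    exact Subtype.ext (hcomp f.1 f.2)

/-- The constant simplicial functor with value the empty list of colors, the unit of the monoidal
structure of the envelope. -/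
def unitFunctor (Q : SimplicialOperad.{w, u}) (C : Type u') [Category.{u} C]
    [SimplicialCategory C] : EnrichedFunctor SSet.{u} C (Envelope Q) :=
  functorOfOps (fun _ => []) (fun _ => []) (fun _ => rfl) (fun _ => rfl) (fun _ _ => rfl)
    (fun _ _ => rfl) (fun _ _ => rfl)

/-- The pointwise tensor product of simplicial functors to the monoidal envelope. -/
def tensorFunctor (F G : EnrichedFunctor SSet.{u} C (Envelope Q)) :
    EnrichedFunctor SSet.{u} C (Envelope Q) :=
  functorOfOps (fun x => (F.obj x).cols ++ (G.obj x).cols) (fun f => ops F f ++ ops G f)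
    (fun f => by rw [List.flatMap_append, flatMap_src_ops, flatMap_src_ops])
    (fun f => by rw [List.map_append, map_tgt_ops, map_tgt_ops])
    (fun p f => by rw [ops_map, ops_map, List.map_append])
    (fun m x => by rw [ops_idAt, ops_idAt, List.map_append])
    (fun {m x y z} f g => by
      refine ((congrArg₂ (· ++ ·) (ops_compAt F f g) (ops_compAt G f g))).trans ?_
      exact ((Q.level m).compList_append _ _ _ _ _ _).symm)

/-- The tensor product of a list of simplicial functors to the monoidal envelope. -/
def tensorList : List (EnrichedFunctor SSet.{u} C (Envelope Q)) →
    EnrichedFunctor SSet.{u} C (Envelope Q) :=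
  List.foldr tensorFunctor (unitFunctor Q C)

theorem cols_tensorList (L : List (EnrichedFunctor SSet.{u} C (Envelope Q))) (x : C) :
    ((tensorList L).obj x).cols = L.flatMap fun F => (F.obj x).cols := by
  induction L with
  | nil => rfl
  | cons F L ih => exact congrArg ((F.obj x).cols ++ ·) ih

theorem ops_tensorList (L : List (EnrichedFunctor SSet.{u} C (Envelope Q))) {x y : C}
    (f : (x ⟶[SSet.{u}] y).obj m) : ops (tensorList L) f = L.flatMap fun F => ops F f := by
  induction L with
  | nil => rfl
  | cons F L ih => exact congrArg (ops F f ++ ·) ih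

end ListNerve

/-! ### From the list nerve to the nerve of the monoidal envelope -/

namespace ListNerve

open Simplicial SimplicialArrow

variable {Q : SimplicialOperad.{w, u}} {n k : ℕ} {m m' : SimplexCategoryᵒᵖ}

theorem Shape.finRange_eq_flatMap_fiber (α : Shape n) {i j : Fin (n + 1)} (h : i ≤ j) :
    List.finRange (α.card i) = (List.finRange (α.card j)).flatMap (α.fiber h) :=
  finRange_eq_flatMap_fiberList (α.monotone h)

/-- The value of `x : 𝕍_α → Q` on the generator `(f, a)`. -/
noncomputable def genOp {α : Shape n} (x : SimplicialOperad.Hom (V.{u} α) Q) {i j : Thick.{u} n}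
    (f : (i ⟶[SSet.{u}] j).obj m) (a : Fin (α.card j.as.down)) : (Q.level m).Op :=
  (x.hom m).op (vGen ⟨f, a⟩)

section

variable {α : Shape n} (x : SimplicialOperad.Hom (V.{u} α) Q) {i j l : Thick.{u} n}

theorem src_genOp (f : (i ⟶[SSet.{u}] j).obj m) (a : Fin (α.card j.as.down)) :
    (Q.level m).src (genOp x f a) = (α.fiber (Thick.le f) a).map fun b => x.col ⟨_, b⟩ :=
  ((x.hom m).src_op _).trans List.map_map

theorem tgt_genOp (f : (i ⟶[SSet.{u}] j).obj m) (a : Fin (α.card j.as.down)) :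
    (Q.level m).tgt (genOp x f a) = x.col ⟨_, a⟩ :=
  (x.hom m).tgt_op _

theorem genOp_map (p : m ⟶ m') (f : (i ⟶[SSet.{u}] j).obj m) (a : Fin (α.card j.as.down)) :
    genOp x ((i ⟶[SSet.{u}] j).map p f) a = (Q.map p).op (genOp x f a) := by
  refine Eq.trans ?_ (x.naturality p (vGen ⟨f, a⟩))
  exact congrArg (fun g => (x.hom m').op (vGen ⟨g, a⟩)) (Thick.act_id p f).symm

theorem genOp_idAt (i : Thick.{u} n) (a : Fin (α.card i.as.down)) :
    genOp x (idAt i m) a = (Q.level m).one (x.col ⟨_, a⟩) :=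
  (congrArg (x.hom m).op (vGen_id i a)).trans ((x.hom m).op_one _)

theorem map_tgt_genOp (f : (i ⟶[SSet.{u}] j).obj m) (g : (j ⟶[SSet.{u}] l).obj m)
    (a : Fin (α.card l.as.down)) : ((α.fiber (Thick.le g) a).map (genOp x f)).map (Q.level m).tgt =
      (Q.level m).src (genOp x g a) :=
  (List.map_map.trans (List.map_congr_left fun b _ => tgt_genOp x f b)).trans (src_genOp x g a).symm

theorem genOp_compAt (f : (i ⟶[SSet.{u}] j).obj m) (g : (j ⟶[SSet.{u}] l).obj m)
    (a : Fin (α.card l.as.down)) : genOp x (compAt f g) a =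
      (Q.level m).comp (genOp x g a) ((α.fiber (Thick.le g) a).map (genOp x f))
        (map_tgt_genOp x f g a) := by
  refine (congrArg (x.hom m).op (vGen_comp f g a)).trans (((x.hom m).op_comp _ _ _).trans ?_)
  exact OperadData.comp_congr _ rfl List.map_map _

/-- The simplicial functor `𝚫ⁿ → 𝓛 Q` adjoint to `x : 𝕍_α → Q`: it sends `i` to the colors of the
elements of `Aᵢ`, and `f : i ⟶ j` to the operations `x (f, a)`, where `a` runs through `Aⱼ`. -/
noncomputable def adjoint : EnrichedFunctor SSet.{u} (Thick.{u} n) (Envelope Q) :=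
  functorOfOps (fun i => (List.finRange (α.card i.as.down)).map fun a => x.col ⟨_, a⟩)
    (fun {m i j} f => (List.finRange (α.card j.as.down)).map (genOp x f))
    (fun f => by
      rw [List.flatMap_map, α.finRange_eq_flatMap_fiber (Thick.le f), List.map_flatMap]
      exact congrArg (fun F => List.flatMap F _) (funext fun a => src_genOp x f a))
    (fun f => List.map_map.trans (List.map_congr_left fun a _ => tgt_genOp x f a))
    (fun p f => (List.map_congr_left fun a _ => genOp_map x p f a).trans List.map_map.symm)
    (fun m i => (List.map_congr_left fun a _ => genOp_idAt x i a).trans List.map_map.symm)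
    (fun f g => by
      refine Eq.trans ?_ ((Q.level _).compList_finRange (α.monotone (Thick.le g))
        (map_tgt_genOp x f g) _).symm
      exact List.map_congr_left fun a _ => genOp_compAt x f g a)

theorem cols_adjoint (i : Thick.{u} n) : ((adjoint x).obj i).cols =
    (List.finRange (α.card i.as.down)).map fun a => x.col ⟨_, a⟩ := rfl

theorem ops_adjoint (f : (i ⟶[SSet.{u}] j).obj m) :
    ops (adjoint x) f = (List.finRange (α.card j.as.down)).map (genOp x f) := rfl

end

/-- The restrictions of `x : 𝕍_α → Q` to the operads `𝕍` of the rooted components of `θ^* α`. -/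
noncomputable def components {α : Shape n} (x : SimplicialOperad.Hom (V.{u} α) Q)
    (θ : Fin (k + 1) →o Fin (n + 1)) : List (NerveSimplex Q k) :=
  (List.finRange ((α.pull θ).card (Fin.last k))).map fun a =>
    NerveSimplex.restrict x ((ShapeHom.pull α θ).comp (ShapeHom.root (α.pull θ) a))
      ((α.pull θ).root_isRooted a)

theorem genOp_restrict {α : Shape n} (x : SimplicialOperad.Hom (V.{u} α) Q) {β : Shape k}
    (F : ShapeHom β α) {i j : Thick.{u} k} (f : (i ⟶[SSet.{u}] j).obj m)
    (a : Fin (β.card j.as.down)) : genOp (x.comp (V.hom F)) f a =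
      genOp x (((Thick.functor F.θ).map i j).app m f) (F.φ _ a) :=
  have h : Thick.act F.θ (𝟙 m) f = ((Thick.functor F.θ).map i j).app m f :=
    congrArg (fun G => G (((Thick.functor F.θ).map i j).app m f))
      (((Thick.functor F.θ).obj i ⟶[SSet.{u}] (Thick.functor F.θ).obj j).map_id m)
  congrArg (fun e => (x.hom m).op (vGen e)) (ShapeHom.mk_congr h (F.φ j.as.down a))

/-- The simplicial functor corresponding to a list of simplices of the list nerve. -/
noncomputable def adjointList (L : List (NerveSimplex Q n)) :
    EnrichedFunctor SSet.{u} (Thick.{u} n) (Envelope Q) :=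
  tensorList (L.map fun x => adjoint x.hom)

theorem cols_adjointList (L : List (NerveSimplex Q n)) (i : Thick.{u} n) :
    ((adjointList L).obj i).cols = L.flatMap fun x => ((adjoint x.hom).obj i).cols :=
  (cols_tensorList _ _).trans (List.flatMap_map _ _ _)

theorem ops_adjointList (L : List (NerveSimplex Q n)) {i j : Thick.{u} n}
    (f : (i ⟶[SSet.{u}] j).obj m) :
    ops (adjointList L) f = L.flatMap fun x => ops (adjoint x.hom) f :=
  (ops_tensorList _ _).trans (List.flatMap_map _ _ _)

/-- The restriction along `θ` of the simplicial functor adjoint to `𝕍_α → Q` is the tensor product of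
the simplicial functors adjoint to the restrictions to the rooted components of `θ^* α`. -/
theorem adjointList_components {α : Shape n} (x : SimplicialOperad.Hom (V.{u} α) Q)
    (θ : Fin (k + 1) →o Fin (n + 1)) :
    adjointList (components x θ) = (Thick.functor θ).comp SSet.{u} (adjoint x) := by
  refine enrichedFunctor_envelope_ext (fun i => ?_) fun m i j f => ?_
  · rw [cols_adjointList, components, List.flatMap_map]
    refine Eq.trans ?_ ((congrArg (List.map fun a => x.col ⟨θ i.as.down, a⟩)
      (NerveSimplex.finRange_eq_flatMap (α.pull θ) i.as.down)).trans List.map_flatMap).symm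
    refine congrArg (fun F => List.flatMap F _) (funext fun a => ?_)
    refine Eq.trans ?_ List.map_map.symm
    rfl
  · rw [ops_adjointList, components, List.flatMap_map]
    refine Eq.trans ?_ ((congrArg (List.map (genOp x (((Thick.functor θ).map i j).app m f)))
      (NerveSimplex.finRange_eq_flatMap (α.pull θ) j.as.down)).trans List.map_flatMap).symm
    refine congrArg (fun F => List.flatMap F _) (funext fun a => ?_)
    refine Eq.trans ?_ List.map_map.symm
    exact List.map_congr_left fun b _ => genOp_restrict x _ f b

theorem comp_functor_id (F : EnrichedFunctor SSet.{u} (Thick.{u} n) (Envelope Q)) :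
    (Thick.functor OrderHom.id).comp SSet.{u} F = F := by
  have : Thick.functor.{u} (OrderHom.id : Fin (n + 1) →o Fin (n + 1)) = EnrichedFunctor.id _ _ :=
    SimplicialThickening.functor_id _
  rw [this]
  rfl

/-- Compatibility of `adjointList` with simplicial operators. -/
theorem adjointList_flatMap (L : List (NerveSimplex Q n)) (θ : Fin (k + 1) →o Fin (n + 1)) :
    adjointList (L.flatMap (NerveSimplex.act θ)) =
      (Thick.functor θ).comp SSet.{u} (adjointList L) := by
  have h (x : NerveSimplex Q n) := adjointList_components x.hom θ
  refine enrichedFunctor_envelope_ext (fun i => ?_) fun m i j f => ?_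
  · rw [cols_adjointList, List.flatMap_assoc]
    refine Eq.trans ?_ (cols_adjointList L ((Thick.functor θ).obj i)).symm
    refine congrArg (fun F => List.flatMap F _) (funext fun x => ?_)
    exact (cols_adjointList _ _).symm.trans (congrArg (fun F => (F.obj i).cols) (h x))
  · rw [ops_adjointList, List.flatMap_assoc]
    refine Eq.trans ?_ (ops_adjointList L (((Thick.functor θ).map i j).app m f)).symm
    refine congrArg (fun F => List.flatMap F _) (funext fun x => ?_)
    exact (ops_adjointList _ _).symm.trans (congrArg (fun F => ops F f) (h x))

/-- The map from lists of simplices of the list nerve to the simplices of the homotopy coherent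
nerve of the monoidal envelope. -/
noncomputable def toSimplicialNerve (Q : SimplicialOperad.{w, u}) :
    (listNerve Q).lists ⟶ SimplicialNerve (Envelope Q) where
  app m := ↾fun L => adjointList (n := m.unop.len) L
  naturality m m' p := by
    ext L
    exact adjointList_flatMap (n := m.unop.len) L p.unop.toOrderHom

end ListNerve

/-! ### Injectivity of the comparison map -/

namespace ListNerve

open Simplicial SimplicialArrow SimplicialThickening

variable {Q : SimplicialOperad.{w, u}} {n k : ℕ} {m m' : SimplexCategoryᵒᵖ}

/-- The `m`-simplex of the mapping space from `i` to `j` that is constant at the shortest path. -/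
def Thick.edge (i j : Thick.{u} n) (h : i.as.down ≤ j.as.down) (m : SimplexCategoryᵒᵖ) :
    (i ⟶[SSet.{u}] j).obj m :=
  mkChain (a := i) (b := j) (fun _ => {i.as, j.as}) (fun _ _ _ => le_rfl)
    (fun _ => Set.mem_insert _ _) (fun _ => Set.mem_insert_of_mem _ rfl) (fun _ l hl => by
      have h' : i.as ≤ j.as := h
      rcases hl with rfl | rfl
      exacts [⟨le_rfl, h'⟩, ⟨h', le_rfl⟩])

theorem Shape.eq_of_length_fiber {α β : Shape n} (hc : ∀ i, α.card i = β.card i)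
    (h : ∀ (i j : Fin (n + 1)) (hij : i ≤ j) (a : Fin (α.card j)),
      (α.fiber hij a).length = (β.fiber hij (Fin.cast (hc j) a)).length) : α = β := by
  obtain ⟨c, p, p1, p2, p3⟩ := α
  obtain ⟨c', p', p1', p2', p3'⟩ := β
  obtain rfl : c = c' := funext hc
  obtain rfl : @p = @p' := by
    funext i j hij
    exact monotone_ext (p1 hij) (p1' hij) (h i j hij)
  rfl

theorem length_src_genOp {α : Shape n} (x : SimplicialOperad.Hom (V.{u} α) Q) {i j : Thick.{u} n}
    (f : (i ⟶[SSet.{u}] j).obj m) (a : Fin (α.card j.as.down)) :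
    ((Q.level m).src (genOp x f a)).length = (α.fiber (Thick.le f) a).length := by
  rw [src_genOp, List.length_map]

theorem length_cols_adjoint {α : Shape n} (x : SimplicialOperad.Hom (V.{u} α) Q) (i : Thick.{u} n) :
    ((adjoint x).obj i).cols.length = α.card i.as.down := by
  rw [cols_adjoint, List.length_map, List.length_finRange]

theorem eq_of_map_finRange_eq {A : Type*} {a b : ℕ} (h : a = b) {f : Fin a → A} {g : Fin b → A}
    (hfg : (List.finRange a).map f = (List.finRange b).map g) (x : Fin a) :
    f x = g (Fin.cast h x) := by
  subst h
  exact List.map_inj_left.1 hfg x (List.mem_finRange x)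

theorem hom_ext_of_genOp {α : Shape n} {x y : SimplicialOperad.Hom (V.{u} α) Q}
    (hcol : ∀ (i : Fin (n + 1)) (a : Fin (α.card i)), x.col ⟨i, a⟩ = y.col ⟨i, a⟩)
    (h : ∀ (m : SimplexCategoryᵒᵖ) (i j : Thick.{u} n) (f : (i ⟶[SSet.{u}] j).obj m)
      (a : Fin (α.card j.as.down)), genOp x f a = genOp y f a) : x = y := by
  refine SimplicialOperad.Hom.ext' (funext fun a => hcol a.1 a.2) fun m => ?_
  have hcol' : x.col = y.col := funext fun a => hcol a.1 a.2
  replace h := h m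
  obtain ⟨c, X, _⟩ := x
  obtain ⟨c', Y, _⟩ := y
  obtain rfl : c = c' := hcol'
  exact vLevel_ext (X m) (Y m) fun e => h e.i e.j e.f e.a

/-- The shape `α` and the morphism `𝕍_α → Q` can be recovered from the adjoint simplicial
functor: the numbers of colors give the `Aᵢ`, and the lengths of the sources of the operations give
the fibers of the maps `Aᵢ → Aⱼ`, which determine these maps by monotonicity. -/
theorem adjoint_injective {α β : Shape n} {x : SimplicialOperad.Hom (V.{u} α) Q}
    {y : SimplicialOperad.Hom (V.{u} β) Q} (h : adjoint x = adjoint y) :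
    ∃ e : α = β, e ▸ x = y := by
  have hc (i : Fin (n + 1)) : α.card i = β.card i := by
    rw [← length_cols_adjoint x ⟨⟨i⟩⟩, h, length_cols_adjoint]
  have hop (m : SimplexCategoryᵒᵖ) (i j : Thick.{u} n) (f : (i ⟶[SSet.{u}] j).obj m)
      (a : Fin (α.card j.as.down)) : genOp x f a = genOp y f (Fin.cast (hc _) a) :=
    eq_of_map_finRange_eq (hc _) (by rw [← ops_adjoint, h, ops_adjoint]) a
  obtain rfl : α = β := Shape.eq_of_length_fiber hc fun i j hij a => by
    have := hop (op ⦋0⦌) ⟨⟨i⟩⟩ ⟨⟨j⟩⟩ (Thick.edge _ _ hij _) a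
    have := congrArg (fun o => ((Q.level (op ⦋0⦌)).src o).length) this
    simp only [length_src_genOp] at this
    exact this
  exact ⟨rfl, hom_ext_of_genOp (fun i a => eq_of_map_finRange_eq rfl
    (congrArg (fun F => (F.obj (⟨⟨i⟩⟩ : Thick.{u} n)).cols) h) a) hop⟩

theorem NerveSimplex.eq_of_adjoint_eq {x y : NerveSimplex Q n} (h : adjoint x.hom = adjoint y.hom) :
    x = y := by
  obtain ⟨α, hα, x⟩ := x
  obtain ⟨β, hβ, y⟩ := y
  obtain ⟨e, h⟩ := adjoint_injective h
  dsimp only at e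
  subst e
  obtain rfl : x = y := h
  rfl

theorem NerveSimplex.exists_ops_eq_singleton (x : NerveSimplex Q n) {i : Thick.{u} n}
    (f : (i ⟶[SSet.{u}] ⟨⟨Fin.last n⟩⟩).obj m) : ∃ o, ops (adjoint x.hom) f = [o] := by
  obtain ⟨a, ha⟩ := finRange_of_rooted x.isRooted
  exact ⟨genOp x.hom f a, (ops_adjoint x.hom f).trans (congrArg (List.map _) ha)⟩

/-- The first simplex of a list can be cut off from the associated simplicial functor: being
rooted, it contributes a single operation to the value on an arrow with end `n`, whose source tells
how many colors it contributes to the value on the origin of the arrow. -/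
theorem adjointList_injective : Function.Injective (adjointList (Q := Q) (n := n)) := by
  intro L
  induction L with
  | nil =>
    rintro (_ | ⟨y, M⟩) h
    · rfl
    · have e := congrArg (fun F => ops F (idAt (⟨⟨Fin.last n⟩⟩ : Thick.{u} n) (op ⦋0⦌))) h
      obtain ⟨o, ho⟩ := y.exists_ops_eq_singleton (idAt (⟨⟨Fin.last n⟩⟩ : Thick.{u} n) (op ⦋0⦌))
      simp only [ops_adjointList, List.flatMap_cons, ho] at e
      exact absurd e (by simp)
  | cons x L ih =>
    rintro (_ | ⟨y, M⟩) h
    · have e := congrArg (fun F => ops F (idAt (⟨⟨Fin.last n⟩⟩ : Thick.{u} n) (op ⦋0⦌))) h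
      obtain ⟨o, ho⟩ := x.exists_ops_eq_singleton (idAt (⟨⟨Fin.last n⟩⟩ : Thick.{u} n) (op ⦋0⦌))
      simp only [ops_adjointList, List.flatMap_cons, ho] at e
      exact absurd e (by simp)
    · have hobj (i : Thick.{u} n) :
          ((adjoint x.hom).obj i).cols = ((adjoint y.hom).obj i).cols := by
        let f := Thick.edge i ⟨⟨Fin.last n⟩⟩ (Fin.le_last _) (op ⦋0⦌)
        obtain ⟨o, ho⟩ := x.exists_ops_eq_singleton f
        obtain ⟨o', ho'⟩ := y.exists_ops_eq_singleton f
        have e := congrArg (fun F => ops F f) h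
        simp only [ops_adjointList, List.flatMap_cons, ho, ho'] at e
        rw [← flatMap_src_ops _ f, ← flatMap_src_ops _ f, ho, ho', (List.cons.inj e).1]
      have hops (m : SimplexCategoryᵒᵖ) (i j : Thick.{u} n) (f : (i ⟶[SSet.{u}] j).obj m) :
          ops (adjoint x.hom) f = ops (adjoint y.hom) f ∧
            ops (adjointList L) f = ops (adjointList M) f := by
        have e := congrArg (fun F => ops F f) h
        simp only [ops_adjointList, List.flatMap_cons] at e
        rw [ops_adjointList, ops_adjointList]
        exact List.append_inj e (by rw [length_ops, length_ops, hobj])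
      have hobj' (i : Thick.{u} n) : ((adjointList L).obj i).cols = ((adjointList M).obj i).cols := by
        rw [← map_tgt_ops _ (idAt i (op ⦋0⦌)), (hops _ _ _ _).2, map_tgt_ops]
      rw [NerveSimplex.eq_of_adjoint_eq
        (enrichedFunctor_envelope_ext hobj fun m i j f => (hops m i j f).1),
        ih (enrichedFunctor_envelope_ext hobj' fun m i j f => (hops m i j f).2)]

end ListNerve

/-! ### Surjectivity of the comparison map -/

namespace ListNerve

open Simplicial SimplicialArrow SimplicialThickening

variable {Q : SimplicialOperad.{w, u}} {n k : ℕ} {m m' : SimplexCategoryᵒᵖ}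

section

variable (F : EnrichedFunctor SSet.{u} (Thick.{u} n) (Envelope Q))

theorem map_src_ops_map {i j : Thick.{u} n} (p : m ⟶ m') (f : (i ⟶[SSet.{u}] j).obj m) :
    (ops F ((i ⟶[SSet.{u}] j).map p f)).map (Q.level m').src = (ops F f).map (Q.level m).src := by
  rw [ops_map, List.map_map]
  exact List.map_congr_left fun o _ => ((Q.map p).src_op o).trans (List.map_id _)

/-- The mapping spaces of `𝚫ⁿ` are connected, so the list of sources of the operations assigned to
an arrow depends on the ends of the arrow only. -/
theorem map_src_ops_eq {i j : Thick.{u} n} (f : (i ⟶[SSet.{u}] j).obj m) :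
    (ops F f).map (Q.level m).src =
      (ops F (Thick.edge i j (Thick.le f) (op ⦋0⦌))).map (Q.level (op ⦋0⦌)).src := by
  -- the edge from the shortest path to the first path of `f`
  let e : (i ⟶[SSet.{u}] j).obj (op ⦋1⦌) :=
    mkChain (a := i) (b := j) (m := op ⦋1⦌)
      (fun x => if x = 0 then {i.as, j.as} else pathAt (a := i) (b := j) f 0) (fun x y hxy => by
        by_cases hy : y = 0
        · subst hy
          rw [le_antisymm hxy (Fin.zero_le _)]
        · dsimp only
          rw [if_neg hy]
          split_ifs
          · rintro l (rfl | rfl)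
            exacts [left_mem_pathAt (a := i) (b := j) f 0, right_mem_pathAt (a := i) (b := j) f 0]
          · exact le_rfl)
      (fun x => by
        split_ifs
        exacts [Set.mem_insert _ _, left_mem_pathAt (a := i) (b := j) f 0])
      (fun x => by
        split_ifs
        exacts [Set.mem_insert_of_mem _ rfl, right_mem_pathAt (a := i) (b := j) f 0])
      (fun x l hl => by
        have h' : i.as ≤ j.as := Thick.le f
        split_ifs at hl
        · rcases hl with rfl | rfl
          exacts [⟨le_rfl, h'⟩, ⟨h', le_rfl⟩]
        · exact ⟨le_of_mem_pathAt (a := i) (b := j) f hl, ge_of_mem_pathAt (a := i) (b := j) f hl⟩)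
  have h0 : (i ⟶[SSet.{u}] j).map (SimplexCategory.const ⦋0⦌ ⦋1⦌ 0).op e =
      Thick.edge i j (Thick.le f) (op ⦋0⦌) := chain_ext (a := i) (b := j) fun _ => rfl
  have h1 : (i ⟶[SSet.{u}] j).map (SimplexCategory.const ⦋0⦌ ⦋1⦌ 1).op e =
      (i ⟶[SSet.{u}] j).map (SimplexCategory.const ⦋0⦌ m.unop 0).op f :=
    chain_ext (a := i) (b := j) fun _ => rfl
  rw [← h0, map_src_ops_map, ← map_src_ops_map F (SimplexCategory.const ⦋0⦌ ⦋1⦌ 1).op e, h1,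
    map_src_ops_map]

/-- The operation assigned to an arrow with end `j` at a position in the list of colors of `j`. -/
def opAt {i j : Thick.{u} n} (f : (i ⟶[SSet.{u}] j).obj m) (a : Fin (F.obj j).cols.length) :
    (Q.level m).Op :=
  (ops F f)[a.1]'(a.2.trans_eq (length_ops F f).symm)

theorem map_opAt {i j : Thick.{u} n} (f : (i ⟶[SSet.{u}] j).obj m) :
    (List.finRange (F.obj j).cols.length).map (opAt F f) = ops F f :=
  List.ext_getElem (by simp [length_ops]) fun a h1 h2 => by simp [opAt]

theorem map_get_cols (i : Thick.{u} n) :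
    (List.finRange (F.obj i).cols.length).map (F.obj i).cols.get = (F.obj i).cols := by
  simp

theorem tgt_opAt {i j : Thick.{u} n} (f : (i ⟶[SSet.{u}] j).obj m)
    (a : Fin (F.obj j).cols.length) : (Q.level m).tgt (opAt F f a) = (F.obj j).cols.get a := by
  have : (List.finRange _).map (fun a => (Q.level m).tgt (opAt F f a)) =
      (List.finRange _).map (F.obj j).cols.get := by
    refine List.map_map.symm.trans ?_
    rw [map_opAt, map_get_cols, map_tgt_ops]
  exact List.map_inj_left.1 this a (List.mem_finRange a)

theorem opAt_map {i j : Thick.{u} n} (p : m ⟶ m') (f : (i ⟶[SSet.{u}] j).obj m)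
    (a : Fin (F.obj j).cols.length) :
    opAt F ((i ⟶[SSet.{u}] j).map p f) a = (Q.map p).op (opAt F f a) := by
  simp only [opAt, ops_map, List.getElem_map]

theorem opAt_idAt (i : Thick.{u} n) (a : Fin (F.obj i).cols.length) :
    opAt F (idAt i m) a = (Q.level m).one ((F.obj i).cols.get a) := by
  simp [opAt, ops_idAt]

/-- The length of the source of the operation at a given position does not depend on the arrow. -/
theorem length_src_opAt {i j : Thick.{u} n} (f : (i ⟶[SSet.{u}] j).obj m)
    (a : Fin (F.obj j).cols.length) : ((Q.level m).src (opAt F f a)).length =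
      ((Q.level (op ⦋0⦌)).src (opAt F (Thick.edge i j (Thick.le f) (op ⦋0⦌)) a)).length := by
  have := List.getElem_of_eq (map_src_ops_eq F f) (i := a.1) (by simp [length_ops])
  simp only [List.getElem_map] at this
  exact congrArg List.length this

theorem sum_length_src_opAt {i j : Thick.{u} n} (f : (i ⟶[SSet.{u}] j).obj m) :
    ((List.finRange (F.obj j).cols.length).map fun a =>
      ((Q.level m).src (opAt F f a)).length).sum = (F.obj i).cols.length := by
  rw [← flatMap_src_ops F f, ← map_opAt F f, List.flatMap_map, List.length_flatMap]

theorem exists_blockMap (i j : Thick.{u} n) (h : i.as.down ≤ j.as.down) :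
    ∃ p : Fin (F.obj i).cols.length → Fin (F.obj j).cols.length, Monotone p ∧
      ∀ (m : SimplexCategoryᵒᵖ) (f : (i ⟶[SSet.{u}] j).obj m) a,
        (fiberList p a).length = ((Q.level m).src (opAt F f a)).length := by
  obtain ⟨p, hp, h⟩ := exists_monotone _
    (sum_length_src_opAt F (Thick.edge i j h (op ⦋0⦌)))
  exact ⟨p, hp, fun m f a => (h a).trans (length_src_opAt F f a).symm⟩

/-- For `i ≤ j`, the monotone map that sends a position in the list of colors of `i` to the position
of the operation having this color in its source. -/
noncomputable def blockMap (i j : Thick.{u} n) (h : i.as.down ≤ j.as.down) :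
    Fin (F.obj i).cols.length → Fin (F.obj j).cols.length :=
  (exists_blockMap F i j h).choose

theorem monotone_blockMap (i j : Thick.{u} n) (h : i.as.down ≤ j.as.down) :
    Monotone (blockMap F i j h) :=
  (exists_blockMap F i j h).choose_spec.1

theorem length_fiberList_blockMap {i j : Thick.{u} n} (f : (i ⟶[SSet.{u}] j).obj m)
    (a : Fin (F.obj j).cols.length) : (fiberList (blockMap F i j (Thick.le f)) a).length =
      ((Q.level m).src (opAt F f a)).length :=
  (exists_blockMap F i j (Thick.le f)).choose_spec.2 m f a

theorem map_tgt_fiberList_blockMap {i j l : Thick.{u} n} (f : (i ⟶[SSet.{u}] j).obj m)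
    (g : (j ⟶[SSet.{u}] l).obj m) (a : Fin (F.obj l).cols.length) :
    ((fiberList (blockMap F j l (Thick.le g)) a).map (opAt F f)).map (Q.level m).tgt =
      (Q.level m).src (opAt F g a) :=
  (Q.level m).map_tgt_fiberList (monotone_blockMap F j l _)
    (by rw [map_opAt, map_opAt, map_tgt_ops, flatMap_src_ops]) (length_fiberList_blockMap F g) a

theorem opAt_compAt {i j l : Thick.{u} n} (f : (i ⟶[SSet.{u}] j).obj m)
    (g : (j ⟶[SSet.{u}] l).obj m) (a : Fin (F.obj l).cols.length) :
    opAt F (compAt f g) a = (Q.level m).comp (opAt F g a)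
      ((fiberList (blockMap F j l (Thick.le g)) a).map (opAt F f))
      (map_tgt_fiberList_blockMap F f g a) := by
  have h : ((List.finRange _).map (opAt F f)).map (Q.level m).tgt =
      ((List.finRange _).map (opAt F g)).flatMap (Q.level m).src := by
    rw [map_opAt, map_opAt, map_tgt_ops, flatMap_src_ops]
  refine List.map_inj_left.1 (((map_opAt F (compAt f g)).trans (ops_compAt F f g)).trans
    (((Q.level m).compList_congr (map_opAt F g).symm (map_opAt F f).symm _).trans
      ((Q.level m).compList_finRange (monotone_blockMap F j l (Thick.le g))
        (map_tgt_fiberList_blockMap F f g) h))) a (List.mem_finRange a)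

theorem blockMap_refl (i : Thick.{u} n) : blockMap F i i le_rfl = id := by
  refine monotone_ext (monotone_blockMap F i i _) monotone_id fun a => ?_
  refine (length_fiberList_blockMap F (idAt i (op ⦋0⦌)) a).trans ?_
  rw [opAt_idAt, OperadData.src_one, ← count_map_finRange, List.map_id, List.length_singleton]
  exact (List.count_eq_one_of_mem (List.nodup_finRange _) (List.mem_finRange a)).symm

theorem blockMap_comp (i j l : Thick.{u} n) (h : i.as.down ≤ j.as.down)
    (h' : j.as.down ≤ l.as.down) :
    blockMap F j l h' ∘ blockMap F i j h = blockMap F i l (h.trans h') := by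
  let f := Thick.edge i j h (op ⦋0⦌)
  let g := Thick.edge j l h' (op ⦋0⦌)
  refine monotone_ext ((monotone_blockMap F j l h').comp (monotone_blockMap F i j h))
    (monotone_blockMap F i l _) fun a => ?_
  refine Eq.trans ?_ (length_fiberList_blockMap F (compAt f g) a).symm
  rw [length_fiberList_comp (monotone_blockMap F i j h), opAt_compAt, OperadData.src_comp,
    List.flatMap_map, List.length_flatMap]
  exact congrArg List.sum (List.map_congr_left fun b _ => length_fiberList_blockMap F f b)

/-- The simplex of the nerve of `Δ₊` underlying a simplicial functor `𝚫ⁿ → 𝓛 Q`. -/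
noncomputable def shapeOf : Shape n where
  card i := (F.obj ⟨⟨i⟩⟩).cols.length
  map {i j} h := blockMap F ⟨⟨i⟩⟩ ⟨⟨j⟩⟩ h
  monotone _ := monotone_blockMap F _ _ _
  map_refl i x := congrFun (blockMap_refl F ⟨⟨i⟩⟩) x
  map_map h h' x := congrFun (blockMap_comp F _ _ _ h h') x

/-- The operads of `m`-simplices of the morphism of simplicial operads with a given adjoint
simplicial functor. -/
noncomputable def levelHomOf (m : SimplexCategoryᵒᵖ) :
    OperadHom (vLevel.{u} (shapeOf F) m).toOperadData (Q.level m).toOperadData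
      fun a => (F.obj ⟨⟨a.1⟩⟩).cols.get a.2 :=
  vLift (fun e => opAt F e.f e.a)
    (fun e => by
      obtain ⟨f, a⟩ := e
      refine (map_tgt_fiberList_blockMap F (idAt _ m) f a).symm.trans ?_
      refine List.map_map.trans (Eq.trans ?_ List.map_map.symm)
      exact List.map_congr_left fun b _ => tgt_opAt F (idAt _ m) b)
    (fun e => tgt_opAt F e.f e.a) (fun i a => opAt_idAt F i a) (fun f g a _ => opAt_compAt F f g a)

/-- The morphism of simplicial operads with a given adjoint simplicial functor. -/
noncomputable def homOf : SimplicialOperad.Hom (V.{u} (shapeOf F)) Q where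
  col a := (F.obj ⟨⟨a.1⟩⟩).cols.get a.2
  hom := levelHomOf F
  naturality {m m'} p := vLevel_ext
    ((levelHomOf F m').comp ((ShapeHom.id (shapeOf F)).vMap p)) ((Q.map p).comp (levelHomOf F m))
    fun e => Eq.trans (congrArg (fun f => opAt F f e.a) (Thick.act_id p e.f)) (opAt_map F p e.f e.a)

theorem adjoint_homOf : adjoint (homOf F) = F := by
  refine enrichedFunctor_envelope_ext (fun i => ?_) fun m i j f => ?_
  · exact map_get_cols F i
  · exact map_opAt F f

end

/-- Every simplicial functor `𝚫ⁿ → 𝓛 Q` is adjoint to a morphism `𝕍_α → Q`, hence comes from the list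
of its restrictions to the rooted components of `α`. -/
theorem adjointList_surjective : Function.Surjective (adjointList (Q := Q) (n := n)) := fun F =>
  ⟨components (homOf F) OrderHom.id,
    (adjointList_components (homOf F) OrderHom.id).trans
      ((comp_functor_id _).trans (adjoint_homOf F))⟩

instance (Q : SimplicialOperad.{w, u}) : IsIso (toSimplicialNerve Q) := by
  refine (NatTrans.isIso_iff_isIso_app _).2 fun m => (isIso_iff_bijective _).2 ?_
  exact ⟨adjointList_injective, adjointList_surjective⟩

end ListNerve

/-! ### The list nerve is a quasi-operad -/

theorem SSet.Quasicategory.of_iso {X Y : SSet.{w}} (e : X ≅ Y) [SSet.Quasicategory X] :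
    SSet.Quasicategory Y := by
  refine ⟨fun {n i} σ h0 hn => ?_⟩
  obtain ⟨τ, hτ⟩ := SSet.Quasicategory.hornFilling' (σ ≫ e.inv) h0 hn
  exact ⟨τ ≫ e.hom, by rw [← Category.assoc, ← hτ, Category.assoc, e.inv_hom_id, Category.comp_id]⟩

theorem mainTheorem6 (Q : ListNerve.SimplicialOperad.{w, u})
    (hQ : ∀ (as : List Q.Col) (b : Q.Col), SSet.KanComplex (Q.opSpace as b)) :
    (ListNerve.listNerve Q).IsQuasiOperad ∧
      Nonempty ((ListNerve.listNerve Q).lists ≅ SimplicialNerve (ListNerve.Envelope Q)) ∧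
      SSet.Quasicategory (SimplicialNerve (ListNerve.Envelope Q)) := by
  have (a b : ListNerve.Envelope Q) : SSet.KanComplex (a ⟶[SSet.{u}] b) :=
    ListNerve.Envelope.kanComplex_homSpace hQ a b
  have hN := SimplicialNerve.quasicategory (C := ListNerve.Envelope Q)
  let e := asIso (ListNerve.toSimplicialNerve Q)
  refine ⟨⟨fun θ hθ x => ?_, SSet.Quasicategory.of_iso e.symm⟩, ⟨e⟩, hN⟩
  exact ListNerve.NerveSimplex.act_of_last θ.toOrderHom hθ x
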